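/- **Setting.** For $L\ge 1$ let $\Lambda_L=\mathbb Z\cap(-L/2,L/2]$ with arithmetic modulo $L$, let $\Lambda_L^*=\Lambda_L/L$, and let $\mathbb T=\mathbb R/\mathbb Z$, $L\mathbb T=\mathbb R/L\mathbb Z$. Let $\gamma>0$ and let $\Phi:\mathbb Z\to\mathbb R$ satisfy: $|\Phi(x)|\le c\,e^{-\delta|x|}$ for all $x$, for some $c,\delta>0$; $\Phi(-x)=\Phi(x)$; and, for some $\omega_0>0$, $\hat\Phi(k):=\sum_{x\in\mathbb Z}\Phi(x)e^{-i2\pi kx}\ge\omega_0^2$ for all $k\in\mathbb T$. Put $\omega(k)=\sqrt{\hat\Phi(k)}$. Assume that $\gamma^2>4\max_k\hat\Phi(k)$ and, with $u(k)=\sqrt{(\gamma/2)^2-\omega(k)^2}$, $\mu_{\pm1}(k)=\frac\gamma2\pm u(k)$ and $\hat A^2_t(k)=\frac1{2u(k)}\sum_{\sigma=\pm1}\sigma\mu_\sigma(k)e^{-t\mu_\sigma(k)}$ (the superscript $2$ on $A$ is an index), that for every $\varepsilon>0$ there is $C_\varepsilon>0$ with $$\int_0^\infty\!dt\int_{\mathbb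 T}\!dk\,\bigl(\hat A^2_t(k+\tfrac{k_0}2)-\hat A^2_t(k-\tfrac{k_0}2)\bigr)^2\ge C_\varepsilon\qquad\text{whenever }\varepsilon\le|k_0|\le\tfrac12 .$$ Define the real $\Lambda_L\times\Lambda_L$ matrix $(\Phi_L)_{x',x}=\frac1L\sum_{k\in\Lambda_L^*}\omega(k)^2e^{i2\pi k(x'-x)}$, the Hamiltonian $H_L(X)=\frac12\sum_{x}(X^2_x)^2+\frac12\sum_{x',x}X^1_{x'}X^1_x(\Phi_L)_{x',x}$ of $X=(X^1,X^2)\in\mathbb R^{\Lambda_L}\times\mathbb R^{\Lambda_L}$ (positions and momenta, $X^i_x$ with index $i$), and $$M_\gamma=\begin{pmatrix}0&\Phi_L\\-1&\gamma 1\end{pmatrix},\quad A^i_{t,x}=(e^{-tM_\gamma})^{i2}_{x0},\quad p_{t,x}=2\gamma\,(A^2_{t,-x})^2,\quad \tilde p_x=\frac\gamma2\int_0^\infty p_{s,x}\,ds,\quad \kappa_L=\sum_{y\in\Lambda_L}y^2\,\tilde p_y .$$ For a random initial field $X(0)$ all of whose second moments exist, let $\mathcal E=L^{-1}\langle H_L(X(0))\rangle$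 and $g_{t,x}=\sum_{i,i'=1}^2\sum_{y,y'\in\Lambda_L}A^i_{t,y}A^{i'}_{t,y'}\langle X(0)^{i'}_{x+y'}X(0)^i_{x+y}\rangle$. The temperature profile $T_{t,x}$ is the continuous solution of $$T_{t,x}=g_{t,x}+\int_0^t ds\sum_{y\in\Lambda_L}p_{s,y}\,T_{t-s,x-y},\qquad t\ge0,\ x\in\Lambda_L. \tag{1}$$ **Corollary.** For $\Phi$ and $\gamma$ as above there are $L_0\in\mathbb N$ and $C>0$, depending only on $\Phi$ and $\gamma$, such that for every $L\ge\max(1,L_0)$ one has $\kappa_L>0$, and for every initial field $X(0)$ all of whose second moments exist, equation (1) has a unique continuous solution $T$, and the following holds for every Schwartz function $\varphi\in\mathcal S(\mathbb R)$ and every $t_0>0$. Let the observed profile be $$T^{(\mathrm{obs})}(t,\xi)=\sum_{y\in\mathbb Z}\varphi(\xi-y)\,T_{t_0+t,\;y\bmod\Lambda_L},\qquad t\ge0,\ \xi\in L\mathbb T .$$ There is a unique $T^{(\mathrm{pred})}\in C^{2}([0,\infty)\times L\mathbb T)$ with $\partial_tT^{(\mathrm{pred})}=\kappa_L\,\partial_\xi^2T^{(\mathrm{pred})}$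 and $T^{(\mathrm{pred})}(0,\cdot)=T^{(\mathrm{obs})}(0,\cdot)$, and for all $t\ge0$ and $\xi\in L\mathbb T$ $$\bigl|T^{(\mathrm{pred})}(t,\xi)-T^{(\mathrm{obs})}(t,\xi)\bigr|\le C\,\mathcal E\,L\,t_0^{-3/2}\Bigl(\|\varphi\|_1+\sup_{\xi'\in\mathbb R}\sum_{y\in\mathbb Z}|\varphi(\xi'-y)|\Bigr)+C\,\mathcal E\sum_{n\in\mathbb Z,\,|n|\ge L/2}|\hat\varphi(n/L)|,$$ where $\hat\varphi(p)=\int_{\mathbb R}\varphi(x)e^{-i2\pi px}dx$. If in addition $\varphi\ge0$, $\int_{\mathbb R}\varphi(x)\,dx=1$ and $\hat\varphi(p)=0$ for all $|p|\ge\frac12$, then, with the same $C$, for all $t\ge0$ and $\xi\in L\mathbb T$ $$\bigl|T^{(\mathrm{pred})}(t,\xi)-T^{(\mathrm{obs})}(t,\xi)\bigr|\le 2C\,\mathcal E\,L\,t_0^{-3/2}.$$ -/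

import Mathlib

open Set MeasureTheory
open scoped FourierTransform SchwartzMap

namespace VelocityFlip

noncomputable section

/-! The periodic lattice with `L` sites is `ZMod L`. The site with residue class `x` has the integer
coordinate `x.valMinAbs`, which lies in `(-L/2, L/2]`; the class of an integer `y` is
`(y : ZMod L)`. -/

/-- The Fourier transform `∑ₓ Φ(x) exp(-i 2π k x)` of the interaction. It is written with the cosine,
as `Φ` is always symmetric, so that the sum is real. -/
def PhiHat (Φ : ℤ → ℝ) (k : ℝ) : ℝ :=
  ∑' x : ℤ, Φ x * Real.cos (2 * Real.pi * k * x)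

/-- The dispersion relation. -/
def omega (Φ : ℤ → ℝ) (k : ℝ) : ℝ :=
  √(PhiHat Φ k)

/-- Exponentially decaying, symmetric and pinning interactions. -/
structure IsInteraction (Φ : ℤ → ℝ) : Prop where
  decay : ∃ C > 0, ∃ δ > 0, ∀ x : ℤ, |Φ x| ≤ C * Real.exp (-δ * |(x : ℝ)|)
  symm : ∀ x : ℤ, Φ (-x) = Φ x
  pinning : ∃ ω₀ > 0, ∀ k : ℝ, ω₀ ^ 2 ≤ PhiHat Φ k

/-- `u(k) = √((γ/2)² - ω(k)²)`. -/
def uu (Φ : ℤ → ℝ) (γ k : ℝ) : ℝ :=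
  √((γ / 2) ^ 2 - omega Φ k ^ 2)

/-- The two relaxation rates `μ_σ(k) = γ/2 + σ u(k)`, `σ = ±1`. -/
def rate (Φ : ℤ → ℝ) (γ σ k : ℝ) : ℝ :=
  γ / 2 + σ * uu Φ γ k

/-- The function `Â²_t(k) = (2 u(k))⁻¹ ∑_{σ = ±1} σ μ_σ(k) exp(-t μ_σ(k))` (the superscript is an
index), in the regime `ω(k) < γ/2`. -/
def A2Hat (Φ : ℤ → ℝ) (γ t k : ℝ) : ℝ :=
  1 / (2 * uu Φ γ k) *
    (rate Φ γ 1 k * Real.exp (-t * rate Φ γ 1 k)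
      - rate Φ γ (-1) k * Real.exp (-t * rate Φ γ (-1) k))

/-- The noise dominates and the harmonic forces are nondegenerate. -/
structure IsAdmissible (Φ : ℤ → ℝ) (γ : ℝ) : Prop where
  interaction : IsInteraction Φ
  flip_pos : 0 < γ
  noise_dominates : ∀ k : ℝ, 4 * PhiHat Φ k < γ ^ 2
  nondegenerate : ∀ ε > 0, ∃ Cε > 0, ∀ k₀ : ℝ, ε ≤ |k₀| → |k₀| ≤ 1 / 2 →
    Cε ≤ ∫ t in Ioi (0 : ℝ), ∫ k in (-(1 / 2) : ℝ)..(1 / 2),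
      (A2Hat Φ γ t (k + k₀ / 2) - A2Hat Φ γ t (k - k₀ / 2)) ^ 2

/-- The finite volume interaction matrix: the translation invariant matrix which the discrete Fourier
transform diagonalizes to `ω(k)²` with `k = n/L` running through the dual lattice,
i.e. `L⁻¹ ∑ₖ ω(k)² exp(i 2π k (x' - x))`, which is real since `ω` is even. -/
def PhiL (Φ : ℤ → ℝ) (L : ℕ) [NeZero L] : Matrix (ZMod L) (ZMod L) ℝ :=
  Matrix.of fun x' x =>
    (1 / (L : ℝ)) * ∑ n : ZMod L, omega Φ ((n.valMinAbs : ℝ) / L) ^ 2 *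
      Real.cos (2 * Real.pi * ((n.valMinAbs : ℝ) / L) * ((x' - x).valMinAbs : ℝ))

/-- Phase space: `X (Sum.inl x)` is the position and `X (Sum.inr x)` the momentum at site `x`. -/
abbrev Phase (L : ℕ) : Type := ZMod L ⊕ ZMod L → ℝ

/-- The Hamiltonian. -/
def hamiltonian (Φ : ℤ → ℝ) (L : ℕ) [NeZero L] (X : Phase L) : ℝ :=
  (∑ x : ZMod L, 1 / 2 * X (Sum.inr x) ^ 2) +
    ∑ x' : ZMod L, ∑ x : ZMod L, 1 / 2 * X (Sum.inl x') * X (Sum.inl x) * PhiL Φ L x' x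

/-- The energy density of the initial distribution `μ`. -/
def energyDensity (Φ : ℤ → ℝ) (L : ℕ) [NeZero L] (μ : Measure (Phase L)) : ℝ :=
  (1 / (L : ℝ)) * ∫ X, hamiltonian Φ L X ∂μ

/-- All second moments of the initial field exist. -/
def HasSecondMoments {L : ℕ} (μ : Measure (Phase L)) : Prop :=
  ∀ a b : ZMod L ⊕ ZMod L, Integrable (fun X : Phase L => X a * X b) μ

/-- The generator matrix `M_γ` of the damped local dynamics. -/
def MM (Φ : ℤ → ℝ) (γ : ℝ) (L : ℕ) [NeZero L] :
    Matrix (ZMod L ⊕ ZMod L) (ZMod L ⊕ ZMod L) ℝ :=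
  Matrix.fromBlocks 0 (PhiL Φ L) (-1) (γ • (1 : Matrix (ZMod L) (ZMod L) ℝ))

/-- `A¹_{t,x}` (at `Sum.inl x`) and `A²_{t,x}` (at `Sum.inr x`): the entries `(i,x),(2,0)` of
`exp(-t M_γ)`. -/
def AA (Φ : ℤ → ℝ) (γ : ℝ) (L : ℕ) [NeZero L] (t : ℝ) (a : ZMod L ⊕ ZMod L) : ℝ :=
  NormedSpace.exp ((-t) • MM Φ γ L) a (Sum.inr 0)

/-- The memory kernel `p_{t,x} = 2 γ (A²_{t,-x})²`. -/
def memory (Φ : ℤ → ℝ) (γ : ℝ) (L : ℕ) [NeZero L] (t : ℝ) (x : ZMod L) : ℝ :=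
  2 * γ * AA Φ γ L t (Sum.inr (-x)) ^ 2

/-- Translation of the site of a coordinate by `x`. -/
def shift {L : ℕ} (x : ZMod L) : ZMod L ⊕ ZMod L → ZMod L ⊕ ZMod L :=
  Sum.map (fun y => x + y) (fun y => x + y)

/-- The source term
`g_{t,x} = ∑_{i,i',y,y'} A^i_{t,y} A^{i'}_{t,y'} ⟨X(0)^{i'}_{x+y'} X(0)^i_{x+y}⟩`. -/
def source (Φ : ℤ → ℝ) (γ : ℝ) (L : ℕ) [NeZero L] (μ : Measure (Phase L)) (t : ℝ)
    (x : ZMod L) : ℝ :=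
  ∑ a' : ZMod L ⊕ ZMod L, ∑ a : ZMod L ⊕ ZMod L,
    AA Φ γ L t a * AA Φ γ L t a' * ∫ X : Phase L, X (shift x a') * X (shift x a) ∂μ

/-- `T` is a continuous solution of the renewal equation for the kinetic temperature profile, with
initial distribution `μ`. Only its values at times `t ≥ 0` matter. -/
structure IsTemperatureProfile (Φ : ℤ → ℝ) (γ : ℝ) (L : ℕ) [NeZero L] (μ : Measure (Phase L))
    (T : ℝ → ZMod L → ℝ) : Prop where
  continuousOn : ∀ x : ZMod L, ContinuousOn (fun t => T t x) (Ici 0)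
  renewal : ∀ t ≥ 0, ∀ x : ZMod L,
    T t x = source Φ γ L μ t x +
      ∫ s in (0 : ℝ)..t, ∑ y : ZMod L, memory Φ γ L s y * T (t - s) (x - y)

/-- The jump weights `p̃_x = (γ/2) ∫₀^∞ p_{s,x} ds`. -/
def ptilde (Φ : ℤ → ℝ) (γ : ℝ) (L : ℕ) [NeZero L] (x : ZMod L) : ℝ :=
  γ / 2 * ∫ s in Ioi (0 : ℝ), memory Φ γ L s x

/-- The diffusion constant `κ_L = ∑_y y² p̃_y`. -/
def kappa (Φ : ℤ → ℝ) (γ : ℝ) (L : ℕ) [NeZero L] : ℝ :=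
  ∑ y : ZMod L, (y.valMinAbs : ℝ) ^ 2 * ptilde Φ γ L y

/-- The observed temperature profile, as an `L`-periodic function of `ξ`. -/
def Tobs {L : ℕ} (φ : 𝓢(ℝ, ℂ)) (T : ℝ → ZMod L → ℝ) (t₀ t ξ : ℝ) : ℂ :=
  ∑' y : ℤ, φ (ξ - y) * (T (t₀ + t) (y : ZMod L) : ℂ)

/-- `u ∈ C²([0,∞) × ℓ𝕋)` solves `∂ₜ u = κ ∂_ξ² u` with `u(0,·) = u₀`. Functions on the circle `ℓ𝕋`
are `ℓ`-periodic functions on the line; only the values at times `t ≥ 0` matter. -/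
structure IsHeatSolution (ℓ κ : ℝ) (u₀ : ℝ → ℂ) (u : ℝ → ℝ → ℂ) : Prop where
  periodic : ∀ t ≥ 0, Function.Periodic (u t) ℓ
  contDiffOn : ContDiffOn ℝ 2 (fun z : ℝ × ℝ => u z.1 z.2) (Ici 0 ×ˢ univ)
  heat : ∀ t ≥ 0, ∀ ξ : ℝ,
    derivWithin (fun s => u s ξ) (Ici 0) t = (κ : ℂ) * iteratedDeriv 2 (u t) ξ
  initial : ∀ ξ : ℝ, u 0 ξ = u₀ ξ

end

end VelocityFlip

/-! The discrete Fourier transform decouples the profile equation. The mode at k = n/L solves a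
scalar renewal equation f = g + q_n * f, whose kernel q_n (`kern`) averages products of two
single-mode responses with frequencies differing by k. Those responses are explicit (`mode`,
`IsAdmissible.AA_eq`). Since γ² > 4 max Φ̂ and Φ̂ is pinned, u(k) stays in a compact part [u₀, u₁]
of (0, γ/2), and this makes all estimates uniform in L.

Each squared response, times 2γ, has mass one and mean 1/γ, hence so has q_0. Responses with
different u decorrelate, so the L¹ norm of q_n is at most one minus a multiple of the mean squared
variation of Φ̂ under translation by k (`integral_abs_kern_le`). The nondegeneracy condition bounds
this variation from below when k stays away from 0 and L is large, and such modes decay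
exponentially (`renewal_decay`).

For small x = (2πk)², fourth moments of the memory kernel (`fourth_moment_le`) show that q_n differs
from q_0 by O(x) and has mass 1 - κ_L x/γ + O(x²). By continuity there is l = κ_L x + O(x²) with ∫
exp(ls) q_n(s) ds = 1 (`exists_rate`). Then exp(lt) f(t) solves a renewal equation with a kernel of
mass one and converges exponentially to a limit. This convergence needs no analysis of Laplace
transforms: a kernel q with primitive Q is compared with an exponential waiting time by means of d =
q - a(1 - Q), and if d has exponentially weighted L¹ norm below one, a contraction gives the limit
(`renewal_limit`). For q_0 the norm bound comes from `mode_hazard`, and it is stable under the small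
tilt (`tilted_hazard`). Consequently f(t₀ + t) equals exp(-κ_L x t) f(t₀) up to a multiple of x
exp(-c x t₀) + exp(-c t₀) (`renewal_modes`).

The source is the expectation of a square, and its sum over sites is at most K L 𝓔 exp(-mt), so the
mode estimates carry the factor L 𝓔. Poisson summation writes observation and prediction as series
over integers j with coefficients φ̂(j/L)/L times a mode. For |j| < L/2 the terms differ by the
diffusive error, which sums over the dual lattice to O(L t₀^(-3/2)). For |j| ≥ L/2 lattice mode and
heat mode need not match, and the uniform bound on the modes leaves the tail of φ̂. The heat flow is
the explicit Fourier series, unique by the maximum principle. -/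

namespace VelocityFlip

noncomputable section

/-! ### Scalar renewal equations -/

/-- A function dominated by its convolution with a kernel of exponentially weighted mass less than
one decays exponentially. -/
theorem norm_le_of_convolution_le {E : Type*} [NormedAddCommGroup E] {f : ℝ → E} {k : ℝ → ℝ}
    {δ θ G : ℝ} (hf : Continuous f) (hk : Continuous k) (hk0 : ∀ s ≥ 0, 0 ≤ k s)
    (hkI : IntegrableOn (fun s => Real.exp (δ * s) * k s) (Ioi 0))
    (hθ : ∫ s in Ioi (0 : ℝ), Real.exp (δ * s) * k s ≤ θ) (hθ1 : θ < 1)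
    (h : ∀ t ≥ 0, ‖f t‖ ≤ G * Real.exp (-δ * t) + ∫ s in (0 : ℝ)..t, k s * ‖f (t - s)‖) :
    ∀ t ≥ 0, ‖f t‖ ≤ G / (1 - θ) * Real.exp (-δ * t) := by
  intro t ht
  set g : ℝ → ℝ := fun τ => Real.exp (δ * τ) * ‖f τ‖ with hg
  have hgc : Continuous g := by fun_prop
  -- On a compact interval the weighted norm attains its maximum, so it is finite and can be
  -- absorbed into the left side as θ < 1. No prior growth bound is needed, and the sign of δ plays
  -- no role.
  obtain ⟨τ, hτ, hmax⟩ := isCompact_Icc.exists_isMaxOn (s := Icc 0 t) ⟨0, by simp [ht]⟩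
    hgc.continuousOn
  have hM0 : 0 ≤ g τ := by positivity
  have hker : ∫ s in (0 : ℝ)..τ, Real.exp (δ * s) * k s ≤ θ := by
    refine le_trans ?_ hθ
    rw [intervalIntegral.integral_of_le hτ.1]
    refine setIntegral_mono_set hkI ?_ (Filter.Eventually.of_forall fun s hs => hs.1)
    filter_upwards [ae_restrict_mem measurableSet_Ioi] with s hs
    have := hk0 s (le_of_lt hs)
    simp only [Pi.zero_apply]
    positivity
  have key : g τ ≤ G + θ * g τ := by
    have h1 : g τ ≤ Real.exp (δ * τ) * (G * Real.exp (-δ * τ)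
        + ∫ s in (0 : ℝ)..τ, k s * ‖f (τ - s)‖) :=
      mul_le_mul_of_nonneg_left (h τ hτ.1) (Real.exp_pos _).le
    have h2 : Real.exp (δ * τ) * ∫ s in (0 : ℝ)..τ, k s * ‖f (τ - s)‖
        = ∫ s in (0 : ℝ)..τ, (Real.exp (δ * s) * k s) * g (τ - s) := by
      rw [← intervalIntegral.integral_const_mul]
      refine intervalIntegral.integral_congr fun s _ => ?_
      simp only [hg]
      rw [show δ * τ = δ * s + δ * (τ - s) by ring, Real.exp_add]
      ring
    have h3 : ∫ s in (0 : ℝ)..τ, (Real.exp (δ * s) * k s) * g (τ - s)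
        ≤ ∫ s in (0 : ℝ)..τ, (Real.exp (δ * s) * k s) * g τ := by
      refine intervalIntegral.integral_mono_on hτ.1 (Continuous.intervalIntegrable (by fun_prop) _ _)
        (Continuous.intervalIntegrable (by fun_prop) _ _) fun s hs => ?_
      have hmem : τ - s ∈ Icc 0 t := ⟨by linarith [hs.2], by linarith [hs.1, hτ.2]⟩
      have := hk0 s hs.1
      exact mul_le_mul_of_nonneg_left (hmax hmem) (by positivity)
    rw [intervalIntegral.integral_mul_const] at h3
    have h4 : Real.exp (δ * τ) * (G * Real.exp (-δ * τ)) = G := by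
      rw [mul_left_comm, ← Real.exp_add]; simp
    rw [mul_add, h4, h2] at h1
    nlinarith [mul_le_mul_of_nonneg_right hker hM0]
  have h5 : g τ ≤ G / (1 - θ) := by
    rw [le_div_iff₀ (by linarith)]; linarith
  have h6 : g t ≤ G / (1 - θ) := (hmax (⟨ht, le_rfl⟩ : t ∈ Icc 0 t)).trans h5
  have h7 : ‖f t‖ = g t * Real.exp (-δ * t) := by
    simp only [hg]
    rw [mul_right_comm, ← Real.exp_add]; simp
  rw [h7]
  exact mul_le_mul_of_nonneg_right h6 (Real.exp_pos _).le

/-! ### Integrals of exponentially bounded functions -/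

theorem integral_exp_neg_mul_Ioi {m : ℝ} (hm : 0 < m) (c : ℝ) :
    ∫ s in Ioi c, Real.exp (-m * s) = Real.exp (-m * c) / m := by
  rw [integral_exp_mul_Ioi (by linarith)]; rw [neg_div_neg_eq]

theorem integrableOn_exp_neg_mul_Ioi {m : ℝ} (hm : 0 < m) (c : ℝ) :
    IntegrableOn (fun s => Real.exp (-m * s)) (Ioi c) :=
  integrableOn_exp_mul_Ioi (by linarith) c

/-- A continuous function that decays exponentially is integrable on half lines. -/
theorem integrableOn_Ioi_of_le_exp {E : Type*} [NormedAddCommGroup E] {f : ℝ → E}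
    (hf : Continuous f) {C m : ℝ} (hm : 0 < m) {c : ℝ} (hc : 0 ≤ c)
    (h : ∀ s ≥ 0, ‖f s‖ ≤ C * Real.exp (-m * s)) :
    IntegrableOn f (Ioi c) := by
  refine Integrable.mono' ((integrableOn_exp_neg_mul_Ioi hm c).const_mul C)
    hf.aestronglyMeasurable ?_
  filter_upwards [ae_restrict_mem measurableSet_Ioi] with s hs
  exact h s (hc.trans (le_of_lt hs))

theorem norm_integral_Ioi_le_of_le_exp {E : Type*} [NormedAddCommGroup E] [NormedSpace ℝ E]
    {f : ℝ → E} {C m : ℝ} (hm : 0 < m) {c : ℝ} (hc : 0 ≤ c)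
    (h : ∀ s ≥ 0, ‖f s‖ ≤ C * Real.exp (-m * s)) :
    ‖∫ s in Ioi c, f s‖ ≤ C / m * Real.exp (-m * c) := by
  have := norm_integral_le_of_norm_le ((integrableOn_exp_neg_mul_Ioi hm c).const_mul C)
    (f := f) (μ := volume.restrict (Ioi c)) (by
      filter_upwards [ae_restrict_mem measurableSet_Ioi] with s hs
      exact h s (hc.trans (le_of_lt hs)))
  rw [integral_const_mul, integral_exp_neg_mul_Ioi hm] at this
  calc _ ≤ _ := this
    _ = _ := by ring

theorem setIntegral_le_of_le_exp {f : ℝ → ℝ} {C m : ℝ} (hm : 0 < m)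
    (h : ∀ s ≥ 0, ‖f s‖ ≤ C * Real.exp (-m * s)) :
    ∫ s in Ioi (0 : ℝ), f s ≤ C / m := by
  have := norm_integral_Ioi_le_of_le_exp hm le_rfl h
  simp only [mul_zero, Real.exp_zero, mul_one] at this
  exact (le_abs_self _).trans this

/-- Every factor of time in the estimates is paid for, through this bound, by a fraction of the
decay rate. -/
theorem mul_exp_neg_le {a t : ℝ} (ha : 0 < a) : t * Real.exp (-a * t) ≤ 1 / a := by
  have h1 : a * t ≤ Real.exp (a * t) := by linarith [Real.add_one_le_exp (a * t)]
  have h2 : Real.exp (-a * t) = (Real.exp (a * t))⁻¹ := by rw [← Real.exp_neg]; ring_nf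
  rw [h2, ← div_eq_mul_inv, div_le_div_iff₀ (Real.exp_pos _) ha]
  linarith

theorem integral_eq_integral_Ioi_sub {E : Type*} [NormedAddCommGroup E] [NormedSpace ℝ E]
    {f : ℝ → E} (hf : IntegrableOn f (Ioi 0)) {t : ℝ} (ht : 0 ≤ t) :
    ∫ s in (0 : ℝ)..t, f s = (∫ s in Ioi 0, f s) - ∫ s in Ioi t, f s := by
  rw [intervalIntegral.integral_of_le ht, eq_sub_iff_add_eq,
    ← setIntegral_union (by
      rw [Set.disjoint_left]; intro x hx hx'; exact absurd hx.2 (not_le.mpr hx')) measurableSet_Ioi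
      (hf.mono_set fun x hx => hx.1) (hf.mono_set fun x hx => lt_of_le_of_lt ht hx),
    Ioc_union_Ioi_eq_Ioi ht]

/-- The tail `∫_t^∞ q` of a continuous integrable function has derivative `-q`. -/
theorem hasDerivAt_integral_zero {q : ℝ → ℝ} (hq : Continuous q) (t : ℝ) :
    HasDerivAt (fun t => ∫ s in (0 : ℝ)..t, q s) (q t) t :=
  intervalIntegral.integral_hasDerivAt_right (hq.intervalIntegrable _ _)
    hq.aestronglyMeasurable.stronglyMeasurableAtFilter hq.continuousAt

/-- The time integral of a causal convolution. -/
theorem integral_convolution {q : ℝ → ℝ} {h : ℝ → ℂ} (hq : Continuous q) (hh : Continuous h)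
    {t : ℝ} (ht : 0 ≤ t) :
    ∫ τ in (0 : ℝ)..t, ∫ s in (0 : ℝ)..τ, (q s : ℂ) * h (τ - s)
      = ∫ s in (0 : ℝ)..t, ((∫ r in (0 : ℝ)..s, q r : ℝ) : ℂ) * h (t - s) := by
  -- Extending h by zero to negative times puts the inner integral on the fixed interval (0, t], so
  -- that Fubini applies on a square.
  set g : ℝ → ℂ := (Ici (0 : ℝ)).indicator h with hg
  have hgm : Measurable g := hh.measurable.indicator measurableSet_Ici
  set H : ℝ → ℂ := fun t => ∫ r in (0 : ℝ)..t, h r with hH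
  have hHd : ∀ t, HasDerivAt H (h t) t := fun t =>
    intervalIntegral.integral_hasDerivAt_right (hh.intervalIntegrable _ _)
      hh.aestronglyMeasurable.stronglyMeasurableAtFilter hh.continuousAt
  have e1 : ∀ τ ∈ uIcc 0 t, ∫ s in (0 : ℝ)..τ, (q s : ℂ) * h (τ - s)
      = ∫ s in Ioc 0 t, (q s : ℂ) * g (τ - s) := by
    intro τ hτ
    rw [uIcc_of_le ht] at hτ
    rw [intervalIntegral.integral_of_le hτ.1]
    have : ∀ s ∈ Ioc 0 t, (q s : ℂ) * g (τ - s)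
        = (Ioc 0 τ).indicator (fun s => (q s : ℂ) * h (τ - s)) s := by
      intro s hs
      by_cases hst : s ≤ τ
      · rw [indicator_of_mem (show s ∈ Ioc 0 τ from ⟨hs.1, hst⟩), hg,
          indicator_of_mem (show τ - s ∈ Ici 0 by simpa using hst)]
      · rw [indicator_of_notMem (fun h' => hst h'.2), hg,
          indicator_of_notMem (by simpa using hst), mul_zero]
    rw [setIntegral_congr_fun measurableSet_Ioc this, setIntegral_indicator measurableSet_Ioc]
    congr 2
    ext s
    simp only [mem_inter_iff, mem_Ioc]
    constructor
    · exact fun h => ⟨⟨h.1, h.2.trans hτ.2⟩, h⟩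
    · exact fun h => h.2
  rw [intervalIntegral.integral_congr e1]
  obtain ⟨Cq, hCq⟩ := isCompact_Icc.exists_bound_of_continuousOn (s := Icc 0 t) hq.continuousOn
  obtain ⟨Ch, hCh⟩ := isCompact_Icc.exists_bound_of_continuousOn (s := Icc 0 t) hh.continuousOn
  have hCh0 : 0 ≤ Ch := (norm_nonneg _).trans (hCh 0 ⟨le_rfl, ht⟩)
  have hCq0 : 0 ≤ Cq := (norm_nonneg _).trans (hCq 0 ⟨le_rfl, ht⟩)
  rw [intervalIntegral_integral_swap]
  · rw [← intervalIntegral.integral_of_le ht]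
    have e2 : ∀ s ∈ uIcc 0 t, ∫ τ in (0 : ℝ)..t, (q s : ℂ) * g (τ - s) = (q s : ℂ) * H (t - s) := by
      intro s hs
      rw [uIcc_of_le ht] at hs
      rw [intervalIntegral.integral_const_mul, intervalIntegral.integral_comp_sub_right]
      congr 1
      have hi : IntervalIntegrable g volume (0 - s) 0 := by
        refine (intervalIntegrable_const (c := (0 : ℂ))).congr_ae ?_
        rw [Filter.EventuallyEq, ae_restrict_iff' measurableSet_uIoc]
        have h0 : ∀ᵐ x : ℝ, x ≠ 0 := by simp [ae_iff]
        filter_upwards [h0] with x hx0 hx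
        rw [uIoc_of_le (by linarith [hs.1])] at hx
        rw [hg, indicator_of_notMem]
        simp only [mem_Ici, not_le]
        exact lt_of_le_of_ne hx.2 hx0
      have hi2 : IntervalIntegrable g volume 0 (t - s) := by
        refine (hh.intervalIntegrable 0 (t - s)).congr_ae ?_
        rw [Filter.EventuallyEq, ae_restrict_iff' measurableSet_uIoc]
        refine Filter.Eventually.of_forall fun x hx => ?_
        rw [uIoc_of_le (by linarith [hs.2])] at hx
        rw [hg, indicator_of_mem (show x ∈ Ici 0 from hx.1.le)]
      rw [← intervalIntegral.integral_add_adjacent_intervals hi hi2]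
      have z1 : ∫ x in (0 - s)..0, g x = 0 := by
        refine intervalIntegral.integral_zero_ae ?_
        have h0 : ∀ᵐ x : ℝ, x ≠ 0 := by simp [ae_iff]
        filter_upwards [h0] with x hx0 hx
        rw [uIoc_of_le (by linarith [hs.1])] at hx
        rw [hg, indicator_of_notMem]
        simp only [mem_Ici, not_le]
        exact lt_of_le_of_ne hx.2 hx0
      rw [z1, zero_add, hH]
      refine intervalIntegral.integral_congr fun x hx => ?_
      rw [uIcc_of_le (by linarith [hs.2])] at hx
      simp only [hg]
      rw [indicator_of_mem (show x ∈ Ici 0 from hx.1)]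
    rw [intervalIntegral.integral_congr e2]
    have hQd : ∀ x, HasDerivAt (fun t => ((∫ s in (0 : ℝ)..t, q s : ℝ) : ℂ)) (q x : ℂ) x :=
      fun x => (hasDerivAt_integral_zero hq x).ofReal_comp
    have hHs : ∀ x, HasDerivAt (fun s => H (t - s)) (-h (t - x)) x := by
      intro x
      have := (hHd (t - x)).scomp x ((hasDerivAt_id x).const_sub t)
      simpa [Function.comp_def] using this
    -- After the swap the inner integral is the primitive H(t - s); integration by parts moves the
    -- primitive from h to q. The boundary terms vanish because both primitives vanish at 0.
    have ibp := intervalIntegral.integral_mul_deriv_eq_deriv_mul (a := 0) (b := t)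
      (fun x _ => hQd x) (fun x _ => hHs x)
      (Continuous.intervalIntegrable (by fun_prop) _ _)
      (Continuous.intervalIntegrable (by fun_prop) _ _)
    have hH0 : H 0 = 0 := by simp [hH]
    simp only [sub_self, hH0, mul_zero, intervalIntegral.integral_same, Complex.ofReal_zero,
      zero_mul, mul_neg, intervalIntegral.integral_neg, zero_sub] at ibp
    exact (neg_inj.mp ibp).symm
  · rw [uIoc_of_le ht]
    have : IsFiniteMeasure ((volume.restrict (Ioc 0 t)).prod (volume.restrict (Ioc 0 t))) := by
      infer_instance
    refine Integrable.of_bound (C := Cq * Ch) ?_ ?_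
    · refine Measurable.aestronglyMeasurable ?_
      have : Measurable fun p : ℝ × ℝ => (q p.2 : ℂ) * g (p.1 - p.2) :=
        (Complex.measurable_ofReal.comp (hq.measurable.comp measurable_snd)).mul
          (hgm.comp (measurable_fst.sub measurable_snd))
      exact this
    · rw [Measure.prod_restrict]
      filter_upwards [ae_restrict_mem (measurableSet_Ioc.prod measurableSet_Ioc)] with p hp
      have h1 : ‖(q p.2 : ℂ)‖ ≤ Cq := by
        rw [Complex.norm_real]; exact hCq _ ⟨hp.2.1.le, hp.2.2⟩
      have h2 : ‖g (p.1 - p.2)‖ ≤ Ch := by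
        by_cases h0 : 0 ≤ p.1 - p.2
        · rw [hg, indicator_of_mem (show p.1 - p.2 ∈ Ici 0 from h0)]
          exact hCh _ ⟨h0, by linarith [hp.1.2, hp.2.1]⟩
        · rw [hg, indicator_of_notMem (by simpa using h0)]
          simpa using hCh0
      simp only [Function.uncurry]
      rw [norm_mul]
      exact mul_le_mul h1 h2 (norm_nonneg _) hCq0

/-- Exponential convergence for a renewal equation whose kernel has mass one and is close to a
kernel with constant hazard rate `a`. -/
theorem renewal_limit {h g : ℝ → ℂ} {q : ℝ → ℝ} (hh : Continuous h) (hg : Continuous g)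
    (hq : Continuous q) {a δ S θ : ℝ} (ha : 0 < a) (hδ : 0 < δ) (hS : 0 ≤ S)
    (hgS : ∀ t ≥ 0, ‖g t‖ ≤ S * Real.exp (-δ * t))
    (hren : ∀ t ≥ 0, h t = g t + ∫ s in (0 : ℝ)..t, (q s : ℂ) * h (t - s))
    (hI : IntegrableOn (fun s => Real.exp (δ * s) * |q s - a * (1 - ∫ r in (0 : ℝ)..s, q r)|)
      (Ioi 0))
    (hθ : ∫ s in Ioi (0 : ℝ), Real.exp (δ * s) * |q s - a * (1 - ∫ r in (0 : ℝ)..s, q r)| ≤ θ)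
    (hθ1 : θ < 1) :
    ∃ l : ℂ, ‖l‖ ≤ a / δ / (1 - θ) * S ∧
      ∀ t ≥ 0, ‖h t - l‖ ≤ (1 + a / δ / (1 - θ)) / (1 - θ) * S * Real.exp (-δ * t) := by
  set Q : ℝ → ℝ := fun s => ∫ r in (0 : ℝ)..s, q r with hQ
  have hQc : Continuous Q :=
    continuous_iff_continuousAt.mpr fun t => (hasDerivAt_integral_zero hq t).continuousAt
  -- For a waiting time density q this is the defect from constant hazard rate a; it vanishes
  -- identically for q(s) = a exp(-as).
  set d : ℝ → ℝ := fun s => q s - a * (1 - Q s) with hd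
  have hdc : Continuous d := by fun_prop
  have hθ0 : 0 ≤ θ := le_trans (integral_nonneg fun s => by positivity) hθ
  have hI2 : IntegrableOn (fun s => Real.exp (δ * s) * |d s|) (Ioi 0) := hI
  have hdI : IntegrableOn d (Ioi 0) := by
    refine Integrable.mono' hI2 hdc.aestronglyMeasurable ?_
    filter_upwards [ae_restrict_mem measurableSet_Ioi] with s hs
    rw [Real.norm_eq_abs]
    have : 1 ≤ Real.exp (δ * s) := Real.one_le_exp (mul_nonneg hδ.le (le_of_lt hs))
    nlinarith [abs_nonneg (d s)]
  have htail : ∀ t ≥ 0, |∫ s in Ioi t, d s| ≤ θ * Real.exp (-δ * t) := by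
    intro t ht
    have h1 : |∫ s in Ioi t, d s| ≤ ∫ s in Ioi t, Real.exp (-δ * t) * (Real.exp (δ * s) * |d s|) := by
      rw [← Real.norm_eq_abs]
      refine norm_integral_le_of_norm_le ((hI2.mono_set (Ioi_subset_Ioi ht)).const_mul _) ?_
      filter_upwards [ae_restrict_mem measurableSet_Ioi] with s hs
      rw [Real.norm_eq_abs, ← mul_assoc, ← Real.exp_add]
      have : 1 ≤ Real.exp (-δ * t + δ * s) :=
        Real.one_le_exp (by nlinarith [mem_Ioi.mp hs])
      nlinarith [abs_nonneg (d s)]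
    rw [integral_const_mul] at h1
    have h2 : ∫ s in Ioi t, Real.exp (δ * s) * |d s| ≤ θ := by
      refine le_trans (setIntegral_mono_set hI2 ?_ ?_) hθ
      · exact Filter.Eventually.of_forall fun s => by simp only [Pi.zero_apply]; positivity
      · exact Filter.Eventually.of_forall fun s hs => lt_of_le_of_lt ht hs
    calc _ ≤ _ := h1
      _ ≤ Real.exp (-δ * t) * θ := mul_le_mul_of_nonneg_left h2 (Real.exp_pos _).le
      _ = _ := mul_comm _ _
  have hgI : IntegrableOn g (Ioi 0) := integrableOn_Ioi_of_le_exp hg hδ le_rfl hgS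
  set G : ℂ := ∫ s in Ioi (0 : ℝ), g s with hG
  set D : ℝ := ∫ s in Ioi (0 : ℝ), d s with hD
  have hDθ : |D| ≤ θ := by simpa using htail 0 le_rfl
  have hD1 : 1 - θ ≤ ‖(1 - D : ℂ)‖ := by
    rw [← Complex.ofReal_one, ← Complex.ofReal_sub, Complex.norm_real, Real.norm_eq_abs]
    have := (abs_le.mp hDθ).2
    rw [abs_of_nonneg (by linarith)]
    linarith
  have hD0 : (1 - D : ℂ) ≠ 0 := by
    intro h0; rw [h0, norm_zero] at hD1; linarith
  have hGn : ‖G‖ ≤ S / δ := by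
    simpa using norm_integral_Ioi_le_of_le_exp hδ le_rfl hgS
  -- Integrating the renewal equation gives (1 - Q) * h = ∫ g. Inserting q = d + a(1 - Q) therefore
  -- replaces the kernel q by d, of weighted mass below one, at the price of the additional source a
  -- ∫ g.
  have hren2 : ∀ t ≥ 0, h t = g t + a * (∫ s in (0 : ℝ)..t, g s)
      + ∫ s in (0 : ℝ)..t, (d s : ℂ) * h (t - s) := by
    intro t ht
    have e1 : ∫ s in (0 : ℝ)..t, h s = (∫ s in (0 : ℝ)..t, g s)
        + ∫ s in (0 : ℝ)..t, (Q s : ℂ) * h (t - s) := by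
      rw [← integral_convolution hq hh ht, ← intervalIntegral.integral_add
        (hg.intervalIntegrable _ _)]
      · refine intervalIntegral.integral_congr fun s hs => ?_
        rw [uIcc_of_le ht] at hs
        exact hren s hs.1
      · refine Continuous.intervalIntegrable ?_ _ _
        exact intervalIntegral.continuous_parametric_intervalIntegral_of_continuous
          (by simp only [Function.uncurry_def]; fun_prop) continuous_id
    have e2 : ∫ s in (0 : ℝ)..t, h (t - s) = ∫ s in (0 : ℝ)..t, h s := by
      rw [intervalIntegral.integral_comp_sub_left]; simp
    have e3 : ∫ s in (0 : ℝ)..t, (d s : ℂ) * h (t - s)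
        = (∫ s in (0 : ℝ)..t, (q s : ℂ) * h (t - s)) - a * (∫ s in (0 : ℝ)..t, h (t - s))
          + a * ∫ s in (0 : ℝ)..t, (Q s : ℂ) * h (t - s) := by
      rw [← intervalIntegral.integral_const_mul, ← intervalIntegral.integral_const_mul,
        ← intervalIntegral.integral_sub (Continuous.intervalIntegrable (by fun_prop) _ _)
          (Continuous.intervalIntegrable (by fun_prop) _ _),
        ← intervalIntegral.integral_add (Continuous.intervalIntegrable (by fun_prop) _ _)
          (Continuous.intervalIntegrable (by fun_prop) _ _)]
      refine intervalIntegral.integral_congr fun s _ => ?_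
      simp only [hd]
      push_cast
      ring
    rw [e3, e2, e1, hren t ht]
    ring
  -- Letting t → ∞ in `hren2` forces l = aG + lD.
  refine ⟨a * G / (1 - D), ?_, ?_⟩
  · rw [norm_div, norm_mul, Complex.norm_real, Real.norm_eq_abs, abs_of_pos ha]
    calc a * ‖G‖ / ‖(1 - D : ℂ)‖ ≤ a * (S / δ) / (1 - θ) := by
          have : 0 < 1 - θ := by linarith
          gcongr
      _ = _ := by ring
  · set l : ℂ := a * G / (1 - D) with hl
    have hlD : l = a * G + l * D := by rw [hl]; field_simp; ring
    have hln : ‖l‖ ≤ a / δ / (1 - θ) * S := by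
      rw [hl, norm_div, norm_mul, Complex.norm_real, Real.norm_eq_abs, abs_of_pos ha]
      calc a * ‖G‖ / ‖(1 - D : ℂ)‖ ≤ a * (S / δ) / (1 - θ) := by
            have : 0 < 1 - θ := by linarith
            gcongr
        _ = _ := by ring
    have hmain := norm_le_of_convolution_le (f := fun t => h t - l) (k := fun s => |d s|)
      (δ := δ) (θ := θ) (G := (1 + a / δ / (1 - θ)) * S) (by fun_prop) (by fun_prop)
      (fun s _ => abs_nonneg _) hI hθ hθ1 ?_
    · intro t ht
      refine (hmain t ht).trans (le_of_eq ?_)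
      ring
    · intro t ht
      -- Subtracting l = aG + lD from `hren2` leaves g and the tails of g and d as the source for h
      -- - l, all exponentially small.
      have e1 : h t - l = (g t - a * ∫ s in Ioi t, g s) - l * ((∫ s in Ioi t, d s : ℝ) : ℂ)
          + ∫ s in (0 : ℝ)..t, (d s : ℂ) * (h (t - s) - l) := by
        have e2 : ∫ s in (0 : ℝ)..t, (d s : ℂ) * (h (t - s) - l)
            = (∫ s in (0 : ℝ)..t, (d s : ℂ) * h (t - s)) - ((∫ s in (0 : ℝ)..t, d s : ℝ) : ℂ) * l := by
          rw [← intervalIntegral.integral_ofReal, ← intervalIntegral.integral_mul_const,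
            ← intervalIntegral.integral_sub (Continuous.intervalIntegrable (by fun_prop) _ _)
            (Continuous.intervalIntegrable (by fun_prop) _ _)]
          refine intervalIntegral.integral_congr fun s _ => ?_
          ring
        rw [e2, integral_eq_integral_Ioi_sub hdI ht, hren2 t ht,
          integral_eq_integral_Ioi_sub hgI ht]
        push_cast
        linear_combination -hlD
      have n1 : ‖g t - a * ∫ s in Ioi t, g s‖ ≤ (1 + a / δ) * S * Real.exp (-δ * t) := by
        have := norm_integral_Ioi_le_of_le_exp hδ ht hgS
        calc _ ≤ ‖g t‖ + ‖(a : ℂ) * ∫ s in Ioi t, g s‖ := norm_sub_le _ _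
          _ ≤ S * Real.exp (-δ * t) + a * (S / δ * Real.exp (-δ * t)) := by
            rw [norm_mul, Complex.norm_real, Real.norm_eq_abs, abs_of_pos ha]
            exact add_le_add (hgS t ht) (mul_le_mul_of_nonneg_left this ha.le)
          _ = _ := by ring
      have n2 : ‖l * ((∫ s in Ioi t, d s : ℝ) : ℂ)‖
          ≤ a / δ / (1 - θ) * S * (θ * Real.exp (-δ * t)) := by
        rw [norm_mul, Complex.norm_real, Real.norm_eq_abs]
        have : 0 < 1 - θ := by linarith
        exact mul_le_mul hln (htail t ht) (abs_nonneg _) (by positivity)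
      have n3 : ‖∫ s in (0 : ℝ)..t, (d s : ℂ) * (h (t - s) - l)‖
          ≤ ∫ s in (0 : ℝ)..t, |d s| * ‖h (t - s) - l‖ := by
        refine (intervalIntegral.norm_integral_le_integral_norm ht).trans (le_of_eq ?_)
        refine intervalIntegral.integral_congr fun s _ => ?_
        simp
      have n4 : (1 + a / δ) * S * Real.exp (-δ * t)
          + a / δ / (1 - θ) * S * (θ * Real.exp (-δ * t))
          = (1 + a / δ / (1 - θ)) * S * Real.exp (-δ * t) := by
        have : 1 - θ ≠ 0 := by linarith
        field_simp
        ring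
      rw [e1]
      calc _ ≤ ‖g t - a * ∫ s in Ioi t, g s‖ + ‖l * ((∫ s in Ioi t, d s : ℝ) : ℂ)‖
            + ‖∫ s in (0 : ℝ)..t, (d s : ℂ) * (h (t - s) - l)‖ :=
            (norm_add_le _ _).trans (add_le_add_left (norm_sub_le _ _) _)
        _ ≤ _ := by rw [← n4]; exact add_le_add (add_le_add n1 n2) n3

/-! ### Perturbation of a kernel of mass one -/

theorem exp_sub_one_sub_le {z : ℝ} : Real.exp z - 1 - z ≤ z ^ 2 * Real.exp z ∨ z < 0 := by
  rcases lt_or_ge z 0 with h | h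
  · exact Or.inr h
  · left
    have h1 : 1 - z ≤ Real.exp (-z) := by linarith [Real.add_one_le_exp (-z)]
    have h2 : Real.exp (-z) * Real.exp z = 1 := by rw [← Real.exp_add]; simp
    nlinarith [Real.exp_pos z, mul_le_mul_of_nonneg_right h1 (Real.exp_pos z).le,
      mul_le_mul_of_nonneg_right (mul_le_mul_of_nonneg_right h1 (Real.exp_pos z).le)
        (by linarith : (0 : ℝ) ≤ 1 + z)]

theorem exp_sub_one_le {z : ℝ} : Real.exp z - 1 ≤ z * Real.exp z := by
  have h1 : 1 - z ≤ Real.exp (-z) := by linarith [Real.add_one_le_exp (-z)]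
  have h2 : Real.exp (-z) * Real.exp z = 1 := by rw [← Real.exp_add]; simp
  nlinarith [Real.exp_pos z, mul_le_mul_of_nonneg_right h1 (Real.exp_pos z).le]

set_option maxHeartbeats 1000000 in
/-- The exponential rate of a small perturbation of a kernel of mass one. -/
theorem exists_rate {γ C₀ m C₁ C₂ κ₀ κ₁ : ℝ} (hγ : 0 < γ) (hC₀ : 0 < C₀) (hm : 0 < m)
    (hC₁ : 0 < C₁) (hC₂ : 0 < C₂) (hκ₀ : 0 < κ₀) (hκ₁ : 0 < κ₁) :
    ∃ ε > 0, ∃ C > 0, ∀ (q₀ q : ℝ → ℝ) (κ x : ℝ), Continuous q₀ → Continuous q →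
      (∀ s ≥ 0, |q₀ s| ≤ C₀ * Real.exp (-m * s)) →
      (∀ s ≥ 0, |q₀ s - q s| ≤ C₁ * x * Real.exp (-m * s)) →
      ∫ s in Ioi (0 : ℝ), q₀ s = 1 → ∫ s in Ioi (0 : ℝ), s * q₀ s = 1 / γ →
      |(∫ s in Ioi (0 : ℝ), (q₀ s - q s)) - κ * x / γ| ≤ C₂ * x ^ 2 →
      κ₀ ≤ κ → κ ≤ κ₁ → 0 ≤ x → x ≤ ε →
      ∃ l, κ₀ * x / 2 ≤ l ∧ l ≤ 2 * κ₁ * x ∧ l ≤ m / 4 ∧ |l - κ * x| ≤ C * x ^ 2 ∧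
        ∫ s in Ioi (0 : ℝ), Real.exp (l * s) * q s = 1 := by
  -- C₃ bounds the second order error of `hexpand`: C₂ for the mass, the rest for the pointwise
  -- remainder integrated at rate m/4. The four bounds on ε give, in turn, x ≤ 1, 2κ₁x ≤ m/4, and an
  -- error no larger than the margin at the lower and at the upper end of the bracket for l.
  set C₃ : ℝ := C₂ + ((2 * κ₁) ^ 2 * (C₀ + C₁) * (16 / m ^ 2) + 2 * κ₁ * C₁ * (4 / m)) * (4 / m)
    with hC₃
  have hC₃0 : 0 < C₃ := by positivity
  refine ⟨min 1 (min (m / (8 * κ₁)) (min (κ₀ / (2 * γ * C₃)) (κ₁ / (γ * C₃)))), by positivity,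
    γ * C₃, by positivity, ?_⟩
  intro q₀ q κ x hq₀c hqc hq₀ hqd h1 h2 h3 hκ hκ' hx0 hxε
  have hx1 : x ≤ 1 := hxε.trans (min_le_left _ _)
  have hx2 : x ≤ m / (8 * κ₁) := hxε.trans ((min_le_right _ _).trans (min_le_left _ _))
  have hx3 : x ≤ κ₀ / (2 * γ * C₃) :=
    hxε.trans ((min_le_right _ _).trans ((min_le_right _ _).trans (min_le_left _ _)))
  have hx4 : x ≤ κ₁ / (γ * C₃) :=
    hxε.trans ((min_le_right _ _).trans ((min_le_right _ _).trans (min_le_right _ _)))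
  have hxm : 2 * κ₁ * x ≤ m / 4 := by
    rw [le_div_iff₀ (by positivity)] at hx2; linarith
  have hqb : ∀ s ≥ 0, |q s| ≤ (C₀ + C₁) * Real.exp (-m * s) := by
    intro s hs
    have e : q s = q₀ s - (q₀ s - q s) := by ring
    rw [e]
    calc _ ≤ |q₀ s| + |q₀ s - q s| := abs_sub _ _
      _ ≤ C₀ * Real.exp (-m * s) + C₁ * x * Real.exp (-m * s) := add_le_add (hq₀ s hs) (hqd s hs)
      _ ≤ _ := by
        have : C₁ * x ≤ C₁ := by nlinarith
        nlinarith [Real.exp_pos (-m * s)]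
  have hsplit : ∀ s, Real.exp (-m * s) = Real.exp (-(m / 4) * s) * Real.exp (-(m / 4) * s)
      * Real.exp (-(m / 4) * s) * Real.exp (-(m / 4) * s) := by
    intro s; rw [← Real.exp_add, ← Real.exp_add, ← Real.exp_add]; congr 1; ring
  have hexp1 : ∀ s ≥ 0, Real.exp (-(m / 4) * s) ≤ 1 := by
    intro s hs
    rw [Real.exp_le_one_iff]
    nlinarith
  have hsexp : ∀ s, s * Real.exp (-(m / 4) * s) ≤ 4 / m := by
    intro s
    have := mul_exp_neg_le (a := m / 4) (t := s) (by positivity)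
    simpa using this
  have hlexp : ∀ l s, l ≤ m / 4 → 0 ≤ s → Real.exp (l * s) * Real.exp (-(m / 4) * s) ≤ 1 := by
    intro l s hl hs
    rw [← Real.exp_add, Real.exp_le_one_iff]
    nlinarith
  have hqexp : ∀ l, l ≤ m / 4 → ∀ s ≥ 0,
      ‖Real.exp (l * s) * q s‖ ≤ (C₀ + C₁) * Real.exp (-(m / 4) * s) := by
    intro l hl s hs
    rw [norm_mul, Real.norm_eq_abs, Real.norm_eq_abs, Real.abs_exp]
    have e0 := Real.exp_pos (-(m / 4) * s)
    calc Real.exp (l * s) * |q s| ≤ Real.exp (l * s) * ((C₀ + C₁) * Real.exp (-m * s)) :=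
          mul_le_mul_of_nonneg_left (hqb s hs) (Real.exp_pos _).le
      _ = (Real.exp (l * s) * Real.exp (-(m / 4) * s)) * (Real.exp (-(m / 4) * s)
          * Real.exp (-(m / 4) * s)) * ((C₀ + C₁) * Real.exp (-(m / 4) * s)) := by
          rw [hsplit]; ring
      _ ≤ 1 * (1 * 1) * ((C₀ + C₁) * Real.exp (-(m / 4) * s)) := by
          have := hexp1 s hs
          have := hlexp l s hl hs
          gcongr
      _ = _ := by ring
  have hsq₀ : ∀ s ≥ 0, ‖s * q₀ s‖ ≤ C₀ * (4 / m) * Real.exp (-(m / 4) * s) := by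
    intro s hs
    rw [norm_mul, Real.norm_eq_abs, Real.norm_eq_abs, abs_of_nonneg hs]
    have e0 := Real.exp_pos (-(m / 4) * s)
    calc s * |q₀ s| ≤ s * (C₀ * Real.exp (-m * s)) := mul_le_mul_of_nonneg_left (hq₀ s hs) hs
      _ = C₀ * (s * Real.exp (-(m / 4) * s)) * Real.exp (-(m / 4) * s) * (Real.exp (-(m / 4) * s)
          * Real.exp (-(m / 4) * s)) := by rw [hsplit]; ring
      _ ≤ C₀ * (4 / m) * Real.exp (-(m / 4) * s) * (1 * 1) := by
          have := hexp1 s hs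
          have := hsexp s
          gcongr
      _ = _ := by ring
  have hdI : ∀ s ≥ 0, ‖q₀ s - q s‖ ≤ C₁ * x * Real.exp (-m * s) := hqd
  have hm4 : 0 < m / 4 := by positivity
  -- Up to O(x²) the tilted mass is 1 - κx/γ + l/γ: q₀ has mass 1 and mean 1/γ, and passing to q
  -- lowers the mass by κx/γ.
  have hexpand : ∀ l, 0 ≤ l → l ≤ 2 * κ₁ * x →
      |(∫ s in Ioi (0 : ℝ), Real.exp (l * s) * q s) - 1 + κ * x / γ - l / γ| ≤ C₃ * x ^ 2 := by
    intro l hl0 hl1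
    have hlm : l ≤ m / 4 := hl1.trans hxm
    have I1 : IntegrableOn (fun s => Real.exp (l * s) * q s) (Ioi 0) :=
      integrableOn_Ioi_of_le_exp (by fun_prop) hm4 le_rfl (hqexp l hlm)
    have I2 : IntegrableOn (fun s => q₀ s) (Ioi 0) :=
      integrableOn_Ioi_of_le_exp hq₀c hm le_rfl hq₀
    have I3 : IntegrableOn (fun s => q₀ s - q s) (Ioi 0) :=
      integrableOn_Ioi_of_le_exp (by fun_prop) hm le_rfl hdI
    have I4 : IntegrableOn (fun s => s * q₀ s) (Ioi 0) :=
      integrableOn_Ioi_of_le_exp (by fun_prop) hm4 le_rfl hsq₀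
    -- The remainder consists of the quadratic part of the exponential against q and the cross term
    -- between tilt and perturbation; both are of order x² because l ≤ 2κ₁x.
    have e1 : (∫ s in Ioi (0 : ℝ), Real.exp (l * s) * q s) - 1
        + (∫ s in Ioi (0 : ℝ), (q₀ s - q s)) - l / γ
        = ∫ s in Ioi (0 : ℝ), ((Real.exp (l * s) - 1 - l * s) * q s - l * s * (q₀ s - q s)) := by
      have : (fun s => (Real.exp (l * s) - 1 - l * s) * q s - l * s * (q₀ s - q s))
          = fun s => Real.exp (l * s) * q s - q₀ s + (q₀ s - q s) - l * (s * q₀ s) := by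
        funext s; ring
      have I5 : IntegrableOn (fun s => Real.exp (l * s) * q s - q₀ s) (Ioi 0) := I1.sub I2
      have I6 : IntegrableOn (fun s => Real.exp (l * s) * q s - q₀ s + (q₀ s - q s)) (Ioi 0) :=
        I5.add I3
      rw [this, integral_sub I6 (I4.const_mul l),
        integral_add I5 I3, integral_sub I1 I2, integral_const_mul, h1, h2]
      ring
    have e2 : ∀ s ≥ 0, ‖(Real.exp (l * s) - 1 - l * s) * q s - l * s * (q₀ s - q s)‖
        ≤ (((2 * κ₁) ^ 2 * (C₀ + C₁) * (16 / m ^ 2) + 2 * κ₁ * C₁ * (4 / m)) * x ^ 2)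
          * Real.exp (-(m / 4) * s) := by
      intro s hs
      have hls : 0 ≤ l * s := mul_nonneg hl0 hs
      have a1 : |Real.exp (l * s) - 1 - l * s| ≤ (l * s) ^ 2 * Real.exp (l * s) := by
        rw [abs_of_nonneg (by linarith [Real.add_one_le_exp (l * s)])]
        rcases exp_sub_one_sub_le (z := l * s) with h | h
        · exact h
        · linarith
      have e0 := Real.exp_pos (-(m / 4) * s)
      have f1 := hexp1 s hs
      have f2 := hsexp s
      have f3 := hlexp l s hlm hs
      have a2 : |Real.exp (l * s) - 1 - l * s| * |q s|
          ≤ (2 * κ₁) ^ 2 * (C₀ + C₁) * (16 / m ^ 2) * x ^ 2 * Real.exp (-(m / 4) * s) := by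
        calc _ ≤ ((l * s) ^ 2 * Real.exp (l * s)) * ((C₀ + C₁) * Real.exp (-m * s)) :=
              mul_le_mul a1 (hqb s hs) (abs_nonneg _) (by positivity)
          _ = l ^ 2 * (C₀ + C₁) * ((s * Real.exp (-(m / 4) * s)) * (s * Real.exp (-(m / 4) * s)))
              * (Real.exp (l * s) * Real.exp (-(m / 4) * s)) * Real.exp (-(m / 4) * s) := by
              rw [hsplit]; ring
          _ ≤ (2 * κ₁ * x) ^ 2 * (C₀ + C₁) * ((4 / m) * (4 / m)) * 1
              * Real.exp (-(m / 4) * s) := by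
              have : 0 ≤ s * Real.exp (-(m / 4) * s) := by positivity
              gcongr
          _ = _ := by ring
      have a3 : l * s * |q₀ s - q s| ≤ 2 * κ₁ * C₁ * (4 / m) * x ^ 2 * Real.exp (-(m / 4) * s) := by
        calc _ ≤ l * s * (C₁ * x * Real.exp (-m * s)) :=
              mul_le_mul_of_nonneg_left (hqd s hs) hls
          _ = l * (C₁ * x) * (s * Real.exp (-(m / 4) * s)) * (Real.exp (-(m / 4) * s)
              * Real.exp (-(m / 4) * s)) * Real.exp (-(m / 4) * s) := by rw [hsplit]; ring
          _ ≤ (2 * κ₁ * x) * (C₁ * x) * (4 / m) * (1 * 1) * Real.exp (-(m / 4) * s) := by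
              have : 0 ≤ s * Real.exp (-(m / 4) * s) := by positivity
              gcongr
          _ = _ := by ring
      rw [Real.norm_eq_abs]
      calc _ ≤ |(Real.exp (l * s) - 1 - l * s) * q s| + |l * s * (q₀ s - q s)| := abs_sub _ _
        _ = |Real.exp (l * s) - 1 - l * s| * |q s| + l * s * |q₀ s - q s| := by
          rw [abs_mul, abs_mul (l * s), abs_of_nonneg hls]
        _ ≤ _ := add_le_add a2 a3
        _ = _ := by ring
    have e3 := norm_integral_Ioi_le_of_le_exp hm4 le_rfl e2
    rw [← e1, Real.norm_eq_abs] at e3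
    simp only [mul_zero, Real.exp_zero, mul_one] at e3
    have e4 : (∫ s in Ioi (0 : ℝ), Real.exp (l * s) * q s) - 1 + κ * x / γ - l / γ
        = ((∫ s in Ioi (0 : ℝ), Real.exp (l * s) * q s) - 1
          + (∫ s in Ioi (0 : ℝ), (q₀ s - q s)) - l / γ)
          - ((∫ s in Ioi (0 : ℝ), (q₀ s - q s)) - κ * x / γ) := by ring
    rw [e4]
    refine (abs_sub _ _).trans ((add_le_add e3 h3).trans (le_of_eq ?_))
    rw [hC₃]
    field_simp
    ring
  set P : ℝ → ℝ := fun l => ∫ s in Ioi (0 : ℝ), Real.exp (l * s) * q s with hP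
  have hlo_hi : κ₀ * x / 2 ≤ 2 * κ₁ * x := by
    have := mul_le_mul_of_nonneg_right (hκ.trans hκ') hx0
    have := mul_nonneg hκ₁.le hx0
    linarith
  have hPc : ContinuousOn P (Icc (κ₀ * x / 2) (2 * κ₁ * x)) := by
    refine continuousOn_of_dominated (bound := fun s => (C₀ + C₁) * Real.exp (-(m / 4) * s)) ?_ ?_
      ((integrableOn_exp_neg_mul_Ioi hm4 0).const_mul _) ?_
    · intro l _
      exact Continuous.aestronglyMeasurable (by fun_prop)
    · intro l hl
      filter_upwards [ae_restrict_mem measurableSet_Ioi] with s hs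
      exact hqexp l (hl.2.trans hxm) s (le_of_lt hs)
    · exact Filter.Eventually.of_forall fun s => by fun_prop
  have hlo : P (κ₀ * x / 2) ≤ 1 := by
    have h5 := (abs_le.mp (hexpand (κ₀ * x / 2) (by positivity) hlo_hi)).2
    have h6 : C₃ * x ^ 2 ≤ κ₀ * x / (2 * γ) := by
      rw [le_div_iff₀ (by positivity)] at hx3 ⊢
      calc C₃ * x ^ 2 * (2 * γ) = x * (2 * γ * C₃) * x := by ring
        _ ≤ κ₀ * x := mul_le_mul_of_nonneg_right hx3 hx0
    have h7 : κ₀ * x / 2 / γ = κ₀ * x / (2 * γ) := by field_simp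
    have h8 : 2 * (κ₀ * x / (2 * γ)) ≤ κ * x / γ := by
      rw [show 2 * (κ₀ * x / (2 * γ)) = κ₀ * x / γ by field_simp]
      gcongr
    simp only [hP]
    linarith
  have hhi : 1 ≤ P (2 * κ₁ * x) := by
    have h5 := (abs_le.mp (hexpand (2 * κ₁ * x) (by positivity) le_rfl)).1
    have h6 : C₃ * x ^ 2 ≤ κ₁ * x / γ := by
      rw [le_div_iff₀ (by positivity)] at hx4 ⊢
      calc C₃ * x ^ 2 * γ = x * (γ * C₃) * x := by ring
        _ ≤ κ₁ * x := mul_le_mul_of_nonneg_right hx4 hx0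
    have h7 : 2 * κ₁ * x / γ = 2 * (κ₁ * x / γ) := by ring
    have h8 : κ * x / γ ≤ κ₁ * x / γ := by gcongr
    simp only [hP]
    linarith
  -- The tilted mass crosses one inside the bracket, and the expansion at that point reads l = κx +
  -- O(x²).
  obtain ⟨l, hl, hPl⟩ := intermediate_value_Icc hlo_hi hPc ⟨hlo, hhi⟩
  refine ⟨l, hl.1, hl.2, hl.2.trans hxm, ?_, hPl⟩
  have h5 := hexpand l (le_trans (by positivity) hl.1) hl.2
  simp only [hP] at hPl
  rw [hPl, show (1 : ℝ) - 1 + κ * x / γ - l / γ = -((l - κ * x) / γ) by ring, abs_neg, abs_div,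
    abs_of_pos hγ, div_le_iff₀ hγ] at h5
  linarith

theorem abs_exp_neg_sub_exp_neg_le {A B M : ℝ} (hA : M ≤ A) (hB : M ≤ B) :
    |Real.exp (-A) - Real.exp (-B)| ≤ |A - B| * Real.exp (-M) := by
  have key : ∀ A B : ℝ, M ≤ A → A ≤ B →
      |Real.exp (-A) - Real.exp (-B)| ≤ |A - B| * Real.exp (-M) := by
    intro A B hA hAB
    have h1 : Real.exp (-B) = Real.exp (-A) * Real.exp (-(B - A)) := by
      rw [← Real.exp_add]; congr 1; ring
    have h2 : 1 - (B - A) ≤ Real.exp (-(B - A)) := by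
      linarith [Real.add_one_le_exp (-(B - A))]
    have h3 : Real.exp (-(B - A)) ≤ 1 := by rw [Real.exp_le_one_iff]; linarith
    have h4 : Real.exp (-A) ≤ Real.exp (-M) := Real.exp_le_exp.mpr (by linarith)
    rw [h1, show Real.exp (-A) - Real.exp (-A) * Real.exp (-(B - A))
      = Real.exp (-A) * (1 - Real.exp (-(B - A))) by ring, abs_mul, Real.abs_exp,
      abs_of_nonneg (by linarith : 0 ≤ 1 - Real.exp (-(B - A))), abs_sub_comm,
      abs_of_nonneg (by linarith : 0 ≤ B - A), mul_comm]
    exact mul_le_mul (by linarith) h4 (Real.exp_pos _).le (by linarith)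
  rcases le_total A B with h | h
  · exact key A B hA h
  · rw [abs_sub_comm, abs_sub_comm A]; exact key B A hB h

/-- The tilted kernel stays close to a kernel with constant hazard rate. -/
theorem tilted_hazard {C₀ m C₁ κ₁ a η : ℝ} (hC₀ : 0 < C₀) (hm : 0 < m)
    (hC₁ : 0 < C₁) (hκ₁ : 0 < κ₁) (ha : 0 < a) (hη : 0 < η) :
    ∃ ε > 0, ∃ δ > 0, δ ≤ m / 4 ∧ ∀ (q₀ q : ℝ → ℝ) (x l : ℝ), Continuous q₀ → Continuous q →
      (∀ s ≥ 0, |q₀ s| ≤ C₀ * Real.exp (-m * s)) →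
      (∀ s ≥ 0, |q₀ s - q s| ≤ C₁ * x * Real.exp (-m * s)) →
      ∫ s in Ioi (0 : ℝ), q₀ s = 1 →
      ∫ s in Ioi (0 : ℝ), |q₀ s - a * (1 - ∫ r in (0 : ℝ)..s, q₀ r)| ≤ 1 - η →
      0 ≤ l → l ≤ 2 * κ₁ * x → l ≤ m / 4 →
      ∫ s in Ioi (0 : ℝ), Real.exp (l * s) * q s = 1 → 0 ≤ x → x ≤ ε →
      IntegrableOn (fun s => Real.exp (δ * s) * |Real.exp (l * s) * q s
        - a * (1 - ∫ r in (0 : ℝ)..s, Real.exp (l * r) * q r)|) (Ioi 0) ∧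
      ∫ s in Ioi (0 : ℝ), Real.exp (δ * s) * |Real.exp (l * s) * q s
        - a * (1 - ∫ r in (0 : ℝ)..s, Real.exp (l * r) * q r)| ≤ 1 - η / 2 := by
  set C₄ : ℝ := C₁ + 2 * κ₁ * C₀ * (4 / m) with hC₄
  have hC₄0 : 0 < C₄ := by positivity
  set D₀ : ℝ := C₀ * (1 + a / m) with hD₀
  have hD₀0 : 0 < D₀ := by positivity
  set D₁ : ℝ := C₄ * (1 + 2 * a / m) with hD₁
  have hD₁0 : 0 < D₁ := by positivity
  have hm4 : 0 < m / 4 := by positivity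
  have hm2 : 0 < m / 2 := by positivity
  -- The bounds on x and on δ are such that perturbing the kernel and inserting the weight exp(δs)
  -- cost at most η/4 each.
  refine ⟨η * m / (16 * D₁), by positivity, min (m / 4) (η * m ^ 2 / (64 * D₀)), by positivity,
    min_le_left _ _, ?_⟩
  set δ : ℝ := min (m / 4) (η * m ^ 2 / (64 * D₀)) with hδ
  intro q₀ q x l hq₀c hqc hq₀ hqd h1 h2 hl0 hl1 hl2 hl hx0 hxε
  have hδ0 : 0 < δ := by positivity
  have hδm : δ ≤ m / 4 := min_le_left _ _
  have hδη : δ ≤ η * m ^ 2 / (64 * D₀) := min_le_right _ _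
  have hsplit : ∀ s, Real.exp (-m * s) = Real.exp (-(m / 4) * s) * Real.exp (-(m / 4) * s)
      * Real.exp (-(m / 4) * s) * Real.exp (-(m / 4) * s) := by
    intro s; rw [← Real.exp_add, ← Real.exp_add, ← Real.exp_add]; congr 1; ring
  have hsplit2 : ∀ s, Real.exp (-(m / 2) * s)
      = Real.exp (-(m / 4) * s) * Real.exp (-(m / 4) * s) := by
    intro s; rw [← Real.exp_add]; congr 1; ring
  have hexp1 : ∀ s ≥ 0, Real.exp (-(m / 4) * s) ≤ 1 := by
    intro s hs
    rw [Real.exp_le_one_iff]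
    nlinarith
  have hsexp : ∀ s, s * Real.exp (-(m / 4) * s) ≤ 4 / m := by
    intro s
    have := mul_exp_neg_le (a := m / 4) (t := s) (by positivity)
    simpa using this
  have hlexp : ∀ l s, l ≤ m / 4 → 0 ≤ s → Real.exp (l * s) * Real.exp (-(m / 4) * s) ≤ 1 := by
    intro l s hl hs
    rw [← Real.exp_add, Real.exp_le_one_iff]
    nlinarith
  set p : ℝ → ℝ := fun s => Real.exp (l * s) * q s with hp
  have hpc : Continuous p := by fun_prop
  -- As l is itself O(x), tilting keeps the kernel within O(x) of q₀, at half of the decay rate.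
  have hpq : ∀ s ≥ 0, ‖p s - q₀ s‖ ≤ C₄ * x * Real.exp (-(m / 2) * s) := by
    intro s hs
    have e0 := Real.exp_pos (-(m / 4) * s)
    have f1 := hexp1 s hs
    have f2 := hsexp s
    have f3 := hlexp l s hl2 hs
    have f4 : 0 ≤ s * Real.exp (-(m / 4) * s) := by positivity
    have b1 : Real.exp (l * s) * |q₀ s - q s| ≤ C₁ * x * Real.exp (-(m / 2) * s) := by
      calc _ ≤ Real.exp (l * s) * (C₁ * x * Real.exp (-m * s)) :=
            mul_le_mul_of_nonneg_left (hqd s hs) (Real.exp_pos _).le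
        _ = C₁ * x * (Real.exp (l * s) * Real.exp (-(m / 4) * s)) * Real.exp (-(m / 4) * s)
            * Real.exp (-(m / 2) * s) := by rw [hsplit, hsplit2]; ring
        _ ≤ C₁ * x * 1 * 1 * Real.exp (-(m / 2) * s) := by gcongr
        _ = _ := by ring
    have b2 : (Real.exp (l * s) - 1) * |q₀ s|
        ≤ 2 * κ₁ * C₀ * (4 / m) * x * Real.exp (-(m / 2) * s) := by
      calc _ ≤ (l * s * Real.exp (l * s)) * (C₀ * Real.exp (-m * s)) :=
            mul_le_mul exp_sub_one_le (hq₀ s hs) (abs_nonneg _) (by positivity)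
        _ = l * C₀ * (s * Real.exp (-(m / 4) * s)) * (Real.exp (l * s) * Real.exp (-(m / 4) * s))
            * Real.exp (-(m / 2) * s) := by rw [hsplit, hsplit2]; ring
        _ ≤ (2 * κ₁ * x) * C₀ * (4 / m) * 1 * Real.exp (-(m / 2) * s) := by gcongr
        _ = _ := by ring
    have e1 : p s - q₀ s = (Real.exp (l * s) - 1) * q₀ s - Real.exp (l * s) * (q₀ s - q s) := by
      simp only [hp]; ring
    rw [e1, Real.norm_eq_abs]
    have hge : 0 ≤ Real.exp (l * s) - 1 := by
      linarith [Real.one_le_exp (mul_nonneg hl0 hs)]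
    calc _ ≤ |(Real.exp (l * s) - 1) * q₀ s| + |Real.exp (l * s) * (q₀ s - q s)| := abs_sub _ _
      _ = (Real.exp (l * s) - 1) * |q₀ s| + Real.exp (l * s) * |q₀ s - q s| := by
        rw [abs_mul, abs_mul, Real.abs_exp, abs_of_nonneg hge]
      _ ≤ _ := add_le_add b2 b1
      _ = _ := by rw [hC₄]; ring
  have Iq₀ : IntegrableOn q₀ (Ioi 0) := integrableOn_Ioi_of_le_exp hq₀c hm le_rfl hq₀
  have Ipq : IntegrableOn (fun s => p s - q₀ s) (Ioi 0) :=
    integrableOn_Ioi_of_le_exp (by fun_prop) hm2 le_rfl hpq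
  have Ip : IntegrableOn p (Ioi 0) := by
    have := Ipq.add Iq₀
    refine this.congr (Filter.Eventually.of_forall fun s => ?_)
    simp
  set d : ℝ → ℝ := fun s => p s - a * (1 - ∫ r in (0 : ℝ)..s, p r) with hd
  set d₀ : ℝ → ℝ := fun s => q₀ s - a * (1 - ∫ r in (0 : ℝ)..s, q₀ r) with hd₀
  have cint : ∀ q : ℝ → ℝ, Continuous q → Continuous fun s => ∫ r in (0 : ℝ)..s, q r :=
    fun q hq => continuous_iff_continuousAt.mpr fun t => (hasDerivAt_integral_zero hq t).continuousAt
  have hdc : Continuous d := by have := cint p hpc; fun_prop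
  have hd₀c : Continuous d₀ := by have := cint q₀ hq₀c; fun_prop
  have hd₀b : ∀ s ≥ 0, ‖d₀ s‖ ≤ D₀ * Real.exp (-m * s) := by
    intro s hs
    have t1 := norm_integral_Ioi_le_of_le_exp (f := q₀) hm hs hq₀
    have e1 : d₀ s = q₀ s - a * ∫ r in Ioi s, q₀ r := by
      simp only [hd₀]
      rw [integral_eq_integral_Ioi_sub Iq₀ hs, h1]; ring
    rw [e1]
    calc _ ≤ ‖q₀ s‖ + ‖a * ∫ r in Ioi s, q₀ r‖ := norm_sub_le _ _
      _ = ‖q₀ s‖ + a * ‖∫ r in Ioi s, q₀ r‖ := by rw [norm_mul, Real.norm_of_nonneg ha.le]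
      _ ≤ C₀ * Real.exp (-m * s) + a * (C₀ / m * Real.exp (-m * s)) :=
        add_le_add (hq₀ s hs) (mul_le_mul_of_nonneg_left t1 ha.le)
      _ = _ := by rw [hD₀]; ring
  -- Both kernels have mass one, so both complements 1 - ∫ are tails, and their difference inherits
  -- the exponential decay.
  have hdd : ∀ s ≥ 0, ‖d s - d₀ s‖ ≤ D₁ * x * Real.exp (-(m / 2) * s) := by
    intro s hs
    have t1 := norm_integral_Ioi_le_of_le_exp hm2 hs hpq
    have e1 : d s - d₀ s = (p s - q₀ s) - a * ∫ r in Ioi s, (p r - q₀ r) := by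
      simp only [hd, hd₀]
      rw [integral_eq_integral_Ioi_sub Iq₀ hs, h1, integral_eq_integral_Ioi_sub Ip hs, hl,
        integral_sub (Ip.mono_set (Ioi_subset_Ioi hs)) (Iq₀.mono_set (Ioi_subset_Ioi hs))]
      ring
    rw [e1]
    calc _ ≤ ‖p s - q₀ s‖ + ‖a * ∫ r in Ioi s, (p r - q₀ r)‖ := norm_sub_le _ _
      _ = ‖p s - q₀ s‖ + a * ‖∫ r in Ioi s, (p r - q₀ r)‖ := by
        rw [norm_mul, Real.norm_of_nonneg ha.le]
      _ ≤ C₄ * x * Real.exp (-(m / 2) * s) + a * (C₄ * x / (m / 2) * Real.exp (-(m / 2) * s)) :=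
        add_le_add (hpq s hs) (mul_le_mul_of_nonneg_left t1 ha.le)
      _ = _ := by rw [hD₁]; field_simp
  set R : ℝ := δ * (4 / m) * D₀ + D₁ * x with hR
  have hpt : ∀ s ≥ 0, Real.exp (δ * s) * |d s| ≤ |d₀ s| + R * Real.exp (-(m / 4) * s) := by
    intro s hs
    have e0 := Real.exp_pos (-(m / 4) * s)
    have f1 := hexp1 s hs
    have f2 := hsexp s
    have f3 := hlexp δ s hδm hs
    have f4 : 0 ≤ s * Real.exp (-(m / 4) * s) := by positivity
    have b1 : (Real.exp (δ * s) - 1) * |d₀ s| ≤ δ * (4 / m) * D₀ * Real.exp (-(m / 4) * s) := by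
      calc _ ≤ (δ * s * Real.exp (δ * s)) * (D₀ * Real.exp (-m * s)) :=
            mul_le_mul exp_sub_one_le (hd₀b s hs) (abs_nonneg _) (by positivity)
        _ = δ * D₀ * (s * Real.exp (-(m / 4) * s)) * (Real.exp (δ * s) * Real.exp (-(m / 4) * s))
            * Real.exp (-(m / 4) * s) * Real.exp (-(m / 4) * s) := by rw [hsplit]; ring
        _ ≤ δ * D₀ * (4 / m) * 1 * 1 * Real.exp (-(m / 4) * s) := by gcongr
        _ = _ := by ring
    have b2 : Real.exp (δ * s) * |d s - d₀ s| ≤ D₁ * x * Real.exp (-(m / 4) * s) := by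
      calc _ ≤ Real.exp (δ * s) * (D₁ * x * Real.exp (-(m / 2) * s)) :=
            mul_le_mul_of_nonneg_left (hdd s hs) (Real.exp_pos _).le
        _ = D₁ * x * (Real.exp (δ * s) * Real.exp (-(m / 4) * s)) * Real.exp (-(m / 4) * s) := by
            rw [hsplit2]; ring
        _ ≤ D₁ * x * 1 * Real.exp (-(m / 4) * s) := by gcongr
        _ = _ := by ring
    have b3 : |d s| ≤ |d₀ s| + |d s - d₀ s| := by
      have := abs_add_le (d₀ s) (d s - d₀ s)
      simpa using this
    have := mul_le_mul_of_nonneg_left b3 (Real.exp_pos (δ * s)).le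
    rw [hR]
    linarith
  have IR : IntegrableOn (fun s => R * Real.exp (-(m / 4) * s)) (Ioi 0) :=
    (integrableOn_exp_neg_mul_Ioi hm4 0).const_mul R
  have Id₀ : IntegrableOn (fun s => |d₀ s|) (Ioi 0) :=
    (integrableOn_Ioi_of_le_exp hd₀c hm le_rfl hd₀b).abs
  have Isum : IntegrableOn (fun s => |d₀ s| + R * Real.exp (-(m / 4) * s)) (Ioi 0) := Id₀.add IR
  have Ifin : IntegrableOn (fun s => Real.exp (δ * s) * |d s|) (Ioi 0) := by
    refine Integrable.mono' Isum (Continuous.aestronglyMeasurable (by fun_prop)) ?_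
    filter_upwards [ae_restrict_mem measurableSet_Ioi] with s hs
    rw [Real.norm_of_nonneg (by positivity)]
    exact hpt s (le_of_lt hs)
  refine ⟨Ifin, ?_⟩
  calc ∫ s in Ioi (0 : ℝ), Real.exp (δ * s) * |d s|
      ≤ ∫ s in Ioi (0 : ℝ), (|d₀ s| + R * Real.exp (-(m / 4) * s)) :=
        setIntegral_mono_on Ifin Isum measurableSet_Ioi fun s hs => hpt s (le_of_lt hs)
    _ = (∫ s in Ioi (0 : ℝ), |d₀ s|) + R * (4 / m) := by
        rw [integral_add Id₀ IR, integral_const_mul, integral_exp_neg_mul_Ioi hm4]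
        simp
    _ ≤ (1 - η) + (η / 4 + η / 4) := by
        refine add_le_add h2 ?_
        rw [hR, add_mul]
        refine add_le_add ?_ ?_
        · rw [le_div_iff₀ (by positivity)] at hδη
          rw [show δ * (4 / m) * D₀ * (4 / m) = δ * (64 * D₀) / (4 * m ^ 2) by field_simp; ring,
            div_le_iff₀ (by positivity)]
          linarith
        · rw [le_div_iff₀ (by positivity)] at hxε
          rw [show D₁ * x * (4 / m) = x * (16 * D₁) / (4 * m) by field_simp; ring,
            div_le_iff₀ (by positivity)]
          linarith
    _ = _ := by ring

set_option maxHeartbeats 800000 in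
/-- Diffusive relaxation for a small perturbation of a kernel of mass one. -/
theorem renewal_diffusive {γ C₀ m C₁ C₂ a η κ₀ κ₁ : ℝ} (hγ : 0 < γ) (hC₀ : 0 < C₀) (hm : 0 < m)
    (hC₁ : 0 < C₁) (hC₂ : 0 < C₂) (ha : 0 < a) (hη : 0 < η) (hκ₀ : 0 < κ₀) (hκ₁ : 0 < κ₁) :
    ∃ ε > 0, ∃ c > 0, ∃ C > 0, ∀ (q₀ q : ℝ → ℝ) (κ x : ℝ), Continuous q₀ → Continuous q →
      (∀ s ≥ 0, |q₀ s| ≤ C₀ * Real.exp (-m * s)) →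
      (∀ s ≥ 0, |q₀ s - q s| ≤ C₁ * x * Real.exp (-m * s)) →
      ∫ s in Ioi (0 : ℝ), q₀ s = 1 → ∫ s in Ioi (0 : ℝ), s * q₀ s = 1 / γ →
      |(∫ s in Ioi (0 : ℝ), (q₀ s - q s)) - κ * x / γ| ≤ C₂ * x ^ 2 →
      ∫ s in Ioi (0 : ℝ), |q₀ s - a * (1 - ∫ r in (0 : ℝ)..s, q₀ r)| ≤ 1 - η →
      κ₀ ≤ κ → κ ≤ κ₁ → 0 ≤ x → x ≤ ε →
      ∀ (f g : ℝ → ℂ) (S : ℝ), Continuous f → Continuous g → 0 ≤ S →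
      (∀ t ≥ 0, ‖g t‖ ≤ S * Real.exp (-m * t)) →
      (∀ t ≥ 0, f t = g t + ∫ s in (0 : ℝ)..t, (q s : ℂ) * f (t - s)) →
      (∀ t ≥ 0, ‖f t‖ ≤ C * S) ∧
      ∀ t₀ ≥ 0, ∀ t ≥ 0, ‖f (t₀ + t) - Real.exp (-(κ * x) * t) * f t₀‖
        ≤ C * S * (x * Real.exp (-(c * x) * t₀) + Real.exp (-c * t₀)) := by
  obtain ⟨ε₁, hε₁, C₅, hC₅, hrate⟩ := exists_rate hγ hC₀ hm hC₁ hC₂ hκ₀ hκ₁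
  obtain ⟨ε₂, hε₂, δ, hδ, hδm, htilt⟩ := tilted_hazard hC₀ hm hC₁ hκ₁ ha hη
  have hη2 : 0 < 1 - (1 - η / 2) := by linarith
  set K₁ : ℝ := a / δ / (1 - (1 - η / 2)) with hK₁
  have hK₁0 : 0 < K₁ := by positivity
  set K₂ : ℝ := (1 + K₁) / (1 - (1 - η / 2)) with hK₂
  have hK₂0 : 0 < K₂ := by positivity
  refine ⟨min ε₁ ε₂, by positivity, min (κ₀ / 2) δ, by positivity,
    K₁ + 2 * K₂ + K₁ * C₅ * (2 / κ₀), by positivity, ?_⟩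
  intro q₀ q κ x hq₀c hqc hq₀ hqd h1 h2 h3 h4 hκ hκ' hx0 hxε f g S hf hg hS hgS hren
  obtain ⟨l, hl1, hl2, hl3, hl4, hl⟩ := hrate q₀ q κ x hq₀c hqc hq₀ hqd h1 h2 h3 hκ hκ' hx0
    (hxε.trans (min_le_left _ _))
  have hl0 : 0 ≤ l := le_trans (by positivity) hl1
  obtain ⟨hI, hθ⟩ := htilt q₀ q x l hq₀c hqc hq₀ hqd h1 h4 hl0 hl2 hl3 hl hx0
    (hxε.trans (min_le_right _ _))
  have hgS' : ∀ t ≥ 0, ‖(Real.exp (l * t) : ℂ) * g t‖ ≤ S * Real.exp (-δ * t) := by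
    intro t ht
    rw [norm_mul, Complex.norm_real, Real.norm_eq_abs, Real.abs_exp]
    calc _ ≤ Real.exp (l * t) * (S * Real.exp (-m * t)) :=
          mul_le_mul_of_nonneg_left (hgS t ht) (Real.exp_pos _).le
      _ = S * Real.exp (l * t + -m * t) := by rw [Real.exp_add]; ring
      _ ≤ S * Real.exp (-δ * t) := by
        refine mul_le_mul_of_nonneg_left (Real.exp_le_exp.mpr ?_) hS
        have := mul_le_mul_of_nonneg_right (show l + δ ≤ m by linarith) ht
        linarith
  have hren' : ∀ t ≥ 0, (Real.exp (l * t) : ℂ) * f t = (Real.exp (l * t) : ℂ) * g t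
      + ∫ s in (0 : ℝ)..t, ((Real.exp (l * s) * q s : ℝ) : ℂ)
        * ((Real.exp (l * (t - s)) : ℂ) * f (t - s)) := by
    intro t ht
    rw [hren t ht, mul_add, ← intervalIntegral.integral_const_mul]
    congr 1
    refine intervalIntegral.integral_congr fun s _ => ?_
    rw [show l * t = l * s + l * (t - s) by ring, Real.exp_add]
    push_cast
    ring
  -- Multiplication by exp(lt) turns the equation into one with a kernel of mass one. Its solution
  -- tends to a limit L at a rate δ independent of x, so f(t) behaves like L exp(-lt).
  obtain ⟨L, hL, hlim⟩ := renewal_limit (h := fun t => (Real.exp (l * t) : ℂ) * f t)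
    (g := fun t => (Real.exp (l * t) : ℂ) * g t) (q := fun t => Real.exp (l * t) * q t)
    (by fun_prop) (by fun_prop) (by fun_prop) ha hδ hS hgS' hren' hI hθ (by linarith)
  have hfh : ∀ t, f t = (Real.exp (-(l * t)) : ℂ) * ((Real.exp (l * t) : ℂ) * f t) := by
    intro t
    rw [← mul_assoc, ← Complex.ofReal_mul, ← Real.exp_add]
    simp
  have hex : ∀ t ≥ 0, Real.exp (-(l * t)) ≤ 1 := by
    intro t ht; rw [Real.exp_le_one_iff]; linarith [mul_nonneg hl0 ht]
  have hex2 : ∀ t ≥ 0, Real.exp (-δ * t) ≤ 1 := by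
    intro t ht; rw [Real.exp_le_one_iff]; linarith [mul_nonneg hδ.le ht]
  rw [← hK₁] at hL
  rw [← hK₁, ← hK₂] at hlim
  refine ⟨?_, ?_⟩
  · intro t ht
    rw [hfh t, norm_mul, Complex.norm_real, Real.norm_eq_abs, Real.abs_exp]
    have hb : ‖(Real.exp (l * t) : ℂ) * f t‖ ≤ K₁ * S + K₂ * S := by
      have := norm_add_le ((Real.exp (l * t) : ℂ) * f t - L) L
      rw [sub_add_cancel] at this
      have h5 := hlim t ht
      have h6 : K₂ * S * Real.exp (-δ * t) ≤ K₂ * S * 1 :=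
        mul_le_mul_of_nonneg_left (hex2 t ht) (by positivity)
      linarith
    calc _ ≤ 1 * (K₁ * S + K₂ * S) := mul_le_mul (hex t ht) hb (norm_nonneg _) zero_le_one
      _ ≤ _ := by
        have : 0 ≤ K₁ * C₅ * (2 / κ₀) * S := by positivity
        have : 0 ≤ K₂ * S := by positivity
        linarith
  · intro t₀ ht₀ t ht
    have hsum : 0 ≤ t₀ + t := by linarith
    set h : ℝ → ℂ := fun t => (Real.exp (l * t) : ℂ) * f t with hh
    -- The first term compares the two slow exponentials; the other two are the deviations of h from
    -- its limit at the times t₀ + t and t₀.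
    have e1 : f (t₀ + t) - Real.exp (-(κ * x) * t) * f t₀
        = (Real.exp (-(l * t₀)) : ℂ) * L
            * ((Real.exp (-(l * t)) - Real.exp (-(κ * x * t)) : ℝ) : ℂ)
          + (Real.exp (-(l * (t₀ + t))) : ℂ) * (h (t₀ + t) - L)
          - (Real.exp (-(κ * x * t)) : ℂ) * ((Real.exp (-(l * t₀)) : ℂ) * (h t₀ - L)) := by
      have e2 : (Real.exp (-(l * (t₀ + t))) : ℂ)
          = (Real.exp (-(l * t₀)) : ℂ) * (Real.exp (-(l * t)) : ℂ) := by
        rw [← Complex.ofReal_mul, ← Real.exp_add]; congr 2; ring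
      rw [hfh (t₀ + t), hfh t₀, neg_mul, e2]
      simp only [hh]
      push_cast
      ring
    have hM : κ₀ * x / 2 ≤ κ * x := by
      linarith [mul_le_mul_of_nonneg_right hκ hx0, mul_nonneg hκ₀.le hx0]
    -- The difference is at most |l - κx| t exp(-κ₀xt/2) ≤ C₅x² t exp(-κ₀xt/2). The exponential
    -- absorbs one factor xt, which leaves O(x) uniformly in t.
    have b0 : |Real.exp (-(l * t)) - Real.exp (-(κ * x * t))| ≤ C₅ * (2 / κ₀) * x := by
      have := abs_exp_neg_sub_exp_neg_le (A := l * t) (B := κ * x * t) (M := κ₀ * x / 2 * t)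
        (mul_le_mul_of_nonneg_right hl1 ht) (mul_le_mul_of_nonneg_right hM ht)
      rw [← sub_mul, abs_mul, abs_of_nonneg ht] at this
      have h7 := mul_exp_neg_le (a := κ₀ / 2) (t := x * t) (by positivity)
      have h8 : Real.exp (-(κ₀ * x / 2 * t)) = Real.exp (-(κ₀ / 2) * (x * t)) := by
        congr 1; ring
      rw [h8] at this
      refine this.trans ?_
      calc _ ≤ C₅ * x ^ 2 * t * Real.exp (-(κ₀ / 2) * (x * t)) := by gcongr
        _ = C₅ * x * (x * t * Real.exp (-(κ₀ / 2) * (x * t))) := by ring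
        _ ≤ C₅ * x * (1 / (κ₀ / 2)) := by gcongr
        _ = _ := by field_simp
    have hc1 : Real.exp (-(l * t₀)) ≤ Real.exp (-(min (κ₀ / 2) δ * x) * t₀) := by
      refine Real.exp_le_exp.mpr ?_
      have h9 : min (κ₀ / 2) δ * x ≤ l := by
        refine le_trans ?_ hl1
        have := mul_le_mul_of_nonneg_right (min_le_left (κ₀ / 2) δ) hx0
        linarith
      have := mul_le_mul_of_nonneg_right h9 ht₀
      linarith
    have hc2 : ∀ s ≥ t₀, Real.exp (-δ * s) ≤ Real.exp (-(min (κ₀ / 2) δ) * t₀) := by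
      intro s hs
      refine Real.exp_le_exp.mpr ?_
      have h9 := min_le_right (κ₀ / 2) δ
      have := mul_le_mul h9 hs ht₀ hδ.le
      linarith
    set A := Real.exp (-(min (κ₀ / 2) δ * x) * t₀) with hA
    set B := Real.exp (-(min (κ₀ / 2) δ) * t₀) with hB
    have hA0 : 0 < A := Real.exp_pos _
    have hB0 : 0 < B := Real.exp_pos _
    have n1 : ‖(Real.exp (-(l * t₀)) : ℂ) * L
        * ((Real.exp (-(l * t)) - Real.exp (-(κ * x * t)) : ℝ) : ℂ)‖
        ≤ A * (K₁ * S) * (C₅ * (2 / κ₀) * x) := by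
      rw [norm_mul, norm_mul, Complex.norm_real, Complex.norm_real, Real.norm_eq_abs,
        Real.norm_eq_abs, Real.abs_exp]
      gcongr
    have n2 : ‖(Real.exp (-(l * (t₀ + t))) : ℂ) * (h (t₀ + t) - L)‖ ≤ 1 * (K₂ * S * B) := by
      rw [norm_mul, Complex.norm_real, Real.norm_eq_abs, Real.abs_exp]
      refine mul_le_mul (hex _ hsum) ((hlim _ hsum).trans ?_) (norm_nonneg _) zero_le_one
      exact mul_le_mul_of_nonneg_left (hc2 _ (by linarith)) (by positivity)
    have n3 : ‖(Real.exp (-(κ * x * t)) : ℂ) * ((Real.exp (-(l * t₀)) : ℂ) * (h t₀ - L))‖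
        ≤ 1 * (1 * (K₂ * S * B)) := by
      rw [norm_mul, norm_mul, Complex.norm_real, Complex.norm_real, Real.norm_eq_abs,
        Real.norm_eq_abs, Real.abs_exp, Real.abs_exp]
      have : Real.exp (-(κ * x * t)) ≤ 1 := by
        rw [Real.exp_le_one_iff]
        have : 0 ≤ κ * x * t := mul_nonneg (mul_nonneg (hκ₀.le.trans hκ) hx0) ht
        linarith
      refine mul_le_mul this ?_ (by positivity) zero_le_one
      refine mul_le_mul (hex _ ht₀) ((hlim _ ht₀).trans ?_) (norm_nonneg _) zero_le_one
      exact mul_le_mul_of_nonneg_left (hc2 _ le_rfl) (by positivity)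
    rw [e1]
    refine (norm_sub_le _ _).trans ((add_le_add ((norm_add_le _ _).trans (add_le_add n1 n2))
      n3).trans ?_)
    have p1 : 0 ≤ (K₁ + 2 * K₂) * S * (x * A) := by positivity
    have p2 : 0 ≤ (K₁ + K₁ * C₅ * (2 / κ₀)) * S * B := by positivity
    linarith

/-- Exponential relaxation for a renewal equation whose kernel has mass less than one. -/
theorem renewal_decay {C₀ m c : ℝ} (hC₀ : 0 < C₀) (hm : 0 < m) (hc : 0 < c) :
    ∃ δ > 0, δ ≤ m ∧ ∀ q : ℝ → ℝ, Continuous q →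
      (∀ s ≥ 0, |q s| ≤ C₀ * Real.exp (-m * s)) →
      ∫ s in Ioi (0 : ℝ), |q s| ≤ 1 - c →
      ∀ (f g : ℝ → ℂ) (S : ℝ), Continuous f → Continuous g → 0 ≤ S →
      (∀ t ≥ 0, ‖g t‖ ≤ S * Real.exp (-m * t)) →
      (∀ t ≥ 0, f t = g t + ∫ s in (0 : ℝ)..t, (q s : ℂ) * f (t - s)) →
      ∀ t ≥ 0, ‖f t‖ ≤ 2 / c * S * Real.exp (-δ * t) := by
  have hm2 : 0 < m / 2 := by positivity
  have hm4 : 0 < m / 4 := by positivity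
  refine ⟨min (m / 2) (c * m ^ 2 / (32 * C₀)), by positivity,
    (min_le_left _ _).trans (by linarith), ?_⟩
  set δ : ℝ := min (m / 2) (c * m ^ 2 / (32 * C₀)) with hδ
  have hδ0 : 0 < δ := by positivity
  have hδm : δ ≤ m / 2 := min_le_left _ _
  have hδc : δ ≤ c * m ^ 2 / (32 * C₀) := min_le_right _ _
  intro q hq hqb hq1 f g S hf hg hS hgS hren
  have hpt : ∀ s ≥ 0, Real.exp (δ * s) * |q s|
      ≤ |q s| + δ * C₀ * (4 / m) * Real.exp (-(m / 4) * s) := by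
    intro s hs
    have e0 := Real.exp_pos (-(m / 4) * s)
    have f2 : s * Real.exp (-(m / 4) * s) ≤ 4 / m := by
      have := mul_exp_neg_le (a := m / 4) (t := s) (by positivity)
      simpa using this
    have f3 : Real.exp (δ * s) * Real.exp (-(m / 2) * s) ≤ 1 := by
      rw [← Real.exp_add, Real.exp_le_one_iff]
      nlinarith
    have hsplit : Real.exp (-m * s) = Real.exp (-(m / 2) * s) * Real.exp (-(m / 4) * s)
        * Real.exp (-(m / 4) * s) := by
      rw [← Real.exp_add, ← Real.exp_add]; congr 1; ring
    have b1 : (Real.exp (δ * s) - 1) * |q s| ≤ δ * C₀ * (4 / m) * Real.exp (-(m / 4) * s) := by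
      calc _ ≤ (δ * s * Real.exp (δ * s)) * (C₀ * Real.exp (-m * s)) :=
            mul_le_mul exp_sub_one_le (hqb s hs) (abs_nonneg _) (by positivity)
        _ = δ * C₀ * (s * Real.exp (-(m / 4) * s)) * (Real.exp (δ * s) * Real.exp (-(m / 2) * s))
            * Real.exp (-(m / 4) * s) := by rw [hsplit]; ring
        _ ≤ δ * C₀ * (4 / m) * 1 * Real.exp (-(m / 4) * s) := by gcongr
        _ = _ := by ring
    linarith
  have Iq : IntegrableOn (fun s => |q s|) (Ioi 0) :=
    (integrableOn_Ioi_of_le_exp hq hm le_rfl hqb).abs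
  have IR : IntegrableOn (fun s => δ * C₀ * (4 / m) * Real.exp (-(m / 4) * s)) (Ioi 0) :=
    (integrableOn_exp_neg_mul_Ioi hm4 0).const_mul _
  have Ifin : IntegrableOn (fun s => Real.exp (δ * s) * |q s|) (Ioi 0) := by
    refine Integrable.mono' (Iq.add IR) (Continuous.aestronglyMeasurable (by fun_prop)) ?_
    filter_upwards [ae_restrict_mem measurableSet_Ioi] with s hs
    rw [Real.norm_of_nonneg (by positivity)]
    exact hpt s (le_of_lt hs)
  -- By the choice of δ the weight exp(δs) uses up at most half of the gap c.
  have hθ : ∫ s in Ioi (0 : ℝ), Real.exp (δ * s) * |q s| ≤ 1 - c / 2 := by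
    calc _ ≤ ∫ s in Ioi (0 : ℝ), (|q s| + δ * C₀ * (4 / m) * Real.exp (-(m / 4) * s)) :=
          setIntegral_mono_on Ifin (Iq.add IR) measurableSet_Ioi fun s hs => hpt s (le_of_lt hs)
      _ = (∫ s in Ioi (0 : ℝ), |q s|) + δ * C₀ * (4 / m) * (4 / m) := by
          rw [integral_add Iq IR, integral_const_mul, integral_exp_neg_mul_Ioi hm4]
          simp
      _ ≤ (1 - c) + c / 2 := by
          refine add_le_add hq1 ?_
          rw [le_div_iff₀ (by positivity)] at hδc
          rw [show δ * C₀ * (4 / m) * (4 / m) = δ * (32 * C₀) / (2 * m ^ 2) by field_simp; ring,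
            div_le_iff₀ (by positivity)]
          linarith
      _ = _ := by ring
  have := norm_le_of_convolution_le (k := fun s => |q s|) (G := S) hf (by fun_prop)
    (fun s _ => abs_nonneg _) Ifin hθ (by linarith) (fun t ht => ?_)
  · intro t ht
    refine (this t ht).trans (le_of_eq ?_)
    rw [show 1 - (1 - c / 2) = c / 2 by ring]
    field_simp
  · rw [hren t ht]
    refine (norm_add_le _ _).trans (add_le_add ((hgS t ht).trans ?_) ?_)
    · refine mul_le_mul_of_nonneg_left (Real.exp_le_exp.mpr ?_) hS
      have := mul_le_mul_of_nonneg_right (show δ ≤ m by linarith) ht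
      linarith
    · refine (intervalIntegral.norm_integral_le_integral_norm ht).trans (le_of_eq ?_)
      refine intervalIntegral.integral_congr fun s _ => ?_
      simp

/-! ### Vector valued renewal equations -/

section Volterra

variable {E : Type*} [NormedAddCommGroup E] [NormedSpace ℝ E]

/-- In the norm weighted by exp(-2Bt) a Volterra operator with kernel bounded by B contracts by one
half, however long the time interval. -/
theorem volterra_integral_weight_le {B : ℝ} (hB : 0 < B) {t : ℝ} (ht : 0 ≤ t) :
    ∫ s in (0 : ℝ)..t, Real.exp (-(2 * B) * s) * B ≤ 1 / 2 := by
  have hB2 : 0 < 2 * B := by positivity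
  rw [intervalIntegral.integral_mul_const,
    integral_eq_integral_Ioi_sub (integrableOn_exp_neg_mul_Ioi hB2 0) ht,
    integral_exp_neg_mul_Ioi hB2, integral_exp_neg_mul_Ioi hB2]
  have : 0 < Real.exp (-(2 * B) * t) / (2 * B) := by positivity
  calc _ ≤ (Real.exp (-(2 * B) * 0) / (2 * B)) * B :=
        mul_le_mul_of_nonneg_right (by linarith) hB.le
    _ = 1 / 2 := by simp; field_simp

/-- Existence of continuous solutions of linear renewal equations with bounded data. -/
theorem exists_volterra [CompleteSpace E] {K : ℝ → E →L[ℝ] E} {g : ℝ → E} (hK : Continuous K) (hg : Continuous g)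
    {B : ℝ} (hB : 0 < B) (hKB : ∀ s ≥ 0, ‖K s‖ ≤ B) (hgB : ∀ s ≥ 0, ‖g s‖ ≤ B) :
    ∃ T : ℝ → E, Continuous T ∧ ∀ t ≥ 0, T t = g t + ∫ s in (0 : ℝ)..t, K s (T (t - s)) := by
  set β : ℝ := 2 * B with hβ
  have hβ0 : 0 < β := by positivity
  -- The fixed point sought is exp(-2Bt) T(t). Evaluation at `max t 0` freezes the equation at
  -- negative times, so that the map acts on bounded continuous functions on the whole line.
  set F : (ℝ → E) → ℝ → E := fun h t => Real.exp (-β * max t 0) • g (max t 0)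
    + ∫ s in (0 : ℝ)..(max t 0), Real.exp (-β * s) • K s (h (max t 0 - s)) with hF
  have hcont : ∀ h : ℝ → E, Continuous h → Continuous (F h) := by
    intro h hh
    refine Continuous.add (by fun_prop) ?_
    refine intervalIntegral.continuous_parametric_intervalIntegral_of_continuous
      (f := fun t s => Real.exp (-β * s) • K s (h (max t 0 - s))) ?_ (by fun_prop)
    simp only [Function.uncurry_def]
    refine Continuous.smul (by fun_prop) ?_
    exact (hK.comp continuous_snd).clm_apply (by fun_prop)
  have hint : ∀ (u : ℝ → E) (M : ℝ), 0 ≤ M → (∀ t, ‖u t‖ ≤ M) → ∀ t,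
      ‖∫ s in (0 : ℝ)..(max t 0), Real.exp (-β * s) • K s (u (max t 0 - s))‖ ≤ 1 / 2 * M := by
    intro u M hM hu t
    have ht : 0 ≤ max t 0 := le_max_right _ _
    calc _ ≤ ∫ s in (0 : ℝ)..(max t 0), (Real.exp (-β * s) * B) * M := by
          refine intervalIntegral.norm_integral_le_of_norm_le ht ?_
            (Continuous.intervalIntegrable (by fun_prop) _ _)
          refine Filter.Eventually.of_forall fun s hs => ?_
          rw [norm_smul, Real.norm_eq_abs, Real.abs_exp, mul_assoc]
          refine mul_le_mul_of_nonneg_left ?_ (Real.exp_pos _).le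
          exact ((K s).le_opNorm _).trans (mul_le_mul (hKB s hs.1.le) (hu _) (norm_nonneg _) hB.le)
      _ ≤ _ := by
          rw [intervalIntegral.integral_mul_const]
          exact mul_le_mul_of_nonneg_right (volterra_integral_weight_le hB ht) hM
  have hbound : ∀ h : BoundedContinuousFunction ℝ E, ∀ t, ‖F h t‖ ≤ B + 1 / 2 * ‖h‖ := by
    intro h t
    have ht : 0 ≤ max t 0 := le_max_right _ _
    refine (norm_add_le _ _).trans (add_le_add ?_
      (hint h ‖h‖ (norm_nonneg _) (fun t => h.norm_coe_le_norm t) t))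
    rw [norm_smul, Real.norm_eq_abs, Real.abs_exp]
    have : Real.exp (-β * max t 0) ≤ 1 := by
      rw [Real.exp_le_one_iff]; nlinarith
    calc _ ≤ 1 * B := mul_le_mul this (hgB _ ht) (norm_nonneg _) zero_le_one
      _ = B := one_mul _
  let Ψ : BoundedContinuousFunction ℝ E → BoundedContinuousFunction ℝ E := fun h =>
    BoundedContinuousFunction.ofNormedAddCommGroup (F h) (hcont h h.continuous) _ (hbound h)
  have hΨ : ∀ h t, Ψ h t = F h t := fun h t => rfl
  have hlip : LipschitzWith (1 / 2) Ψ := by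
    refine LipschitzWith.of_dist_le_mul fun h₁ h₂ => ?_
    rw [BoundedContinuousFunction.dist_le (by positivity)]
    intro t
    rw [hΨ, hΨ, dist_eq_norm]
    have ht : 0 ≤ max t 0 := le_max_right _ _
    have ii : ∀ h : BoundedContinuousFunction ℝ E, IntervalIntegrable
        (fun s => Real.exp (-β * s) • K s (h (max t 0 - s))) volume 0 (max t 0) := by
      intro h
      refine Continuous.intervalIntegrable (Continuous.smul (by fun_prop) ?_) _ _
      exact hK.clm_apply (by fun_prop)
    have e1 : F h₁ t - F h₂ t = ∫ s in (0 : ℝ)..(max t 0),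
        Real.exp (-β * s) • K s ((fun r => h₁ r - h₂ r) (max t 0 - s)) := by
      simp only [hF, add_sub_add_left_eq_sub]
      rw [← intervalIntegral.integral_sub (ii h₁) (ii h₂)]
      refine intervalIntegral.integral_congr fun s _ => ?_
      simp only [map_sub, smul_sub]
    rw [e1]
    refine (hint (fun r => h₁ r - h₂ r) (dist h₁ h₂) dist_nonneg (fun r => ?_) t).trans (le_of_eq ?_)
    · rw [← dist_eq_norm]; exact BoundedContinuousFunction.dist_coe_le_dist r
    · simp
  have hcontr : ContractingWith (1 / 2) Ψ := ⟨by
    rw [← NNReal.coe_lt_coe]; norm_num, hlip⟩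
  set h := hcontr.fixedPoint Ψ with hh
  have hfix : Ψ h = h := hcontr.fixedPoint_isFixedPt
  refine ⟨fun t => Real.exp (β * t) • h t, by fun_prop, fun t ht => ?_⟩
  have e1 : h t = F h t := by rw [← hΨ, hfix]
  have e2 : F h t = Real.exp (-β * t) • g t
      + ∫ s in (0 : ℝ)..t, Real.exp (-β * s) • K s (h (t - s)) := by
    simp only [hF, max_eq_left ht]
  simp only
  rw [e1, e2, smul_add, smul_smul, ← Real.exp_add, ← intervalIntegral.integral_smul]
  congr 1
  · simp
  · refine intervalIntegral.integral_congr fun s _ => ?_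
    simp only [map_smul, smul_smul, ← Real.exp_add]
    congr 2
    ring

/-- Uniqueness of continuous solutions of linear renewal equations with bounded kernel. -/
theorem volterra_unique {K : ℝ → E →L[ℝ] E} {g : ℝ → E} (hK : Continuous K)
    {B : ℝ} (hB : 0 < B) (hKB : ∀ s ≥ 0, ‖K s‖ ≤ B) {T T' : ℝ → E} (hT : Continuous T)
    (hT' : Continuous T') (h : ∀ t ≥ 0, T t = g t + ∫ s in (0 : ℝ)..t, K s (T (t - s)))
    (h' : ∀ t ≥ 0, T' t = g t + ∫ s in (0 : ℝ)..t, K s (T' (t - s))) :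
    ∀ t ≥ 0, T' t = T t := by
  intro t ht
  have hB2 : 0 < 2 * B := by positivity
  -- With the negative rate -2B growth like exp(2Bt) is tolerated and the constant kernel B has
  -- weighted mass 1/2; the source G = 0 then forces the difference to vanish.
  have key := norm_le_of_convolution_le (f := fun t => T' t - T t) (k := fun _ => B)
    (δ := -(2 * B)) (θ := 1 / 2) (G := 0) (by fun_prop) (by fun_prop) (fun _ _ => hB.le)
    ((integrableOn_exp_neg_mul_Ioi hB2 0).mul_const B) ?_ (by norm_num) ?_ t ht
  · simp only [zero_div, zero_mul] at key
    exact sub_eq_zero.mp (norm_le_zero_iff.mp key)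
  · rw [integral_mul_const, integral_exp_neg_mul_Ioi hB2]
    simp
    apply le_of_eq
    field_simp
  · intro t ht
    have ii : ∀ u : ℝ → E, Continuous u → IntervalIntegrable
        (fun s => K s (u (t - s))) volume 0 t := by
      intro u hu
      exact Continuous.intervalIntegrable (hK.clm_apply (by fun_prop)) _ _
    have e1 : T' t - T t = ∫ s in (0 : ℝ)..t, K s (T' (t - s) - T (t - s)) := by
      rw [h t ht, h' t ht, add_sub_add_left_eq_sub,
        ← intervalIntegral.integral_sub (ii T' hT') (ii T hT)]
      refine intervalIntegral.integral_congr fun s _ => ?_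
      simp only [map_sub]
    rw [e1, zero_mul, zero_add]
    refine intervalIntegral.norm_integral_le_of_norm_le ht ?_
      (Continuous.intervalIntegrable (by fun_prop) _ _)
    refine Filter.Eventually.of_forall fun s hs => ?_
    exact ((K s).le_opNorm _).trans (mul_le_mul_of_nonneg_right (hKB s hs.1.le) (norm_nonneg _))

end Volterra

/-! ### The relaxation of a single mode -/

/-- The momentum response of the mode with `u(k) = u`. -/
def mode (γ u t : ℝ) : ℝ :=
  1 / (2 * u) * ((γ / 2 + u) * Real.exp (-t * (γ / 2 + u))
    - (γ / 2 - u) * Real.exp (-t * (γ / 2 - u)))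

/-- The antiderivative of `mode`. -/
def modeInt (γ u t : ℝ) : ℝ :=
  1 / (2 * u) * (Real.exp (-t * (γ / 2 - u)) - Real.exp (-t * (γ / 2 + u)))

theorem mode_continuous (γ u : ℝ) : Continuous (mode γ u) := by unfold mode; fun_prop

theorem modeInt_continuous (γ u : ℝ) : Continuous (modeInt γ u) := by unfold modeInt; fun_prop

theorem mode_zero (γ : ℝ) {u : ℝ} (hu : u ≠ 0) : mode γ u 0 = 1 := by
  unfold mode; simp; field_simp; ring

theorem modeInt_zero (γ u : ℝ) : modeInt γ u 0 = 0 := by simp [modeInt]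

theorem hasDerivAt_exp_neg_mul (c t : ℝ) :
    HasDerivAt (fun t => Real.exp (-t * c)) (-c * Real.exp (-t * c)) t := by
  have := ((hasDerivAt_id t).neg.mul_const c).exp
  exact this.congr_deriv (by simp only [Pi.neg_apply, id]; ring)

theorem hasDerivAt_modeInt (γ u t : ℝ) : HasDerivAt (modeInt γ u) (mode γ u t) t := by
  unfold modeInt mode
  exact (((hasDerivAt_exp_neg_mul (γ / 2 - u) t).sub
    (hasDerivAt_exp_neg_mul (γ / 2 + u) t)).const_mul _).congr_deriv (by ring)

/-- Together with `hasDerivAt_modeInt` this is the overdamped oscillator y'' = -γy' - ω²y for y =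
`modeInt`, as ω² = (γ/2)² - u². It is the action of `MM` on a single Fourier mode. -/
theorem hasDerivAt_mode (γ u t : ℝ) :
    HasDerivAt (mode γ u) (-γ * mode γ u t - ((γ / 2) ^ 2 - u ^ 2) * modeInt γ u t) t := by
  unfold modeInt mode
  exact ((((hasDerivAt_exp_neg_mul (γ / 2 + u) t).const_mul (γ / 2 + u)).sub
    ((hasDerivAt_exp_neg_mul (γ / 2 - u) t).const_mul (γ / 2 - u))).const_mul _).congr_deriv
    (by ring)

/-! ### Uniform bounds on a mode and on its variation in `u` -/

section Bounds

variable {γ u₀ u₁ : ℝ}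

theorem exp_rate_le {t : ℝ} (ht : 0 ≤ t) (σ : ℝ) (hσ : -u₁ ≤ σ) :
    Real.exp (-t * (γ / 2 + σ)) ≤ Real.exp (-(γ / 2 - u₁) * t) := by
  refine Real.exp_le_exp.mpr ?_
  nlinarith

theorem abs_mode_le (hu₀ : 0 < u₀) (hu₁ : u₁ < γ / 2) {u t : ℝ} (hu : u ∈ Icc u₀ u₁)
    (ht : 0 ≤ t) : |mode γ u t| ≤ γ / u₀ * Real.exp (-(γ / 2 - u₁) * t) := by
  have hupos : 0 < u := hu₀.trans_le hu.1
  have hγ : 0 < γ := by linarith [hu.1, hu.2]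
  have e1 := exp_rate_le (γ := γ) (u₁ := u₁) ht u (by linarith [hu.2])
  have e2 := exp_rate_le (γ := γ) (u₁ := u₁) ht (-u) (by linarith [hu.2])
  rw [← sub_eq_add_neg] at e2
  unfold mode
  set A := Real.exp (-(γ / 2 - u₁) * t)
  have hA : 0 < A := Real.exp_pos _
  rw [abs_mul, abs_of_pos (by positivity : 0 < 1 / (2 * u))]
  have h1 : |(γ / 2 + u) * Real.exp (-t * (γ / 2 + u))
      - (γ / 2 - u) * Real.exp (-t * (γ / 2 - u))| ≤ γ * A := by
    refine (abs_sub _ _).trans ?_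
    rw [abs_mul, abs_mul, Real.abs_exp, Real.abs_exp, abs_of_pos (by linarith : 0 < γ / 2 + u),
      abs_of_pos (by linarith [hu.2] : 0 < γ / 2 - u)]
    have := mul_le_mul_of_nonneg_left e1 (by linarith : 0 ≤ γ / 2 + u)
    have := mul_le_mul_of_nonneg_left e2 (by linarith [hu.2] : 0 ≤ γ / 2 - u)
    linarith
  calc _ ≤ 1 / (2 * u) * (γ * A) := mul_le_mul_of_nonneg_left h1 (by positivity)
    _ ≤ 1 / u₀ * (γ * A) := by
      refine mul_le_mul_of_nonneg_right ?_ (by positivity)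
      exact one_div_le_one_div_of_le hu₀ (by linarith [hu.1])
    _ = _ := by ring

theorem abs_modeInt_le (hu₀ : 0 < u₀) {u t : ℝ} (hu : u ∈ Icc u₀ u₁)
    (ht : 0 ≤ t) : |modeInt γ u t| ≤ 1 / u₀ * Real.exp (-(γ / 2 - u₁) * t) := by
  have hupos : 0 < u := hu₀.trans_le hu.1
  have e1 := exp_rate_le (γ := γ) (u₁ := u₁) ht u (by linarith [hu.2])
  have e2 := exp_rate_le (γ := γ) (u₁ := u₁) ht (-u) (by linarith [hu.2])
  rw [← sub_eq_add_neg] at e2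
  unfold modeInt
  set A := Real.exp (-(γ / 2 - u₁) * t)
  have hA : 0 < A := Real.exp_pos _
  rw [abs_mul, abs_of_pos (by positivity : 0 < 1 / (2 * u))]
  have h1 : |Real.exp (-t * (γ / 2 - u)) - Real.exp (-t * (γ / 2 + u))| ≤ 2 * A := by
    refine (abs_sub _ _).trans ?_
    rw [Real.abs_exp, Real.abs_exp]
    linarith
  calc _ ≤ 1 / (2 * u) * (2 * A) := mul_le_mul_of_nonneg_left h1 (by positivity)
    _ = 1 / u * A := by field_simp
    _ ≤ 1 / u₀ * A := by
      refine mul_le_mul_of_nonneg_right ?_ (by positivity)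
      exact one_div_le_one_div_of_le hu₀ hu.1

/-- Second differences of a function with bounded first and second derivatives. -/
theorem second_difference_le {F F' F'' : ℝ → ℝ} {a b B : ℝ}
    (h1 : ∀ x ∈ Icc a b, HasDerivAt F (F' x) x) (h2 : ∀ x ∈ Icc a b, HasDerivAt F' (F'' x) x)
    (b1 : ∀ x ∈ Icc a b, |F' x| ≤ B) (b2 : ∀ x ∈ Icc a b, |F'' x| ≤ B)
    {x y z : ℝ} (hx : x ∈ Icc a b) (hy : y ∈ Icc a b) (hz : z ∈ Icc a b) :
    |F x - 2 * F y + F z| ≤ B * (|x - 2 * y + z| + (x - y) ^ 2 + (z - y) ^ 2) := by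
  -- With both expansions made about the middle value y, the first order terms combine into the
  -- second difference of the arguments.
  have taylor : ∀ x ∈ Icc a b, |F x - F y - F' y * (x - y)| ≤ B * (x - y) ^ 2 := by
    intro x hx
    have hsub : uIcc y x ⊆ Icc a b := uIcc_subset_Icc hy hx
    have hF' : ∀ s ∈ uIcc y x, |F' s - F' y| ≤ B * |x - y| := by
      intro s hs
      have h3 := Convex.norm_image_sub_le_of_norm_hasDerivWithin_le (f := F') (f' := F'')
        (s := uIcc y x) (C := B) (fun r hr => (h2 r (hsub hr)).hasDerivWithinAt)
        (fun r hr => b2 r (hsub hr)) (convex_uIcc y x) left_mem_uIcc hs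
      have h4 : ‖s - y‖ ≤ |x - y| := abs_sub_left_of_mem_uIcc hs
      exact h3.trans (mul_le_mul_of_nonneg_left h4 ((abs_nonneg _).trans (b2 y hy)))
    have h3 := Convex.norm_image_sub_le_of_norm_hasDerivWithin_le
      (f := fun s => F s - F' y * s) (f' := fun s => F' s - F' y)
      (s := uIcc y x) (C := B * |x - y|)
      (fun r hr => ((h1 r (hsub hr)).sub (by
        simpa using (hasDerivAt_id r).const_mul (F' y))).hasDerivWithinAt)
      hF' (convex_uIcc y x) left_mem_uIcc right_mem_uIcc
    rw [Real.norm_eq_abs, Real.norm_eq_abs, mul_assoc, ← sq, sq_abs] at h3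
    rwa [show F x - F' y * x - (F y - F' y * y) = F x - F y - F' y * (x - y) by ring] at h3
  have e : F x - 2 * F y + F z = (F x - F y - F' y * (x - y)) + (F z - F y - F' y * (z - y))
      + F' y * (x - 2 * y + z) := by ring
  rw [e]
  have t3 : |F' y * (x - 2 * y + z)| ≤ B * |x - 2 * y + z| := by
    rw [abs_mul]; exact mul_le_mul_of_nonneg_right (b1 y hy) (abs_nonneg _)
  have := abs_add_three (F x - F y - F' y * (x - y)) (F z - F y - F' y * (z - y))
    (F' y * (x - 2 * y + z))
  linarith [taylor x hx, taylor z hz]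

theorem first_difference_le {F F' : ℝ → ℝ} {a b B : ℝ}
    (h1 : ∀ x ∈ Icc a b, HasDerivAt F (F' x) x) (b1 : ∀ x ∈ Icc a b, |F' x| ≤ B)
    {x y : ℝ} (hx : x ∈ Icc a b) (hy : y ∈ Icc a b) : |F x - F y| ≤ B * |x - y| :=
  Convex.norm_image_sub_le_of_norm_hasDerivWithin_le (f := F) (f' := F')
    (s := Icc a b) (C := B) (fun r hr => (h1 r hr).hasDerivWithinAt) b1 (convex_Icc a b) hy hx

theorem hasDerivAt_rate_exp (t z : ℝ) :
    HasDerivAt (fun z => z * Real.exp (-t * z)) ((1 - t * z) * Real.exp (-t * z)) z := by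
  have h := ((hasDerivAt_id z).const_mul (-t)).exp
  have := (hasDerivAt_id z).mul h
  simp only [id] at this
  exact this.congr_deriv (by ring)

theorem hasDerivAt_rate_exp' (t z : ℝ) :
    HasDerivAt (fun z => (1 - t * z) * Real.exp (-t * z))
      ((t ^ 2 * z - 2 * t) * Real.exp (-t * z)) z := by
  have h := ((hasDerivAt_id z).const_mul (-t)).exp
  have := (((hasDerivAt_id z).const_mul t).const_sub 1).mul h
  simp only [id] at this
  exact this.congr_deriv (by ring)

/-- As a function of u a mode is a symmetric difference quotient of z exp(-tz) about γ/2. Each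
derivative brings down a factor t, absorbed by giving up half of the decay rate. -/
theorem mode_second_difference (hu₀ : 0 < u₀) (hu₁ : u₁ < γ / 2) (h01 : u₀ ≤ u₁) :
    ∃ B > 0, ∀ t ≥ 0,
      (∀ x ∈ Icc u₀ u₁, ∀ y ∈ Icc u₀ u₁,
        |mode γ x t - mode γ y t| ≤ B * Real.exp (-((γ / 2 - u₁) / 2) * t) * |x - y|) ∧
      ∀ x ∈ Icc u₀ u₁, ∀ y ∈ Icc u₀ u₁, ∀ z ∈ Icc u₀ u₁,
        |mode γ x t - 2 * mode γ y t + mode γ z t| ≤ B * Real.exp (-((γ / 2 - u₁) / 2) * t)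
          * (|x - 2 * y + z| + (x - y) ^ 2 + (z - y) ^ 2) := by
  set m : ℝ := γ / 2 - u₁ with hm
  have hm0 : 0 < m := by linarith
  have hγ : 0 < γ := by linarith
  -- K bounds z exp(-tz) and its first two derivatives in z on [m, γ], relative to exp(-(m/2)t); the
  -- powers of 1/m come from t exp(-(m/4)t) ≤ 4/m.
  set K : ℝ := γ + 1 + 4 * γ / m + 8 / m + 16 * γ / m ^ 2 with hK
  have hK0 : 0 < K := by positivity
  refine ⟨K * (1 / u₀ + 2 / u₀ ^ 2 + 2 / u₀ ^ 3), by positivity, ?_⟩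
  intro t ht
  set A := Real.exp (-(m / 2) * t) with hA
  have hA0 : 0 < A := Real.exp_pos _
  set a := Real.exp (-(m / 4) * t) with ha
  have ha0 : 0 < a := Real.exp_pos _
  have ha1 : a ≤ 1 := by rw [ha, Real.exp_le_one_iff]; nlinarith
  have hta : t * a ≤ 4 / m := by
    have := mul_exp_neg_le (a := m / 4) (t := t) (by positivity)
    rwa [one_div_div] at this
  have hta0 : 0 ≤ t * a := by positivity
  have hsplit : Real.exp (-m * t) = a * a * A := by
    rw [ha, hA, ← Real.exp_add, ← Real.exp_add]; congr 1; ring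
  have hez : ∀ z, m ≤ z → Real.exp (-t * z) ≤ a * a * A := by
    intro z hz; rw [← hsplit]; exact Real.exp_le_exp.mpr (by nlinarith)
  have q1 : γ ≤ K := by
    have : 0 ≤ 1 + 4 * γ / m + 8 / m + 16 * γ / m ^ 2 := by positivity
    rw [hK]; linarith
  have B0 : ∀ z, m ≤ z → z ≤ γ → |z * Real.exp (-t * z)| ≤ K * A := by
    intro z hz hz'
    rw [abs_of_pos (mul_pos (by linarith) (Real.exp_pos _))]
    calc _ ≤ γ * (a * a * A) := mul_le_mul hz' (hez z hz) (Real.exp_pos _).le hγ.le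
      _ ≤ γ * (1 * 1 * A) := by gcongr
      _ ≤ _ := by nlinarith
  have B1 : ∀ z, m ≤ z → z ≤ γ → |(1 - t * z) * Real.exp (-t * z)| ≤ K * A := by
    intro z hz hz'
    rw [abs_mul, Real.abs_exp]
    have h1 : |1 - t * z| ≤ 1 + t * γ := by
      have h2 : 0 ≤ t * z := mul_nonneg ht (by linarith)
      have h3 : t * z ≤ t * γ := mul_le_mul_of_nonneg_left hz' ht
      rw [abs_le]; constructor <;> linarith
    calc _ ≤ (1 + t * γ) * (a * a * A) := mul_le_mul h1 (hez z hz) (Real.exp_pos _).le (by positivity)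
      _ = (a * a + γ * (t * a) * a) * A := by ring
      _ ≤ (1 * 1 + γ * (4 / m) * 1) * A := by gcongr
      _ ≤ K * A := by
        refine mul_le_mul_of_nonneg_right ?_ hA0.le
        have : 0 ≤ γ + 8 / m + 16 * γ / m ^ 2 := by positivity
        rw [hK, show γ * (4 / m) = 4 * γ / m by ring]; linarith
  have B2 : ∀ z, m ≤ z → z ≤ γ → |(t ^ 2 * z - 2 * t) * Real.exp (-t * z)| ≤ K * A := by
    intro z hz hz'
    rw [abs_mul, Real.abs_exp]
    have h1 : |t ^ 2 * z - 2 * t| ≤ t ^ 2 * γ + 2 * t := by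
      have h2 : 0 ≤ t ^ 2 * z := mul_nonneg (by positivity) (by linarith)
      have h3 : t ^ 2 * z ≤ t ^ 2 * γ := mul_le_mul_of_nonneg_left hz' (by positivity)
      rw [abs_le]; constructor <;> linarith
    calc _ ≤ (t ^ 2 * γ + 2 * t) * (a * a * A) :=
          mul_le_mul h1 (hez z hz) (Real.exp_pos _).le (by positivity)
      _ = (γ * ((t * a) * (t * a)) + 2 * (t * a) * a) * A := by ring
      _ ≤ (γ * ((4 / m) * (4 / m)) + 2 * (4 / m) * 1) * A := by gcongr
      _ ≤ K * A := by
        refine mul_le_mul_of_nonneg_right ?_ hA0.le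
        have : 0 ≤ γ + 1 + 4 * γ / m := by positivity
        rw [hK, show γ * ((4 / m) * (4 / m)) = 16 * γ / m ^ 2 by field_simp; ring,
          show 2 * (4 / m) * 1 = 8 / m by ring]
        linarith
  set p0 : ℝ → ℝ := fun z => z * Real.exp (-t * z) with hp0
  set p1 : ℝ → ℝ := fun z => (1 - t * z) * Real.exp (-t * z) with hp1
  set p2 : ℝ → ℝ := fun z => (t ^ 2 * z - 2 * t) * Real.exp (-t * z) with hp2
  set P0 : ℝ → ℝ := fun u => p0 (γ / 2 + u) - p0 (γ / 2 - u) with hP0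
  set P1 : ℝ → ℝ := fun u => p1 (γ / 2 + u) + p1 (γ / 2 - u) with hP1
  set P2 : ℝ → ℝ := fun u => p2 (γ / 2 + u) - p2 (γ / 2 - u) with hP2
  have dP0 : ∀ u, HasDerivAt P0 (P1 u) u := by
    intro u
    have h1 := (hasDerivAt_rate_exp t (γ / 2 + u)).comp u ((hasDerivAt_id u).const_add (γ / 2))
    have h2 := (hasDerivAt_rate_exp t (γ / 2 - u)).comp u ((hasDerivAt_id u).const_sub (γ / 2))
    exact (h1.sub h2).congr_deriv (by simp only [hP1, hp1]; ring)
  have dP1 : ∀ u, HasDerivAt P1 (P2 u) u := by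
    intro u
    have h1 := (hasDerivAt_rate_exp' t (γ / 2 + u)).comp u ((hasDerivAt_id u).const_add (γ / 2))
    have h2 := (hasDerivAt_rate_exp' t (γ / 2 - u)).comp u ((hasDerivAt_id u).const_sub (γ / 2))
    exact (h1.add h2).congr_deriv (by simp only [hP2, hp2]; ring)
  have range : ∀ u ∈ Icc u₀ u₁, m ≤ γ / 2 + u ∧ γ / 2 + u ≤ γ ∧ m ≤ γ / 2 - u ∧ γ / 2 - u ≤ γ :=
    fun u hu => ⟨by linarith [hu.1, hu.2], by linarith [hu.2], by linarith [hu.2],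
      by linarith [hu.1]⟩
  have bP0 : ∀ u ∈ Icc u₀ u₁, |P0 u| ≤ 2 * (K * A) := fun u hu => by
    obtain ⟨r1, r2, r3, r4⟩ := range u hu
    exact (abs_sub _ _).trans (by linarith [B0 _ r1 r2, B0 _ r3 r4])
  have bP1 : ∀ u ∈ Icc u₀ u₁, |P1 u| ≤ 2 * (K * A) := fun u hu => by
    obtain ⟨r1, r2, r3, r4⟩ := range u hu
    exact (abs_add_le _ _).trans (by linarith [B1 _ r1 r2, B1 _ r3 r4])
  have bP2 : ∀ u ∈ Icc u₀ u₁, |P2 u| ≤ 2 * (K * A) := fun u hu => by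
    obtain ⟨r1, r2, r3, r4⟩ := range u hu
    exact (abs_sub _ _).trans (by linarith [B2 _ r1 r2, B2 _ r3 r4])
  set F1 : ℝ → ℝ := fun u => P1 u / (2 * u) - P0 u / (2 * u ^ 2) with hF1
  set F2 : ℝ → ℝ := fun u => P2 u / (2 * u) - P1 u / u ^ 2 + P0 u / u ^ 3 with hF2
  have hmode : (fun u => mode γ u t) = fun u => P0 u / (2 * u) := by
    funext u; simp only [mode, hP0, hp0]; ring
  have d1 : ∀ u ∈ Icc u₀ u₁, HasDerivAt (fun u => mode γ u t) (F1 u) u := by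
    intro u hu
    have hu0 : u ≠ 0 := (hu₀.trans_le hu.1).ne'
    rw [hmode]
    have := (dP0 u).div ((hasDerivAt_id u).const_mul 2) (by simpa using hu0)
    simp only [id] at this
    exact this.congr_deriv (by simp only [hF1]; field_simp)
  have d2 : ∀ u ∈ Icc u₀ u₁, HasDerivAt F1 (F2 u) u := by
    intro u hu
    have hu0 : u ≠ 0 := (hu₀.trans_le hu.1).ne'
    have h1 := (dP1 u).div ((hasDerivAt_id u).const_mul 2) (by simpa using hu0)
    have h2 := (dP0 u).div (((hasDerivAt_id u).pow 2).const_mul 2) (by simpa using hu0)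
    simp only [id] at h1 h2
    exact (h1.sub h2).congr_deriv (by simp only [hF2]; field_simp; simp; ring)
  have inv1 : ∀ u ∈ Icc u₀ u₁, 1 / u ≤ 1 / u₀ := fun u hu => one_div_le_one_div_of_le hu₀ hu.1
  have b1 : ∀ u ∈ Icc u₀ u₁, |F1 u| ≤ K * (1 / u₀ + 2 / u₀ ^ 2 + 2 / u₀ ^ 3) * A := by
    intro u hu
    have hu0 : 0 < u := hu₀.trans_le hu.1
    have i1 := inv1 u hu
    have i0 : 0 < 1 / u := by positivity
    simp only [hF1]
    refine (abs_sub _ _).trans ?_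
    rw [abs_div, abs_div, abs_of_pos (by positivity : 0 < 2 * u),
      abs_of_pos (by positivity : 0 < 2 * u ^ 2)]
    calc _ ≤ 2 * (K * A) / (2 * u) + 2 * (K * A) / (2 * u ^ 2) := by
          have := bP0 u hu; have := bP1 u hu; gcongr
      _ = K * A * (1 / u + (1 / u) ^ 2) := by field_simp
      _ ≤ K * A * (1 / u₀ + (1 / u₀) ^ 2) := by gcongr
      _ ≤ K * A * (1 / u₀ + 2 / u₀ ^ 2 + 2 / u₀ ^ 3) := by
        refine mul_le_mul_of_nonneg_left ?_ (by positivity)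
        have : 0 < 1 / u₀ ^ 2 := by positivity
        have : 0 < 2 / u₀ ^ 3 := by positivity
        rw [one_div_pow, show 2 / u₀ ^ 2 = 2 * (1 / u₀ ^ 2) by ring]
        linarith
      _ = _ := by ring
  have b2 : ∀ u ∈ Icc u₀ u₁, |F2 u| ≤ K * (1 / u₀ + 2 / u₀ ^ 2 + 2 / u₀ ^ 3) * A := by
    intro u hu
    have hu0 : 0 < u := hu₀.trans_le hu.1
    have i1 := inv1 u hu
    have i0 : 0 < 1 / u := by positivity
    simp only [hF2]
    refine (abs_add_le _ _).trans ((add_le_add_left (abs_sub _ _) _).trans ?_)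
    rw [abs_div, abs_div, abs_div, abs_of_pos (by positivity : 0 < 2 * u),
      abs_of_pos (by positivity : 0 < u ^ 2), abs_of_pos (by positivity : 0 < u ^ 3)]
    calc _ ≤ 2 * (K * A) / (2 * u) + 2 * (K * A) / u ^ 2 + 2 * (K * A) / u ^ 3 := by
          have := bP0 u hu; have := bP1 u hu; have := bP2 u hu; gcongr
      _ = K * A * (1 / u + 2 * (1 / u) ^ 2 + 2 * (1 / u) ^ 3) := by field_simp
      _ ≤ K * A * (1 / u₀ + 2 * (1 / u₀) ^ 2 + 2 * (1 / u₀) ^ 3) := by gcongr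
      _ = _ := by field_simp
  exact ⟨fun x hx y hy => first_difference_le d1 b1 hx hy,
    fun x hx y hy z hz => second_difference_le d1 d2 b1 b2 hx hy hz⟩

end Bounds

/-- The tail mass `∫_t^∞ 2 γ mode²`. -/
def modeTail (γ u t : ℝ) : ℝ :=
  γ / (2 * u ^ 2) * ((γ / 2 + u) / 2 * Real.exp (-(2 * (γ / 2 + u)) * t)
    + (γ / 2 - u) / 2 * Real.exp (-(2 * (γ / 2 - u)) * t)
    - 2 * (γ / 2 + u) * (γ / 2 - u) / γ * Real.exp (-γ * t))

/-- The square is a combination of exponentials with rates 2μ₊, 2μ₋ and μ₊ + μ₋ = γ, which makes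
mass, mean and tail explicit. At u = 0 both sides vanish because division by zero gives zero. -/
theorem mode_sq (γ u t : ℝ) : 2 * γ * mode γ u t ^ 2
    = γ / (2 * u ^ 2) * ((γ / 2 + u) ^ 2 * Real.exp (-(2 * (γ / 2 + u)) * t)
      + (γ / 2 - u) ^ 2 * Real.exp (-(2 * (γ / 2 - u)) * t)
      - 2 * (γ / 2 + u) * (γ / 2 - u) * Real.exp (-γ * t)) := by
  have e1 : Real.exp (-(2 * (γ / 2 + u)) * t) = Real.exp (-t * (γ / 2 + u)) ^ 2 := by
    rw [← Real.exp_nat_mul]; congr 1; push_cast; ring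
  have e2 : Real.exp (-(2 * (γ / 2 - u)) * t) = Real.exp (-t * (γ / 2 - u)) ^ 2 := by
    rw [← Real.exp_nat_mul]; congr 1; push_cast; ring
  have e3 : Real.exp (-γ * t) = Real.exp (-t * (γ / 2 + u)) * Real.exp (-t * (γ / 2 - u)) := by
    rw [← Real.exp_add]; congr 1; ring
  rw [e1, e2, e3, mode]
  by_cases hu : u = 0
  · simp [hu]
  · field_simp
    ring

theorem integral_mul_exp_neg_Ioi {a : ℝ} (ha : 0 < a) :
    ∫ s in Ioi (0 : ℝ), s * Real.exp (-a * s) = 1 / a ^ 2 := by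
  have := Real.integral_rpow_mul_exp_neg_mul_Ioi (a := 2) (r := a) (by norm_num) ha
  rw [Real.Gamma_two, mul_one] at this
  calc _ = ∫ t in Ioi (0 : ℝ), t ^ ((2 : ℝ) - 1) * Real.exp (-(a * t)) := by
        refine setIntegral_congr_fun measurableSet_Ioi fun s _ => ?_
        rw [show (2 : ℝ) - 1 = 1 by norm_num, Real.rpow_one, neg_mul]
    _ = _ := by rw [this]; norm_num

theorem integrableOn_mul_exp_neg_Ioi {a : ℝ} (ha : 0 < a) :
    IntegrableOn (fun s => s * Real.exp (-a * s)) (Ioi 0) := by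
  refine integrableOn_Ioi_of_le_exp (C := 2 / a) (m := a / 2) (by fun_prop) (by positivity) le_rfl ?_
  intro s hs
  have h1 := mul_exp_neg_le (a := a / 2) (t := s) (by positivity)
  rw [one_div_div] at h1
  rw [Real.norm_of_nonneg (by positivity)]
  calc s * Real.exp (-a * s) = (s * Real.exp (-(a / 2) * s)) * Real.exp (-(a / 2) * s) := by
        rw [mul_assoc, ← Real.exp_add]; congr 2; ring
    _ ≤ _ := mul_le_mul_of_nonneg_right h1 (Real.exp_pos _).le

theorem integral_combination {μ : Measure ℝ} {f g h : ℝ → ℝ} (hf : Integrable f μ)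
    (hg : Integrable g μ) (hh : Integrable h μ) (a b c : ℝ) :
    ∫ s, (a * f s + b * g s - c * h s) ∂μ
      = a * ∫ s, f s ∂μ + b * ∫ s, g s ∂μ - c * ∫ s, h s ∂μ := by
  have I : Integrable (fun s => a * f s + b * g s) μ := (hf.const_mul a).add (hg.const_mul b)
  rw [integral_sub I (hh.const_mul c), integral_add (hf.const_mul a) (hg.const_mul b),
    integral_const_mul, integral_const_mul, integral_const_mul]

/-! ### Mass, mean and hazard rate of the squared response -/

section Integrals

variable {γ u : ℝ}

theorem integral_mode_sq (hu : 0 < u) (hu' : u < γ / 2) (t : ℝ) :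
    ∫ s in Ioi t, 2 * γ * mode γ u s ^ 2 = modeTail γ u t := by
  have h1 : 0 < 2 * (γ / 2 + u) := by linarith
  have h2 : 0 < 2 * (γ / 2 - u) := by linarith
  have h3 : 0 < γ := by linarith
  have I1 := integrableOn_exp_neg_mul_Ioi h1 t
  have I2 := integrableOn_exp_neg_mul_Ioi h2 t
  have I3 := integrableOn_exp_neg_mul_Ioi h3 t
  simp_rw [mode_sq]
  rw [integral_const_mul, integral_combination I1 I2 I3, integral_exp_neg_mul_Ioi h1,
    integral_exp_neg_mul_Ioi h2, integral_exp_neg_mul_Ioi h3, modeTail]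
  have : γ / 2 + u ≠ 0 := by linarith
  have : γ / 2 - u ≠ 0 := by linarith
  field_simp

theorem integrableOn_mode_sq (hu : 0 < u) (hu' : u < γ / 2) (t : ℝ) :
    IntegrableOn (fun s => 2 * γ * mode γ u s ^ 2) (Ioi t) := by
  have h1 : 0 < 2 * (γ / 2 + u) := by linarith
  have h2 : 0 < 2 * (γ / 2 - u) := by linarith
  have h3 : 0 < γ := by linarith
  simp_rw [mode_sq]
  exact ((((integrableOn_exp_neg_mul_Ioi h1 t).const_mul _).add
    ((integrableOn_exp_neg_mul_Ioi h2 t).const_mul _)).sub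
    ((integrableOn_exp_neg_mul_Ioi h3 t).const_mul _)).const_mul _

/-- The mass does not depend on u; hence the zero frequency kernel, an average over modes, has mass
one for every L. -/
theorem modeTail_zero (hu : 0 < u) (hu' : u < γ / 2) : modeTail γ u 0 = 1 := by
  have h3 : 0 < γ := by linarith
  unfold modeTail
  simp only [mul_zero, Real.exp_zero, mul_one]
  field_simp
  ring

/-- The mean does not depend on u either. It is the reason why a mass defect and the resulting decay
rate differ by the factor γ in `exists_rate`. -/
theorem integral_mul_mode_sq (hu : 0 < u) (hu' : u < γ / 2) :
    ∫ s in Ioi (0 : ℝ), s * (2 * γ * mode γ u s ^ 2) = 1 / γ := by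
  have h1 : 0 < 2 * (γ / 2 + u) := by linarith
  have h2 : 0 < 2 * (γ / 2 - u) := by linarith
  have h3 : 0 < γ := by linarith
  have I1 := integrableOn_mul_exp_neg_Ioi h1
  have I2 := integrableOn_mul_exp_neg_Ioi h2
  have I3 := integrableOn_mul_exp_neg_Ioi h3
  have e : (fun s => s * (2 * γ * mode γ u s ^ 2)) = fun s => γ / (2 * u ^ 2)
      * ((γ / 2 + u) ^ 2 * (s * Real.exp (-(2 * (γ / 2 + u)) * s))
      + (γ / 2 - u) ^ 2 * (s * Real.exp (-(2 * (γ / 2 - u)) * s))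
      - 2 * (γ / 2 + u) * (γ / 2 - u) * (s * Real.exp (-γ * s))) := by
    funext s; rw [mode_sq]; ring
  rw [e, integral_const_mul, integral_combination I1 I2 I3, integral_mul_exp_neg_Ioi h1,
    integral_mul_exp_neg_Ioi h2, integral_mul_exp_neg_Ioi h3]
  have : γ / 2 + u ≠ 0 := by linarith
  have : γ / 2 - u ≠ 0 := by linarith
  have : γ + 2 * u ≠ 0 := by linarith
  have : γ - 2 * u ≠ 0 := by linarith
  field_simp
  ring

theorem modeTail_integrable (hu : 0 < u) (hu' : u < γ / 2) :
    IntegrableOn (modeTail γ u) (Ioi 0) := by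
  have h1 : 0 < 2 * (γ / 2 + u) := by linarith
  have h2 : 0 < 2 * (γ / 2 - u) := by linarith
  have h3 : 0 < γ := by linarith
  unfold modeTail
  exact ((((integrableOn_exp_neg_mul_Ioi h1 0).const_mul _).add
    ((integrableOn_exp_neg_mul_Ioi h2 0).const_mul _)).sub
    ((integrableOn_exp_neg_mul_Ioi h3 0).const_mul _)).const_mul _

theorem integral_modeTail (hu : 0 < u) (hu' : u < γ / 2) :
    ∫ s in Ioi (0 : ℝ), modeTail γ u s = 1 / γ := by
  have h1 : 0 < 2 * (γ / 2 + u) := by linarith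
  have h2 : 0 < 2 * (γ / 2 - u) := by linarith
  have h3 : 0 < γ := by linarith
  have I1 := integrableOn_exp_neg_mul_Ioi h1 0
  have I2 := integrableOn_exp_neg_mul_Ioi h2 0
  have I3 := integrableOn_exp_neg_mul_Ioi h3 0
  unfold modeTail
  rw [integral_const_mul, integral_combination I1 I2 I3, integral_exp_neg_mul_Ioi h1,
    integral_exp_neg_mul_Ioi h2, integral_exp_neg_mul_Ioi h3]
  have : γ / 2 + u ≠ 0 := by linarith
  have : γ / 2 - u ≠ 0 := by linarith
  have : γ + 2 * u ≠ 0 := by linarith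
  have : γ - 2 * u ≠ 0 := by linarith
  simp only [mul_zero, Real.exp_zero]
  field_simp
  ring

theorem modeTail_le_one (hu : 0 < u) (hu' : u < γ / 2) {t : ℝ} (ht : 0 ≤ t) :
    modeTail γ u t ≤ 1 := by
  have h3 : 0 < γ := by linarith
  rw [← modeTail_zero hu hu', ← integral_mode_sq hu hu', ← integral_mode_sq hu hu']
  refine setIntegral_mono_set (integrableOn_mode_sq hu hu' 0) ?_ ?_
  · exact Filter.Eventually.of_forall fun s => by simp only [Pi.zero_apply]; positivity
  · exact Filter.Eventually.of_forall fun s hs => lt_of_le_of_lt ht hs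

theorem modeTail_le (hu : 0 < u) (hu' : u < γ / 2) {t : ℝ} (ht : 0 ≤ t) :
    modeTail γ u t ≤ γ ^ 2 / (4 * u ^ 2) * Real.exp (-(2 * (γ / 2 - u)) * t) := by
  have h3 : 0 < γ := by linarith
  have e1 : Real.exp (-(2 * (γ / 2 + u)) * t) ≤ Real.exp (-(2 * (γ / 2 - u)) * t) :=
    Real.exp_le_exp.mpr (by nlinarith)
  have e2 : 0 ≤ 2 * (γ / 2 + u) * (γ / 2 - u) / γ * Real.exp (-γ * t) := by
    have : 0 < γ / 2 - u := by linarith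
    positivity
  unfold modeTail
  set A := Real.exp (-(2 * (γ / 2 - u)) * t)
  have e3 := mul_le_mul_of_nonneg_left e1 (by linarith : 0 ≤ (γ / 2 + u) / 2)
  calc _ ≤ γ / (2 * u ^ 2) * (γ / 2 * A) :=
        mul_le_mul_of_nonneg_left (by linarith) (by positivity)
    _ = _ := by field_simp; ring

/-- The kernel of a mode has a definite hazard rate except for a short time around its zero. -/
theorem mode_hazard {u₀ u₁ : ℝ} (hu₀ : 0 < u₀) (hu₁ : u₁ < γ / 2) (h01 : u₀ ≤ u₁) :
    ∃ a > 0, ∃ η > 0, ∀ u ∈ Icc u₀ u₁,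
      ∫ s in Ioi (0 : ℝ), |2 * γ * mode γ u s ^ 2 - a * modeTail γ u s| ≤ 1 - η := by
  set m : ℝ := γ / 2 - u₁ with hm
  have hm0 : 0 < m := by linarith
  have hγ : 0 < γ := by linarith
  -- A mode vanishes at one positive time, so its hazard rate has no positive lower bound; but the
  -- set J of bad times is short. Here r ≤ m/2 keeps v steep on J, r ≤ mu₀/(16γ) gives D ≤ 1/(8γ),
  -- and a = 2r²/γ converts the comparison with the tail into |v| ≤ r.
  set r : ℝ := min (m / 2) (m * u₀ / (16 * γ)) with hr
  have hr0 : 0 < r := by positivity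
  have hr1 : r ≤ m / 2 := min_le_left _ _
  have hr2 : r ≤ m * u₀ / (16 * γ) := min_le_right _ _
  set a : ℝ := 2 * r ^ 2 / γ with ha
  have ha0 : 0 < a := by positivity
  refine ⟨a, ha0, a / (2 * γ), by positivity, ?_⟩
  intro u hu
  have hu0 : 0 < u := hu₀.trans_le hu.1
  have hu2 : u < γ / 2 := hu.2.trans_lt hu₁
  set v : ℝ → ℝ := fun t => (γ / 2 + u) * Real.exp (-(2 * u) * t) - (γ / 2 - u) with hv
  have hmv : ∀ t, 2 * γ * mode γ u t ^ 2
      = γ / (2 * u ^ 2) * (Real.exp (-(2 * (γ / 2 - u)) * t) * v t ^ 2) := by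
    intro t
    have e1 : Real.exp (-t * (γ / 2 + u)) = Real.exp (-t * (γ / 2 - u)) * Real.exp (-(2 * u) * t) := by
      rw [← Real.exp_add]; congr 1; ring
    have e2 : Real.exp (-(2 * (γ / 2 - u)) * t) = Real.exp (-t * (γ / 2 - u)) ^ 2 := by
      rw [← Real.exp_nat_mul]; congr 1; push_cast; ring
    rw [mode, e1, e2]
    simp only [hv]
    field_simp
  set J : Set ℝ := {t | 0 < t ∧ 2 * γ * mode γ u t ^ 2 < a * modeTail γ u t} with hJ
  have hJv : ∀ t ∈ J, |v t| ≤ r := by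
    intro t ht
    have h1 : 2 * γ * mode γ u t ^ 2 < a * (γ ^ 2 / (4 * u ^ 2)
        * Real.exp (-(2 * (γ / 2 - u)) * t)) :=
      ht.2.trans_le (mul_le_mul_of_nonneg_left (modeTail_le hu0 hu2 ht.1.le) ha0.le)
    rw [hmv] at h1
    set A := Real.exp (-(2 * (γ / 2 - u)) * t) with hA
    have hA0 : 0 < A := Real.exp_pos _
    have h2 : γ / (2 * u ^ 2) * (A * v t ^ 2) = (γ * A / (2 * u ^ 2)) * v t ^ 2 := by ring
    have h3 : a * (γ ^ 2 / (4 * u ^ 2) * A) = (γ * A / (2 * u ^ 2)) * r ^ 2 := by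
      rw [ha]; field_simp; ring
    rw [h2, h3] at h1
    have h4 : v t ^ 2 < r ^ 2 := lt_of_mul_lt_mul_left h1 (by positivity)
    exact (abs_lt_of_sq_lt_sq h4 hr0.le).le
  set D : ℝ := 2 * r / (m * u₀) with hD
  -- The function v decreases, with slope of modulus at least mu₀ where |v| ≤ r, so it crosses the
  -- strip |v| ≤ r within the time 2r/(mu₀).
  have hdist : ∀ t ∈ J, ∀ s ∈ J, t ≤ s → s - t ≤ D := by
    intro t ht s hs hts
    have h1 := (abs_le.mp (hJv t ht)).2
    have h2 := (abs_le.mp (hJv s hs)).1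
    have h3 : m / 2 ≤ (γ / 2 + u) * Real.exp (-(2 * u) * s) := by
      have : m ≤ γ / 2 - u := by linarith [hu.2]
      simp only [hv] at h2
      linarith
    have h4 : Real.exp (-(2 * u) * t) = Real.exp (-(2 * u) * s) * Real.exp (2 * u * (s - t)) := by
      rw [← Real.exp_add]; congr 1; ring
    have h5 : 2 * u * (s - t) + 1 ≤ Real.exp (2 * u * (s - t)) := Real.add_one_le_exp _
    have h6 : v t - v s = (γ / 2 + u) * Real.exp (-(2 * u) * s)
        * (Real.exp (2 * u * (s - t)) - 1) := by
      simp only [hv]; rw [h4]; ring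
    have h7 : m / 2 * (2 * u₀ * (s - t)) ≤ v t - v s := by
      rw [h6]
      have h8 : 2 * u₀ * (s - t) ≤ 2 * u * (s - t) :=
        mul_le_mul_of_nonneg_right (by linarith [hu.1]) (by linarith)
      refine mul_le_mul h3 (by linarith) (mul_nonneg (by linarith) (by linarith)) ?_
      have : 0 < γ / 2 + u := by linarith
      positivity
    rw [hD, le_div_iff₀ (by positivity)]
    linarith
  have hJsub : ∃ t₀, J ⊆ Icc (t₀ - D) (t₀ + D) := by
    by_cases hne : J.Nonempty
    · obtain ⟨t₀, ht₀⟩ := hne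
      refine ⟨t₀, fun s hs => ?_⟩
      have hD0 : 0 ≤ D := by positivity
      rcases le_total t₀ s with h | h
      · have := hdist t₀ ht₀ s hs h
        constructor <;> linarith
      · have := hdist s hs t₀ ht₀ h
        constructor <;> linarith
    · rw [not_nonempty_iff_eq_empty] at hne
      exact ⟨0, by rw [hne]; exact empty_subset _⟩
  obtain ⟨t₀, ht₀⟩ := hJsub
  have hD0 : 0 ≤ D := by positivity
  have If := integrableOn_mode_sq hu0 hu2 0
  have It := (modeTail_integrable hu0 hu2).const_mul a
  have Iind : IntegrableOn ((Icc (t₀ - D) (t₀ + D)).indicator fun _ => 2 * a) (Ioi 0) := by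
    refine Integrable.integrableOn ?_
    exact (integrable_indicator_iff measurableSet_Icc).mpr (integrableOn_const (by simp))
  -- The tail is at most one, so the negative part is at most a. The absolute value adds twice the
  -- negative part, which lives on J.
  have hpt : ∀ s ∈ Ioi (0 : ℝ), |2 * γ * mode γ u s ^ 2 - a * modeTail γ u s|
      ≤ (2 * γ * mode γ u s ^ 2 - a * modeTail γ u s)
        + (Icc (t₀ - D) (t₀ + D)).indicator (fun _ => 2 * a) s := by
    intro s hs
    by_cases hsJ : s ∈ J
    · rw [indicator_of_mem (ht₀ hsJ), abs_of_neg (by linarith [hsJ.2])]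
      have h1 := mul_le_mul_of_nonneg_left (modeTail_le_one hu0 hu2 (le_of_lt hs)) ha0.le
      have h2 : 0 ≤ 2 * γ * mode γ u s ^ 2 := by positivity
      linarith
    · have : a * modeTail γ u s ≤ 2 * γ * mode γ u s ^ 2 := by
        by_contra hcon
        exact hsJ ⟨hs, not_le.mp hcon⟩
      rw [abs_of_nonneg (by linarith)]
      have : 0 ≤ (Icc (t₀ - D) (t₀ + D)).indicator (fun _ => 2 * a) s :=
        indicator_nonneg (fun _ _ => by positivity) _
      linarith
  have Isub : IntegrableOn (fun s => 2 * γ * mode γ u s ^ 2 - a * modeTail γ u s) (Ioi 0) :=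
    If.sub It
  -- Without the absolute value the integral is 1 - a/γ, mass minus a times mean; the short set
  -- gives back at most half of the gain a/γ.
  calc _ ≤ ∫ s in Ioi (0 : ℝ), ((2 * γ * mode γ u s ^ 2 - a * modeTail γ u s)
        + (Icc (t₀ - D) (t₀ + D)).indicator (fun _ => 2 * a) s) :=
        setIntegral_mono_on Isub.abs (Isub.add Iind) measurableSet_Ioi hpt
    _ = (1 - a / γ) + ∫ s in Ioi (0 : ℝ), (Icc (t₀ - D) (t₀ + D)).indicator (fun _ => 2 * a) s := by
        rw [integral_add Isub Iind, integral_sub If It,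
          integral_mode_sq hu0 hu2, integral_const_mul, modeTail_zero hu0 hu2, integral_modeTail hu0 hu2]
        ring
    _ ≤ (1 - a / γ) + a / (2 * γ) := by
        refine add_le_add le_rfl ?_
        calc _ ≤ ∫ s, (Icc (t₀ - D) (t₀ + D)).indicator (fun _ => 2 * a) s := by
              refine setIntegral_le_integral
                ((integrable_indicator_iff measurableSet_Icc).mpr (integrableOn_const (by simp))) ?_
              exact Filter.Eventually.of_forall fun s => indicator_nonneg (fun _ _ => by positivity) _
          _ = 2 * D * (2 * a) := by
              rw [integral_indicator measurableSet_Icc, setIntegral_const, Real.volume_real_Icc,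
                max_eq_left (by linarith), smul_eq_mul]
              ring
          _ ≤ a / (2 * γ) := by
              have : D ≤ 1 / (8 * γ) := by
                rw [le_div_iff₀ (by positivity)] at hr2
                rw [hD, div_le_div_iff₀ (by positivity) (by positivity)]
                linarith
              calc 2 * D * (2 * a) ≤ 2 * (1 / (8 * γ)) * (2 * a) := by gcongr
                _ = _ := by field_simp; ring
    _ = _ := by field_simp; ring

end Integrals

/-! ### Decorrelation of two modes -/

theorem mode_eq_cosh {γ u : ℝ} (hu : u ≠ 0) (t : ℝ) :
    mode γ u t = Real.exp (-(γ / 2) * t)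
      * (Real.cosh (u * t) - γ / 2 * (Real.sinh (u * t) / u)) := by
  have e1 : Real.exp (-t * (γ / 2 + u)) = Real.exp (-(γ / 2) * t) * Real.exp (-(u * t)) := by
    rw [← Real.exp_add]; congr 1; ring
  have e2 : Real.exp (-t * (γ / 2 - u)) = Real.exp (-(γ / 2) * t) * Real.exp (u * t) := by
    rw [← Real.exp_add]; congr 1; ring
  rw [mode, e1, e2, Real.cosh_eq, Real.sinh_eq]
  field_simp
  ring

theorem sinh_le_mul_cosh {x : ℝ} (hx : 0 ≤ x) : Real.sinh x ≤ x * Real.cosh x := by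
  have hmono : MonotoneOn (fun x => x * Real.cosh x - Real.sinh x) (Ici 0) := by
    refine monotoneOn_of_hasDerivWithinAt_nonneg (convex_Ici 0)
      (f' := fun x => x * Real.sinh x) (by fun_prop) ?_ ?_
    · intro y _
      have := ((hasDerivAt_id y).mul (Real.hasDerivAt_cosh y)).sub (Real.hasDerivAt_sinh y)
      simp only [id] at this
      exact (this.congr_deriv (by ring)).hasDerivWithinAt
    · intro y hy
      rw [interior_Ici] at hy
      exact mul_nonneg (le_of_lt hy) (Real.sinh_nonneg_iff.mpr (le_of_lt hy))
  have := hmono (show (0 : ℝ) ∈ Ici (0 : ℝ) by simp) hx hx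
  simp only [zero_mul, Real.sinh_zero, sub_zero] at this
  linarith

theorem mul_cosh_sub_sinh_le {x : ℝ} (hx : 0 ≤ x) (hx1 : x ≤ 1) :
    x * Real.cosh x - Real.sinh x ≤ x ^ 3 := by
  have h1 : x ≤ Real.sinh x := Real.self_le_sinh_iff.mpr hx
  have h2 := Real.cosh_le_exp_half_sq x
  have h3 := exp_sub_one_le (z := x ^ 2 / 2)
  have h4 : Real.exp (x ^ 2 / 2) ≤ 2 := by
    have h5 : Real.exp (x ^ 2 / 2) ≤ Real.exp (1 / 2) := Real.exp_le_exp.mpr (by nlinarith)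
    have h6 : Real.exp (1 / 2) ^ 2 ≤ 2 ^ 2 := by
      rw [← Real.exp_nat_mul]
      norm_num
      linarith [Real.exp_one_lt_d9]
    exact h5.trans (abs_le_of_sq_le_sq' h6 (by norm_num)).2
  have h7 : Real.cosh x - 1 ≤ x ^ 2 := by
    have := mul_le_mul_of_nonneg_left h4 (by positivity : 0 ≤ x ^ 2 / 2)
    linarith
  have := mul_le_mul_of_nonneg_left h7 hx
  nlinarith

/-- No mode has changed sign before the time 1/γ, because sinh y ≤ y cosh y. -/
theorem mode_nonneg {γ u t : ℝ} (hu : 0 < u) (hγ : 0 < γ) (ht : 0 ≤ t) (htγ : t ≤ 1 / γ) :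
    0 ≤ mode γ u t := by
  rw [mode_eq_cosh hu.ne']
  refine mul_nonneg (Real.exp_pos _).le ?_
  have h1 := sinh_le_mul_cosh (mul_nonneg hu.le ht)
  have h2 : Real.sinh (u * t) / u ≤ t * Real.cosh (u * t) := by
    rw [div_le_iff₀ hu]; linarith
  have h3 : γ / 2 * (Real.sinh (u * t) / u) ≤ γ / 2 * (t * Real.cosh (u * t)) :=
    mul_le_mul_of_nonneg_left h2 (by positivity)
  rw [le_div_iff₀ hγ] at htγ
  have h4 := Real.cosh_pos (u * t)
  nlinarith

/-- In the hyperbolic form the derivative in u is t sinh(ut) ≥ ut² minus a term at most (γ/2)ut³.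
For t ≤ 1/γ at least ut²/2 remains, so monotonicity in u survives the subtraction of u²t²/4. -/
theorem mode_sub_mode_ge {γ u v t : ℝ} (hu : 0 < u) (huv : u ≤ v) (hv : v ≤ γ / 2) (ht : 0 ≤ t)
    (htγ : t ≤ 1 / γ) :
    Real.exp (-(γ / 2) * t) * ((v ^ 2 - u ^ 2) * t ^ 2 / 4) ≤ mode γ v t - mode γ u t := by
  have hγ : 0 < γ := by linarith
  have hv0 : 0 < v := hu.trans_le huv
  have htγ' : t * γ ≤ 1 := by rwa [le_div_iff₀ hγ] at htγ
  have hmono : MonotoneOn (fun x => Real.cosh (x * t) - γ / 2 * (Real.sinh (x * t) / x)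
      - x ^ 2 * (t ^ 2 / 4)) (Icc u v) := by
    have hd : ∀ x ∈ Icc u v, HasDerivAt (fun x => Real.cosh (x * t)
        - γ / 2 * (Real.sinh (x * t) / x) - x ^ 2 * (t ^ 2 / 4))
        (t * Real.sinh (x * t) - γ / 2 * ((x * t * Real.cosh (x * t) - Real.sinh (x * t)) / x ^ 2)
          - x * t ^ 2 / 2) x := by
      intro x hx
      have hx0 : x ≠ 0 := (hu.trans_le hx.1).ne'
      have hxt : HasDerivAt (fun x => x * t) t x := by
        simpa using (hasDerivAt_id x).mul_const t
      have h1 := hxt.cosh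
      have h2 := (hxt.sinh.div (hasDerivAt_id x) hx0).const_mul (γ / 2)
      have h3 := ((hasDerivAt_id x).pow 2).mul_const (t ^ 2 / 4)
      simp only [id] at h2 h3
      exact ((h1.sub h2).sub h3).congr_deriv (by simp; ring)
    refine monotoneOn_of_hasDerivWithinAt_nonneg (convex_Icc u v)
      (fun x hx => (hd x hx).continuousAt.continuousWithinAt)
      (fun x hx => (hd x (interior_subset hx)).hasDerivWithinAt) ?_
    intro x hx
    have hx' := interior_subset hx
    have hx0 : 0 < x := hu.trans_le hx'.1
    have hxt0 : 0 ≤ x * t := by positivity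
    have hxt1 : x * t ≤ 1 := by nlinarith [hx'.2]
    have h1 : x * t ≤ Real.sinh (x * t) := Real.self_le_sinh_iff.mpr hxt0
    have h2 := mul_cosh_sub_sinh_le hxt0 hxt1
    have h3 : (x * t * Real.cosh (x * t) - Real.sinh (x * t)) / x ^ 2 ≤ x * t ^ 3 := by
      rw [div_le_iff₀ (by positivity)]; linarith
    have h4 := mul_le_mul_of_nonneg_left h3 (by positivity : 0 ≤ γ / 2)
    have h5 := mul_le_mul_of_nonneg_left h1 ht
    have h6 : γ / 2 * (x * t ^ 3) ≤ x * t ^ 2 / 2 := by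
      have := mul_le_mul_of_nonneg_left htγ' (by positivity : 0 ≤ x * t ^ 2 / 2)
      linarith
    linarith
  have h := hmono (left_mem_Icc.mpr huv) (right_mem_Icc.mpr huv) huv
  simp only at h
  rw [mode_eq_cosh hu.ne', mode_eq_cosh hv0.ne', ← mul_sub]
  exact mul_le_mul_of_nonneg_left (by linarith) (Real.exp_pos _).le

/-- Modes with different frequencies decorrelate. -/
theorem mode_decorrelation {γ u₀ u₁ : ℝ} (hu₀ : 0 < u₀) (hu₁ : u₁ < γ / 2) (h01 : u₀ ≤ u₁) :
    ∃ c > 0, ∀ u ∈ Icc u₀ u₁, ∀ v ∈ Icc u₀ u₁,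
      ∫ s in Ioi (0 : ℝ), 2 * γ * |mode γ u s * mode γ v s| ≤ 1 - c * (u ^ 2 - v ^ 2) ^ 2 := by
  have hγ : 0 < γ := by linarith
  -- The gain is the last term of 2|ab| = a² + b² - (|a| - |b|)². On (0, 1/γ] both modes are
  -- nonnegative and differ by at least exp(-γs/2)|u² - v²|s²/4. The constant is the integral of γ
  -- times the square of this bound, with exp(-γs) ≥ exp(-1).
  refine ⟨γ * (Real.exp (-1) / 16 * ((1 / γ) ^ 5 / 5)), by positivity, ?_⟩
  intro u hu v hv
  have hu0 : 0 < u := hu₀.trans_le hu.1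
  have hu2 : u < γ / 2 := hu.2.trans_lt hu₁
  have hv0 : 0 < v := hu₀.trans_le hv.1
  have hv2 : v < γ / 2 := hv.2.trans_lt hu₁
  have Iu := integrableOn_mode_sq hu0 hu2 0
  have Iv := integrableOn_mode_sq hv0 hv2 0
  have hpt : ∀ s ∈ Ioi (0 : ℝ), 2 * γ * |mode γ u s * mode γ v s|
      ≤ (1 / 2 * (2 * γ * mode γ u s ^ 2) + 1 / 2 * (2 * γ * mode γ v s ^ 2))
        - (Ioc 0 (1 / γ)).indicator
          (fun s => γ * (Real.exp (-1) / 16 * (u ^ 2 - v ^ 2) ^ 2 * s ^ 4)) s := by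
    intro s hs
    rw [abs_mul]
    by_cases hs1 : s ≤ 1 / γ
    · rw [indicator_of_mem (show s ∈ Ioc 0 (1 / γ) from ⟨hs, hs1⟩)]
      have n1 := mode_nonneg hu0 hγ (le_of_lt hs) hs1
      have n2 := mode_nonneg hv0 hγ (le_of_lt hs) hs1
      have key : Real.exp (-1) / 16 * (u ^ 2 - v ^ 2) ^ 2 * s ^ 4
          ≤ (mode γ u s - mode γ v s) ^ 2 := by
        have hexp : Real.exp (-1) ≤ Real.exp (-(γ / 2) * s) ^ 2 := by
          rw [← Real.exp_nat_mul]
          refine Real.exp_le_exp.mpr ?_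
          rw [le_div_iff₀ hγ] at hs1
          push_cast
          linarith
        have hsq : (Real.exp (-(γ / 2) * s) * ((v ^ 2 - u ^ 2) * s ^ 2 / 4)) ^ 2
            ≤ (mode γ u s - mode γ v s) ^ 2 := by
          rcases le_total u v with h | h
          · have := mode_sub_mode_ge hu0 h hv2.le (le_of_lt hs) hs1
            rw [sub_sq_comm (mode γ u s)]
            refine pow_le_pow_left₀ ?_ this 2
            have : 0 ≤ v ^ 2 - u ^ 2 := by nlinarith
            positivity
          · have := mode_sub_mode_ge hv0 h hu2.le (le_of_lt hs) hs1
            have e : (Real.exp (-(γ / 2) * s) * ((v ^ 2 - u ^ 2) * s ^ 2 / 4)) ^ 2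
              = (Real.exp (-(γ / 2) * s) * ((u ^ 2 - v ^ 2) * s ^ 2 / 4)) ^ 2 := by ring
            rw [e]
            refine pow_le_pow_left₀ ?_ this 2
            have : 0 ≤ u ^ 2 - v ^ 2 := by nlinarith
            positivity
        refine le_trans ?_ hsq
        calc _ = Real.exp (-1) * ((v ^ 2 - u ^ 2) * s ^ 2 / 4) ^ 2 := by ring
          _ ≤ Real.exp (-(γ / 2) * s) ^ 2 * ((v ^ 2 - u ^ 2) * s ^ 2 / 4) ^ 2 := by gcongr
          _ = _ := by ring
      rw [abs_of_nonneg n1, abs_of_nonneg n2]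
      have := mul_le_mul_of_nonneg_left key hγ.le
      linarith
    · rw [indicator_of_notMem (fun h => hs1 h.2)]
      have h1 := sq_nonneg (|mode γ u s| - |mode γ v s|)
      have h2 := sq_abs (mode γ u s)
      have h3 := sq_abs (mode γ v s)
      have := mul_nonneg hγ.le h1
      rw [sub_sq, h2, h3] at this
      linarith
  have Isum : IntegrableOn (fun s => 1 / 2 * (2 * γ * mode γ u s ^ 2)
      + 1 / 2 * (2 * γ * mode γ v s ^ 2)) (Ioi 0) := (Iu.const_mul _).add (Iv.const_mul _)
  have Iind : IntegrableOn ((Ioc 0 (1 / γ)).indicator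
      (fun s => γ * (Real.exp (-1) / 16 * (u ^ 2 - v ^ 2) ^ 2 * s ^ 4))) (Ioi 0) := by
    refine Integrable.integrableOn ((integrable_indicator_iff measurableSet_Ioc).mpr ?_)
    exact (Continuous.integrableOn_Icc (by fun_prop)).mono_set Ioc_subset_Icc_self
  have Iuv : IntegrableOn (fun s => 2 * γ * |mode γ u s * mode γ v s|) (Ioi 0) := by
    have c1 := mode_continuous γ u
    have c2 := mode_continuous γ v
    refine Integrable.mono' Isum (Continuous.aestronglyMeasurable (by fun_prop)) ?_
    filter_upwards with s
    rw [Real.norm_of_nonneg (by positivity), abs_mul]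
    have h1 := sq_nonneg (|mode γ u s| - |mode γ v s|)
    have h2 := sq_abs (mode γ u s)
    have h3 := sq_abs (mode γ v s)
    have := mul_nonneg hγ.le h1
    rw [sub_sq, h2, h3] at this
    linarith
  calc _ ≤ ∫ s in Ioi (0 : ℝ), ((1 / 2 * (2 * γ * mode γ u s ^ 2)
          + 1 / 2 * (2 * γ * mode γ v s ^ 2)) - (Ioc 0 (1 / γ)).indicator
          (fun s => γ * (Real.exp (-1) / 16 * (u ^ 2 - v ^ 2) ^ 2 * s ^ 4)) s) :=
        setIntegral_mono_on Iuv (Isum.sub Iind) measurableSet_Ioi hpt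
    _ = 1 - ∫ s in Ioi (0 : ℝ), (Ioc 0 (1 / γ)).indicator
          (fun s => γ * (Real.exp (-1) / 16 * (u ^ 2 - v ^ 2) ^ 2 * s ^ 4)) s := by
        rw [integral_sub Isum Iind, integral_add (Iu.const_mul _) (Iv.const_mul _)]
        congr 1
        rw [integral_const_mul (1 / 2 : ℝ) (fun s => 2 * γ * mode γ u s ^ 2),
          integral_const_mul (1 / 2 : ℝ) (fun s => 2 * γ * mode γ v s ^ 2),
          integral_mode_sq hu0 hu2, integral_mode_sq hv0 hv2, modeTail_zero hu0 hu2,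
          modeTail_zero hv0 hv2]
        norm_num
    _ = _ := by
        rw [setIntegral_indicator measurableSet_Ioc,
          inter_eq_right.mpr (show Ioc 0 (1 / γ) ⊆ Ioi 0 from fun x hx => hx.1),
          ← intervalIntegral.integral_of_le (by positivity), intervalIntegral.integral_const_mul,
          intervalIntegral.integral_const_mul, integral_pow]
        norm_num
        ring

/-! ### Fourier analysis on `ZMod L` -/

section Fourier

variable {L : ℕ} [NeZero L]

/-- The discrete Fourier transform. -/
def fhat (f : ZMod L → ℂ) (n : ZMod L) : ℂ := ∑ x, f x * ZMod.stdAddChar (-(n * x))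

/-- The inverse discrete Fourier transform. -/
def finv (c : ZMod L → ℂ) (x : ZMod L) : ℂ := 1 / (L : ℂ) * ∑ n, c n * ZMod.stdAddChar (n * x)

/-- The inverse discrete Fourier transform of a real even function. -/
def rinv (c : ZMod L → ℝ) (x : ZMod L) : ℝ :=
  1 / (L : ℝ) * ∑ n, c n * Real.cos (2 * Real.pi * ((n.valMinAbs : ℝ) / L) * (x.valMinAbs : ℝ))

theorem natCast_ne_zero' : (L : ℂ) ≠ 0 := Nat.cast_ne_zero.mpr (NeZero.ne L)

theorem natCast_pos' : (0 : ℝ) < L := Nat.cast_pos.mpr (NeZero.pos L)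

theorem sum_stdAddChar (b : ZMod L) :
    ∑ x : ZMod L, ZMod.stdAddChar (x * b) = if b = 0 then (L : ℂ) else 0 := by
  rw [AddChar.sum_mulShift b (ZMod.isPrimitive_stdAddChar L), ZMod.card]
  push_cast
  rfl

theorem norm_stdAddChar (a : ZMod L) : ‖(ZMod.stdAddChar a : ℂ)‖ = 1 := by
  exact AddChar.norm_apply _ _

theorem fhat_finv (c : ZMod L → ℂ) (n : ZMod L) : fhat (finv c) n = c n := by
  unfold fhat finv
  calc _ = 1 / (L : ℂ) * ∑ x, ∑ k, c k * ZMod.stdAddChar (x * (k - n)) := by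
        rw [Finset.mul_sum]
        refine Finset.sum_congr rfl fun x _ => ?_
        rw [mul_assoc, Finset.sum_mul]
        congr 1
        refine Finset.sum_congr rfl fun k _ => ?_
        rw [mul_assoc, ← AddChar.map_add_eq_mul]
        congr 2
        ring
    _ = 1 / (L : ℂ) * ∑ k, c k * (if k - n = 0 then (L : ℂ) else 0) := by
        rw [Finset.sum_comm]
        simp_rw [← Finset.mul_sum, sum_stdAddChar]
    _ = c n := by
        simp only [sub_eq_zero, mul_ite, mul_zero, Finset.sum_ite_eq', Finset.mem_univ, if_true]
        field_simp [natCast_ne_zero' (L := L)]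

theorem finv_fhat (f : ZMod L → ℂ) (x : ZMod L) : finv (fhat f) x = f x := by
  unfold fhat finv
  calc _ = 1 / (L : ℂ) * ∑ n, ∑ y, f y * ZMod.stdAddChar (n * (x - y)) := by
        congr 1
        refine Finset.sum_congr rfl fun n _ => ?_
        rw [Finset.sum_mul]
        refine Finset.sum_congr rfl fun y _ => ?_
        rw [mul_assoc, ← AddChar.map_add_eq_mul]
        congr 2
        ring
    _ = 1 / (L : ℂ) * ∑ y, f y * (if x - y = 0 then (L : ℂ) else 0) := by
        rw [Finset.sum_comm]
        simp_rw [← Finset.mul_sum, sum_stdAddChar]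
    _ = f x := by
        simp only [sub_eq_zero, mul_ite, mul_zero, Finset.sum_ite_eq, Finset.mem_univ, if_true]
        field_simp [natCast_ne_zero' (L := L)]

/-- The transform of a product. -/
theorem fhat_mul (c d : ZMod L → ℂ) (k : ZMod L) :
    fhat (fun x => finv c x * finv d x) k = 1 / (L : ℂ) * ∑ n, c n * d (k - n) := by
  unfold fhat
  calc _ = ∑ x, 1 / (L : ℂ) * ∑ n, c n * (ZMod.stdAddChar (n * x) * finv d x
          * ZMod.stdAddChar (-(k * x))) := by
        refine Finset.sum_congr rfl fun x _ => ?_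
        change (1 / (L : ℂ) * ∑ n, c n * ZMod.stdAddChar (n * x)) * finv d x * _ = _
        rw [mul_assoc, mul_assoc, Finset.sum_mul]
        congr 1
        refine Finset.sum_congr rfl fun n _ => ?_
        ring
    _ = 1 / (L : ℂ) * ∑ n, c n * fhat (finv d) (k - n) := by
        rw [← Finset.mul_sum, Finset.sum_comm]
        congr 1
        refine Finset.sum_congr rfl fun n _ => ?_
        rw [← Finset.mul_sum, fhat]
        congr 1
        refine Finset.sum_congr rfl fun x _ => ?_
        rw [mul_right_comm, ← AddChar.map_add_eq_mul, mul_comm]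
        congr 2
        ring
    _ = _ := by simp_rw [fhat_finv]

theorem finv_conj (c : ZMod L → ℂ) (x : ZMod L) :
    finv (fun n => starRingEnd ℂ (c (-n))) x = starRingEnd ℂ (finv c x) := by
  unfold finv
  rw [map_mul, map_sum]
  congr 1
  · simp
  · rw [← Equiv.sum_comp (Equiv.neg (ZMod L))]
    refine Finset.sum_congr rfl fun n _ => ?_
    rw [map_mul (starRingEnd ℂ), ← AddChar.map_neg_eq_conj]
    simp

/-- Parseval's identity. -/
theorem sum_norm_sq_finv (c : ZMod L → ℂ) :
    ∑ x, ‖finv c x‖ ^ 2 = 1 / (L : ℝ) * ∑ n, ‖c n‖ ^ 2 := by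
  have h := fhat_mul c (fun n => starRingEnd ℂ (c (-n))) 0
  unfold fhat at h
  simp only [finv_conj, Complex.mul_conj, zero_mul, neg_zero, AddChar.map_zero_eq_one, mul_one,
    zero_sub, neg_neg, Complex.normSq_eq_norm_sq] at h
  refine Complex.ofReal_injective ?_
  push_cast at h ⊢
  exact h

theorem sum_norm_sq_fhat (f : ZMod L → ℂ) :
    ∑ x, ‖f x‖ ^ 2 = 1 / (L : ℝ) * ∑ n, ‖fhat f n‖ ^ 2 := by
  rw [← sum_norm_sq_finv]
  simp_rw [finv_fhat]

/-- The transform of a convolution. -/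
theorem fhat_convolution (f g : ZMod L → ℂ) (n : ZMod L) :
    fhat (fun x => ∑ y, f y * g (x - y)) n = fhat f n * fhat g n := by
  unfold fhat
  rw [Finset.sum_mul]
  calc _ = ∑ y, ∑ x, f y * g (x - y) * ZMod.stdAddChar (-(n * x)) := by
        rw [Finset.sum_comm]
        exact Finset.sum_congr rfl fun x _ => Finset.sum_mul _ _ _
    _ = _ := by
        refine Finset.sum_congr rfl fun y _ => ?_
        rw [Finset.mul_sum, ← Equiv.sum_comp (Equiv.addRight y)]
        refine Finset.sum_congr rfl fun x _ => ?_
        simp only [Equiv.coe_addRight, add_sub_cancel_right]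
        rw [show -(n * (x + y)) = -(n * y) + -(n * x) by ring, AddChar.map_add_eq_mul]
        ring

theorem convolution_finv (c d : ZMod L → ℂ) (x : ZMod L) :
    ∑ y, finv c (x - y) * finv d y = finv (fun n => c n * d n) x := by
  have h : (fun x => ∑ y, finv c (x - y) * finv d y) = fun x => ∑ y, finv d y * finv c (x - y) := by
    funext x
    exact Finset.sum_congr rfl fun y _ => mul_comm _ _
  have h2 := finv_fhat (fun x => ∑ y, finv c (x - y) * finv d y) x
  rw [← h2]
  congr 1
  funext n
  rw [h, fhat_convolution, fhat_finv, fhat_finv, mul_comm]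

theorem correlation_finv (c : ZMod L → ℂ) (f : ZMod L → ℂ) (x : ZMod L) :
    ∑ y, finv c y * f (x + y) = finv (fun n => c (-n) * fhat f n) x := by
  have h : ∀ y, finv (fun n => c (-n)) y = finv c (-y) := by
    intro y
    unfold finv
    rw [← Equiv.sum_comp (Equiv.neg (ZMod L))]
    simp
  rw [← convolution_finv]
  simp_rw [finv_fhat, h]
  rw [← Equiv.sum_comp (Equiv.addLeft x) (fun y => finv c (-(x - y)) * f y)]
  refine Finset.sum_congr rfl fun y _ => ?_
  simp

theorem stdAddChar_mul_eq (n x : ZMod L) : (ZMod.stdAddChar (n * x) : ℂ)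
    = Complex.exp (((2 * Real.pi * ((n.valMinAbs : ℝ) / L) * (x.valMinAbs : ℝ) : ℝ) : ℂ)
      * Complex.I) := by
  have h : n * x = ((n.valMinAbs * x.valMinAbs : ℤ) : ZMod L) := by
    rw [Int.cast_mul, ZMod.coe_valMinAbs, ZMod.coe_valMinAbs]
  rw [h, ZMod.stdAddChar_coe]
  congr 1
  push_cast
  ring

theorem stdAddChar_mul_re (n x : ZMod L) : (ZMod.stdAddChar (n * x) : ℂ).re
    = Real.cos (2 * Real.pi * ((n.valMinAbs : ℝ) / L) * (x.valMinAbs : ℝ)) := by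
  rw [stdAddChar_mul_eq, Complex.exp_ofReal_mul_I_re]

/-- For real even c the inverse transform equals its own conjugate, hence its real part, which is
the cosine sum. -/
theorem rinv_eq_finv {c : ZMod L → ℝ} (hc : ∀ n, c (-n) = c n) (x : ZMod L) :
    (rinv c x : ℂ) = finv (fun n => (c n : ℂ)) x := by
  have h1 : starRingEnd ℂ (finv (fun n => (c n : ℂ)) x) = finv (fun n => (c n : ℂ)) x := by
    rw [← finv_conj]
    simp [hc]
  rw [Complex.conj_eq_iff_re] at h1
  rw [← h1]
  congr 1
  unfold rinv finv
  rw [show (1 / (L : ℂ)) = ((1 / (L : ℝ) : ℝ) : ℂ) by push_cast; rfl, Complex.re_ofReal_mul,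
    Complex.re_sum]
  congr 1
  refine Finset.sum_congr rfl fun n _ => ?_
  rw [Complex.re_ofReal_mul, stdAddChar_mul_re]

theorem rinv_neg {c : ZMod L → ℝ} (hc : ∀ n, c (-n) = c n) (x : ZMod L) :
    rinv c (-x) = rinv c x := by
  have : (rinv c (-x) : ℂ) = rinv c x := by
    rw [rinv_eq_finv hc, rinv_eq_finv hc]
    unfold finv
    rw [← Equiv.sum_comp (Equiv.neg (ZMod L))]
    simp [hc]
  exact_mod_cast this

theorem rinv_convolution {c d : ZMod L → ℝ} (hc : ∀ n, c (-n) = c n) (hd : ∀ n, d (-n) = d n)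
    (x : ZMod L) : ∑ y, rinv c (x - y) * rinv d y = rinv (fun n => c n * d n) x := by
  have : ((∑ y, rinv c (x - y) * rinv d y : ℝ) : ℂ) = rinv (fun n => c n * d n) x := by
    rw [rinv_eq_finv (fun n => by rw [hc, hd])]
    push_cast
    simp_rw [rinv_eq_finv hc, rinv_eq_finv hd]
    rw [convolution_finv]
  exact_mod_cast this

theorem rinv_one (x : ZMod L) : rinv (fun _ => 1) x = if x = 0 then 1 else 0 := by
  have : (rinv (fun _ : ZMod L => 1) x : ℂ) = if x = 0 then 1 else 0 := by
    rw [rinv_eq_finv (fun _ => rfl)]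
    unfold finv
    simp only [Complex.ofReal_one, one_mul, sum_stdAddChar, mul_ite, mul_zero]
    simp [natCast_ne_zero' (L := L)]
  split_ifs at this ⊢ <;> exact_mod_cast this

/-- Correlating with a function whose transform is bounded is bounded on `ℓ²`. -/
theorem sum_correlation_sq_le {c : ZMod L → ℝ} (hc : ∀ n, c (-n) = c n) {B : ℝ}
    (hB : ∀ n, |c n| ≤ B) (f : ZMod L → ℝ) :
    ∑ x, (∑ y, rinv c y * f (x + y)) ^ 2 ≤ B ^ 2 * ∑ x, f x ^ 2 := by
  have h1 : ∀ x, ((∑ y, rinv c y * f (x + y) : ℝ) : ℂ)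
      = finv (fun n => (c n : ℂ) * fhat (fun x => (f x : ℂ)) n) x := by
    intro x
    have := correlation_finv (fun n => (c n : ℂ)) (fun x => (f x : ℂ)) x
    simp only [hc] at this
    rw [← this]
    push_cast
    simp_rw [rinv_eq_finv hc]
  have h2 : ∀ x, (∑ y, rinv c y * f (x + y)) ^ 2
      = ‖finv (fun n => (c n : ℂ) * fhat (fun x => (f x : ℂ)) n) x‖ ^ 2 := by
    intro x
    rw [← h1, Complex.norm_real, Real.norm_eq_abs, sq_abs]
  have h3 : ∀ x, f x ^ 2 = ‖(f x : ℂ)‖ ^ 2 := by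
    intro x; rw [Complex.norm_real, Real.norm_eq_abs, sq_abs]
  simp_rw [h2, h3]
  have hL := natCast_pos' (L := L)
  rw [sum_norm_sq_finv, sum_norm_sq_fhat (fun x => (f x : ℂ)), mul_left_comm (B ^ 2)]
  refine mul_le_mul_of_nonneg_left ?_ (by positivity : 0 ≤ 1 / (L : ℝ))
  rw [Finset.mul_sum]
  refine Finset.sum_le_sum fun n _ => ?_
  rw [norm_mul, mul_pow, Complex.norm_real, Real.norm_eq_abs]
  exact mul_le_mul_of_nonneg_right (pow_le_pow_left₀ (abs_nonneg _) (hB n) 2) (by positivity)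

/-- A quadratic form with transform bounded below. -/
theorem le_sum_sum_rinv {c : ZMod L → ℝ} (hc : ∀ n, c (-n) = c n) {b : ℝ}
    (hb : ∀ n, b ≤ c n) (f : ZMod L → ℝ) :
    b * ∑ x, f x ^ 2 ≤ ∑ x, ∑ y, f x * f y * rinv c (x - y) := by
  set F := fhat (fun x => (f x : ℂ)) with hF
  have h1 : ∀ x, ∑ y, (rinv c (x - y) : ℂ) * (f y : ℂ) = finv (fun n => (c n : ℂ) * F n) x := by
    intro x
    rw [← convolution_finv]
    simp_rw [hF, finv_fhat, rinv_eq_finv hc]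
  have hFc : ∀ n, starRingEnd ℂ (F n) = F (-n) := by
    intro n
    simp only [hF, fhat, map_sum, map_mul, Complex.conj_ofReal]
    refine Finset.sum_congr rfl fun x _ => ?_
    rw [← AddChar.map_neg_eq_conj]
    congr 2
    ring
  have h2 : ((∑ x, ∑ y, f x * f y * rinv c (x - y) : ℝ) : ℂ)
      = ((1 / (L : ℝ) * ∑ n, c n * ‖F n‖ ^ 2 : ℝ) : ℂ) := by
    calc _ = ∑ x, finv (fun n => (c n : ℂ) * F n) x * finv F x := by
          push_cast
          refine Finset.sum_congr rfl fun x _ => ?_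
          rw [← h1, hF, finv_fhat, Finset.sum_mul]
          refine Finset.sum_congr rfl fun y _ => ?_
          ring
      _ = fhat (fun x => finv (fun n => (c n : ℂ) * F n) x * finv F x) 0 := by
          simp [fhat]
      _ = _ := by
          rw [fhat_mul]
          push_cast
          congr 1
          refine Finset.sum_congr rfl fun n _ => ?_
          rw [zero_sub, ← hFc, mul_assoc, Complex.mul_conj, Complex.normSq_eq_norm_sq]
          push_cast
          ring
  have h3 : ∑ x, f x ^ 2 = 1 / (L : ℝ) * ∑ n, ‖F n‖ ^ 2 := by
    rw [hF, ← sum_norm_sq_fhat]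
    refine Finset.sum_congr rfl fun x _ => ?_
    rw [Complex.norm_real, Real.norm_eq_abs, sq_abs]
  rw [Complex.ofReal_inj.mp h2, h3, mul_left_comm]
  have hL := natCast_pos' (L := L)
  refine mul_le_mul_of_nonneg_left ?_ (by positivity)
  rw [Finset.mul_sum]
  exact Finset.sum_le_sum fun n _ => mul_le_mul_of_nonneg_right (hb n) (by positivity)

/-- Fourth moments are controlled by second differences of the transform. -/
theorem sum_pow_four_le {c : ZMod L → ℝ} (hc : ∀ n, c (-n) = c n) {B : ℝ}
    (hB : ∀ n, |c (n + 1) - 2 * c n + c (n - 1)| ≤ B / (L : ℝ) ^ 2) :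
    ∑ x : ZMod L, (x.valMinAbs : ℝ) ^ 4 * rinv c x ^ 2 ≤ B ^ 2 := by
  have hL := natCast_pos' (L := L)
  have hB0 : 0 ≤ B := by
    have := (abs_nonneg _).trans (hB 0)
    rw [le_div_iff₀ (by positivity)] at this
    linarith
  -- S is the multiplier in position space of the second difference in frequency. Since |S| ≥
  -- 16(x/L)² for the representative in (-L/2, L/2], Parseval's identity for the differences
  -- controls the fourth moment.
  set S : ZMod L → ℝ := fun x => 2 * Real.cos (2 * Real.pi * ((x.valMinAbs : ℝ) / L)) - 2 with hS
  have hcos : ∀ x : ZMod L, (ZMod.stdAddChar x : ℂ) + ZMod.stdAddChar (-x)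
      = ((2 * Real.cos (2 * Real.pi * ((x.valMinAbs : ℝ) / L)) : ℝ) : ℂ) := by
    intro x
    rw [AddChar.map_neg_eq_conj, Complex.add_conj]
    congr 2
    have := ZMod.stdAddChar_coe (N := L) x.valMinAbs
    rw [ZMod.coe_valMinAbs] at this
    rw [this, ← Complex.exp_ofReal_mul_I_re]
    congr 2
    push_cast
    ring
  have h1 : ∀ x, ((rinv c x * S x : ℝ) : ℂ)
      = finv (fun n => ((c (n + 1) - 2 * c n + c (n - 1) : ℝ) : ℂ)) x := by
    intro x
    have e1 : finv (fun n => (c (n + 1) : ℂ)) x = finv (fun n => (c n : ℂ)) x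
        * ZMod.stdAddChar (-x) := by
      unfold finv
      rw [mul_assoc, Finset.sum_mul, ← Equiv.sum_comp (Equiv.addRight (1 : ZMod L))
        (fun n => (c n : ℂ) * ZMod.stdAddChar (n * x) * ZMod.stdAddChar (-x))]
      congr 1
      refine Finset.sum_congr rfl fun n _ => ?_
      rw [mul_assoc, ← AddChar.map_add_eq_mul]
      simp only [Equiv.coe_addRight]
      congr 2
      ring
    have e2 : finv (fun n => (c (n - 1) : ℂ)) x = finv (fun n => (c n : ℂ)) x
        * ZMod.stdAddChar x := by
      unfold finv
      rw [mul_assoc, Finset.sum_mul, ← Equiv.sum_comp (Equiv.subRight (1 : ZMod L))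
        (fun n => (c n : ℂ) * ZMod.stdAddChar (n * x) * ZMod.stdAddChar x)]
      congr 1
      refine Finset.sum_congr rfl fun n _ => ?_
      rw [mul_assoc, ← AddChar.map_add_eq_mul]
      simp only [Equiv.subRight_apply]
      congr 2
      ring
    have e3 : finv (fun n => ((c (n + 1) - 2 * c n + c (n - 1) : ℝ) : ℂ)) x
        = finv (fun n => (c (n + 1) : ℂ)) x - 2 * finv (fun n => (c n : ℂ)) x
          + finv (fun n => (c (n - 1) : ℂ)) x := by
      unfold finv
      rw [mul_left_comm, ← mul_sub, ← mul_add]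
      congr 1
      rw [Finset.mul_sum, ← Finset.sum_sub_distrib, ← Finset.sum_add_distrib]
      refine Finset.sum_congr rfl fun n _ => ?_
      push_cast
      ring
    rw [e3, e1, e2, ← rinv_eq_finv hc]
    have := hcos x
    simp only [hS]
    push_cast at this ⊢
    linear_combination -(rinv c x : ℂ) * this
  have h2 : ∑ x, (rinv c x * S x) ^ 2 ≤ (B / (L : ℝ) ^ 2) ^ 2 := by
    have e : ∀ x, (rinv c x * S x) ^ 2
        = ‖finv (fun n => ((c (n + 1) - 2 * c n + c (n - 1) : ℝ) : ℂ)) x‖ ^ 2 := by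
      intro x; rw [← h1, Complex.norm_real, Real.norm_eq_abs, sq_abs]
    simp_rw [e]
    rw [sum_norm_sq_finv]
    calc _ ≤ 1 / (L : ℝ) * ∑ _n : ZMod L, (B / (L : ℝ) ^ 2) ^ 2 := by
          refine mul_le_mul_of_nonneg_left (Finset.sum_le_sum fun n _ => ?_) (by positivity)
          rw [Complex.norm_real, Real.norm_eq_abs]
          exact pow_le_pow_left₀ (abs_nonneg _) (hB n) 2
      _ = _ := by
          rw [Finset.sum_const, Finset.card_univ, ZMod.card, nsmul_eq_mul]
          field_simp
  have h3 : ∀ x : ZMod L, (x.valMinAbs : ℝ) ^ 4 ≤ (L : ℝ) ^ 4 * S x ^ 2 := by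
    intro x
    have hx := ZMod.valMinAbs_mem_Ioc x
    have hx1 : |(x.valMinAbs : ℝ)| ≤ L / 2 := by
      rw [abs_le]
      have a1 : -(L : ℝ) < x.valMinAbs * 2 := by exact_mod_cast hx.1
      have a2 : (x.valMinAbs : ℝ) * 2 ≤ L := by exact_mod_cast hx.2
      constructor <;> linarith
    set θ := 2 * Real.pi * ((x.valMinAbs : ℝ) / L) with hθ
    have hπ := Real.pi_pos
    have hθ1 : |θ| ≤ Real.pi := by
      rw [hθ, abs_mul, abs_div, abs_of_pos (by positivity : 0 < 2 * Real.pi), abs_of_pos hL]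
      calc _ ≤ 2 * Real.pi * (((L : ℝ) / 2) / L) := by gcongr
        _ = Real.pi := by field_simp
    have hc1 := Real.cos_le_one_sub_mul_cos_sq hθ1
    have hS1 : 16 * ((x.valMinAbs : ℝ) / L) ^ 2 ≤ -S x := by
      have : 2 / Real.pi ^ 2 * θ ^ 2 = 8 * ((x.valMinAbs : ℝ) / L) ^ 2 := by
        rw [hθ]; field_simp; ring
      simp only [hS]
      linarith
    have hS2 : (((x.valMinAbs : ℝ) / L) ^ 2) ^ 2 ≤ (-S x) ^ 2 := by
      refine pow_le_pow_left₀ (by positivity) ?_ 2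
      have : 0 ≤ ((x.valMinAbs : ℝ) / L) ^ 2 := by positivity
      linarith
    calc (x.valMinAbs : ℝ) ^ 4 = (L : ℝ) ^ 4 * (((x.valMinAbs : ℝ) / L) ^ 2) ^ 2 := by
          field_simp
      _ ≤ (L : ℝ) ^ 4 * (-S x) ^ 2 := by gcongr
      _ = _ := by ring
  calc _ ≤ ∑ x, (L : ℝ) ^ 4 * (rinv c x * S x) ^ 2 := by
        refine Finset.sum_le_sum fun x _ => ?_
        calc _ ≤ ((L : ℝ) ^ 4 * S x ^ 2) * rinv c x ^ 2 :=
              mul_le_mul_of_nonneg_right (h3 x) (by positivity)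
          _ = _ := by ring
    _ ≤ (L : ℝ) ^ 4 * (B / (L : ℝ) ^ 2) ^ 2 := by
        rw [← Finset.mul_sum]
        exact mul_le_mul_of_nonneg_left h2 (by positivity)
    _ = B ^ 2 := by field_simp

end Fourier

/-! ### The dispersion relation -/

section Dispersion

variable {Φ : ℤ → ℝ} {γ : ℝ}

theorem IsInteraction.summable_sq (h : IsInteraction Φ) :
    Summable fun x : ℤ => |Φ x| * (x : ℝ) ^ 2 := by
  obtain ⟨C, hC, δ, hδ, hd⟩ := h.decay
  have key : Summable fun n : ℕ => C * ((n : ℝ) ^ 2 * Real.exp (-δ * n)) :=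
    (Real.summable_pow_mul_exp_neg_nat_mul 2 hδ).mul_left C
  refine Summable.of_nat_of_neg ?_ ?_
  · refine Summable.of_nonneg_of_le (fun n => by positivity) (fun n => ?_) key
    have := hd n
    rw [Int.cast_natCast, abs_of_nonneg (Nat.cast_nonneg n : (0 : ℝ) ≤ n)] at this
    push_cast
    nlinarith [mul_le_mul_of_nonneg_right this (by positivity : (0 : ℝ) ≤ (n : ℝ) ^ 2)]
  · refine Summable.of_nonneg_of_le (fun n => by positivity) (fun n => ?_) key
    have := hd (-n)
    rw [Int.cast_neg, Int.cast_natCast, abs_neg,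
      abs_of_nonneg (Nat.cast_nonneg n : (0 : ℝ) ≤ n)] at this
    push_cast
    nlinarith [mul_le_mul_of_nonneg_right this (by positivity : (0 : ℝ) ≤ (n : ℝ) ^ 2)]

theorem IsInteraction.summable_abs (h : IsInteraction Φ) : Summable fun x : ℤ => |Φ x| := by
  have h1 : Summable fun x : ℤ => |Φ x| * (x : ℝ) ^ 2 + if x = 0 then |Φ 0| else 0 :=
    h.summable_sq.add (summable_of_hasFiniteSupport
      ((Set.finite_singleton (0 : ℤ)).subset fun x hx => by
        by_contra h0; simp_all))
  refine Summable.of_nonneg_of_le (fun x => abs_nonneg _) (fun x => ?_) h1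
  by_cases hx : x = 0
  · simp [hx]
  · have h1 : (1 : ℝ) ≤ (x : ℝ) ^ 2 := by
      have : (1 : ℤ) ≤ x ^ 2 := by have := sq_pos_of_ne_zero hx; omega
      exact_mod_cast this
    simp only [hx, if_false, add_zero]
    nlinarith [abs_nonneg (Φ x)]

theorem IsInteraction.summable_cos (h : IsInteraction Φ) (k : ℝ) :
    Summable fun x : ℤ => Φ x * Real.cos (2 * Real.pi * k * x) := by
  refine Summable.of_norm_bounded h.summable_abs fun x => ?_
  rw [norm_mul, Real.norm_eq_abs, Real.norm_eq_abs]
  exact mul_le_of_le_one_right (abs_nonneg _) (Real.abs_cos_le_one _)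

theorem PhiHat_neg (Φ : ℤ → ℝ) (k : ℝ) : PhiHat Φ (-k) = PhiHat Φ k := by
  unfold PhiHat
  refine tsum_congr fun x => ?_
  rw [show 2 * Real.pi * -k * x = -(2 * Real.pi * k * x) by ring, Real.cos_neg]

theorem PhiHat_add_int (Φ : ℤ → ℝ) (k : ℝ) (n : ℤ) : PhiHat Φ (k + n) = PhiHat Φ k := by
  unfold PhiHat
  refine tsum_congr fun x => ?_
  rw [show 2 * Real.pi * (k + n) * x = 2 * Real.pi * k * x + ((n * x : ℤ) : ℝ) * (2 * Real.pi) by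
    push_cast; ring, Real.cos_add_int_mul_two_pi]

/-- The constant which controls the first two differences of the dispersion relation. -/
def PhiBound (Φ : ℤ → ℝ) : ℝ := ∑' x : ℤ, |Φ x| * (x : ℝ) ^ 2

theorem PhiBound_nonneg (Φ : ℤ → ℝ) : 0 ≤ PhiBound Φ := tsum_nonneg fun x => by positivity

theorem IsInteraction.abs_sub_le (h : IsInteraction Φ) (k l : ℝ) :
    |PhiHat Φ k - PhiHat Φ l| ≤ 2 * Real.pi * PhiBound Φ * |k - l| := by
  unfold PhiHat PhiBound
  rw [← (h.summable_cos k).tsum_sub (h.summable_cos l), ← Real.norm_eq_abs]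
  rw [mul_right_comm (2 * Real.pi) _ |k - l|, ← tsum_mul_left]
  refine tsum_of_norm_bounded (h.summable_sq.mul_left _).hasSum fun x => ?_
  rw [← mul_sub, norm_mul, Real.norm_eq_abs, Real.norm_eq_abs]
  have h1 : |Real.cos (2 * Real.pi * k * x) - Real.cos (2 * Real.pi * l * x)|
      ≤ |2 * Real.pi * k * x - 2 * Real.pi * l * x| := by
    have := Real.lipschitzWith_cos.dist_le_mul (2 * Real.pi * k * x) (2 * Real.pi * l * x)
    simpa [Real.dist_eq] using this
  have h2 : |2 * Real.pi * k * x - 2 * Real.pi * l * x| = 2 * Real.pi * |k - l| * |(x : ℝ)| := by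
    rw [show 2 * Real.pi * k * x - 2 * Real.pi * l * x = 2 * Real.pi * (k - l) * x by ring,
      abs_mul, abs_mul, abs_of_pos Real.two_pi_pos]
  -- On the integers |x| ≤ x², so the second moment also serves as a Lipschitz constant.
  have h3 : |(x : ℝ)| ≤ (x : ℝ) ^ 2 := by
    have : |x| ≤ x ^ 2 := by
      rw [← sq_abs]
      rcases eq_or_ne x 0 with h0 | h0
      · simp [h0]
      · have : 1 ≤ |x| := Int.one_le_abs h0
        nlinarith
    exact_mod_cast this
  calc _ ≤ |Φ x| * (2 * Real.pi * |k - l| * (x : ℝ) ^ 2) := by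
        refine mul_le_mul_of_nonneg_left (h1.trans (h2.trans_le ?_)) (abs_nonneg _)
        exact mul_le_mul_of_nonneg_left h3 (by positivity)
    _ = _ := by ring

theorem IsInteraction.second_difference_le (h : IsInteraction Φ) (k r : ℝ) :
    |PhiHat Φ (k + r) - 2 * PhiHat Φ k + PhiHat Φ (k - r)|
      ≤ 4 * Real.pi ^ 2 * PhiBound Φ * r ^ 2 := by
  unfold PhiHat PhiBound
  rw [← tsum_mul_left (a := (2 : ℝ)), ← (h.summable_cos (k + r)).tsum_sub
    ((h.summable_cos k).mul_left 2), ← ((h.summable_cos (k + r)).sub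
    ((h.summable_cos k).mul_left 2)).tsum_add (h.summable_cos (k - r)), ← Real.norm_eq_abs,
    mul_right_comm (4 * Real.pi ^ 2) _ (r ^ 2), ← tsum_mul_left]
  refine tsum_of_norm_bounded (h.summable_sq.mul_left _).hasSum fun x => ?_
  have e : Φ x * Real.cos (2 * Real.pi * (k + r) * x) - 2 * (Φ x * Real.cos (2 * Real.pi * k * x))
      + Φ x * Real.cos (2 * Real.pi * (k - r) * x)
      = Φ x * (Real.cos (2 * Real.pi * k * x) * (2 * Real.cos (2 * Real.pi * r * x) - 2)) := by
    rw [show 2 * Real.pi * (k + r) * x = 2 * Real.pi * k * x + 2 * Real.pi * r * x by ring,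
      show 2 * Real.pi * (k - r) * x = 2 * Real.pi * k * x - 2 * Real.pi * r * x by ring,
      Real.cos_add, Real.cos_sub]
    ring
  rw [e, norm_mul, norm_mul, Real.norm_eq_abs, Real.norm_eq_abs, Real.norm_eq_abs]
  have h1 := Real.one_sub_sq_div_two_le_cos (x := 2 * Real.pi * r * x)
  have h2 := Real.cos_le_one (2 * Real.pi * r * x)
  have h3 : |2 * Real.cos (2 * Real.pi * r * x) - 2| ≤ (2 * Real.pi * r * x) ^ 2 := by
    rw [abs_le]; constructor <;> nlinarith
  have h4 := Real.abs_cos_le_one (2 * Real.pi * k * x)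
  calc _ ≤ |Φ x| * (1 * (2 * Real.pi * r * x) ^ 2) := by gcongr
    _ = _ := by ring

theorem IsInteraction.continuous (h : IsInteraction Φ) : Continuous (PhiHat Φ) := by
  have : LipschitzWith (Real.toNNReal (2 * Real.pi * PhiBound Φ)) (PhiHat Φ) := by
    refine LipschitzWith.of_dist_le_mul fun k l => ?_
    rw [Real.dist_eq, Real.dist_eq, Real.coe_toNNReal _ (by
      have := PhiBound_nonneg Φ; positivity)]
    exact h.abs_sub_le k l
  exact this.continuous

theorem IsInteraction.omega_sq (h : IsInteraction Φ) (k : ℝ) : omega Φ k ^ 2 = PhiHat Φ k := by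
  obtain ⟨w, hw, hp⟩ := h.pinning
  exact Real.sq_sqrt (le_trans (by positivity) (hp k))

theorem IsAdmissible.uu_sq (h : IsAdmissible Φ γ) (k : ℝ) :
    uu Φ γ k ^ 2 = (γ / 2) ^ 2 - PhiHat Φ k := by
  unfold uu
  rw [h.interaction.omega_sq]
  exact Real.sq_sqrt (by nlinarith [h.noise_dominates k])

/-- By periodicity Φ̂ attains its maximum, and strict domination by γ²/4 there keeps u away from 0;
pinning keeps u away from γ/2. All constants uniform in the volume are built from these two bounds.
-/
theorem IsAdmissible.uu_bounds (h : IsAdmissible Φ γ) :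
    ∃ u₀ u₁ : ℝ, 0 < u₀ ∧ u₀ ≤ u₁ ∧ u₁ < γ / 2 ∧ ∀ k, uu Φ γ k ∈ Icc u₀ u₁ := by
  obtain ⟨w, hw, hp⟩ := h.interaction.pinning
  obtain ⟨k₀, -, hk₀⟩ := isCompact_Icc.exists_isMaxOn (s := Icc (0 : ℝ) 1) ⟨0, by simp⟩
    h.interaction.continuous.continuousOn
  have hmax : ∀ k, PhiHat Φ k ≤ PhiHat Φ k₀ := by
    intro k
    have e : PhiHat Φ k = PhiHat Φ (Int.fract k) := by
      conv_lhs => rw [← Int.fract_add_floor k]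
      rw [PhiHat_add_int]
    rw [e]
    exact hk₀ ⟨Int.fract_nonneg k, (Int.fract_lt_one k).le⟩
  have hγ := h.flip_pos
  have hsub : ∀ k, uu Φ γ k = √((γ / 2) ^ 2 - PhiHat Φ k) := fun k => by
    rw [uu, h.interaction.omega_sq]
  refine ⟨uu Φ γ k₀, √((γ / 2) ^ 2 - w ^ 2), ?_, ?_, ?_, fun k => ⟨?_, ?_⟩⟩
  · rw [hsub, Real.sqrt_pos]; nlinarith [h.noise_dominates k₀]
  · rw [hsub]; exact Real.sqrt_le_sqrt (by linarith [hp k₀])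
  · rw [Real.sqrt_lt' (by positivity)]; nlinarith
  · rw [hsub, hsub]; exact Real.sqrt_le_sqrt (by linarith [hmax k])
  · rw [hsub]; exact Real.sqrt_le_sqrt (by linarith [hp k])

theorem A2Hat_eq_mode (Φ : ℤ → ℝ) (γ t k : ℝ) : A2Hat Φ γ t k = mode γ (uu Φ γ k) t := by
  unfold A2Hat mode rate
  simp only [one_mul, neg_one_mul, sub_eq_add_neg]

/-- The nondegeneracy condition bounds the variation of the dispersion relation from below. -/
theorem IsAdmissible.variation_ge (h : IsAdmissible Φ γ) {ε : ℝ} (hε : 0 < ε) :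
    ∃ c > 0, ∀ k₀ : ℝ, ε ≤ |k₀| → |k₀| ≤ 1 / 2 →
      c ≤ ∫ k in (-(1 / 2) : ℝ)..(1 / 2), (PhiHat Φ (k + k₀ / 2) - PhiHat Φ (k - k₀ / 2)) ^ 2 := by
  obtain ⟨u₀, u₁, hu₀, h01, hu₁, hu⟩ := h.uu_bounds
  obtain ⟨B, hB, hdiff⟩ := mode_second_difference hu₀ hu₁ h01
  obtain ⟨c, hc, hnd⟩ := h.nondegenerate ε hε
  set m : ℝ := (γ / 2 - u₁) / 2 with hm
  have hm0 : 0 < m := by rw [hm]; linarith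
  have hm2 : 0 < 2 * m := by positivity
  -- K is the time integral of the squared Lipschitz constant of the response as a function of Φ̂: a
  -- factor B exp(-mt) in u, and a factor 1/(2u₀) because u² = (γ/2)² - Φ̂.
  set K : ℝ := (B / (2 * u₀)) ^ 2 / (2 * m) with hK
  have hK0 : 0 < K := by positivity
  refine ⟨c / K, by positivity, fun k₀ h1 h2 => ?_⟩
  set I : ℝ := ∫ k in (-(1 / 2) : ℝ)..(1 / 2), (PhiHat Φ (k + k₀ / 2) - PhiHat Φ (k - k₀ / 2)) ^ 2
    with hI
  have cP := h.interaction.continuous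
  have cu : Continuous (uu Φ γ) := by
    have : uu Φ γ = fun k => √((γ / 2) ^ 2 - PhiHat Φ k) := by
      funext k; rw [uu, h.interaction.omega_sq]
    rw [this]; fun_prop
  have hpt : ∀ t ≥ 0, ∀ k l, (A2Hat Φ γ t k - A2Hat Φ γ t l) ^ 2
      ≤ (B / (2 * u₀)) ^ 2 * Real.exp (-(2 * m) * t) * (PhiHat Φ k - PhiHat Φ l) ^ 2 := by
    intro t ht k l
    rw [A2Hat_eq_mode, A2Hat_eq_mode]
    have d1 := (hdiff t ht).1 _ (hu k) _ (hu l)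
    have d2 : 2 * u₀ * |uu Φ γ k - uu Φ γ l| ≤ |PhiHat Φ k - PhiHat Φ l| := by
      have e : PhiHat Φ l - PhiHat Φ k = (uu Φ γ k + uu Φ γ l) * (uu Φ γ k - uu Φ γ l) := by
        linear_combination h.uu_sq l - h.uu_sq k
      rw [abs_sub_comm (PhiHat Φ k), e, abs_mul]
      refine mul_le_mul_of_nonneg_right ?_ (abs_nonneg _)
      rw [abs_of_nonneg (by linarith [(hu k).1, (hu l).1])]
      linarith [(hu k).1, (hu l).1]
    have d3 : |uu Φ γ k - uu Φ γ l| ≤ |PhiHat Φ k - PhiHat Φ l| / (2 * u₀) := by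
      rw [le_div_iff₀ (by positivity)]; linarith
    have hE : Real.exp (-(2 * m) * t) = Real.exp (-m * t) ^ 2 := by
      rw [← Real.exp_nat_mul]; congr 1; push_cast; ring
    rw [← sq_abs, hE, ← sq_abs (PhiHat Φ k - PhiHat Φ l)]
    calc _ ≤ (B * Real.exp (-m * t) * (|PhiHat Φ k - PhiHat Φ l| / (2 * u₀))) ^ 2 := by
          refine pow_le_pow_left₀ (abs_nonneg _) (d1.trans ?_) 2
          exact mul_le_mul_of_nonneg_left d3 (by positivity)
      _ = _ := by ring
  have hle : (∫ t in Ioi (0 : ℝ), ∫ k in (-(1 / 2) : ℝ)..(1 / 2),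
      (A2Hat Φ γ t (k + k₀ / 2) - A2Hat Φ γ t (k - k₀ / 2)) ^ 2)
      ≤ ∫ t in Ioi (0 : ℝ), (B / (2 * u₀)) ^ 2 * I * Real.exp (-(2 * m) * t) := by
    refine integral_mono_of_nonneg ?_ ((integrableOn_exp_neg_mul_Ioi hm2 0).const_mul _) ?_
    · exact Filter.Eventually.of_forall fun t =>
        intervalIntegral.integral_nonneg (by norm_num) fun k _ => sq_nonneg _
    · filter_upwards [ae_restrict_mem measurableSet_Ioi] with t ht
      have c1 : Continuous fun k => A2Hat Φ γ t k := by
        simp_rw [A2Hat_eq_mode]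
        unfold mode
        have : ∀ k, 2 * uu Φ γ k ≠ 0 := fun k => by
          have : 0 < uu Φ γ k := by linarith [(hu k).1]
          positivity
        fun_prop (disch := assumption)
      calc _ ≤ ∫ k in (-(1 / 2) : ℝ)..(1 / 2), (B / (2 * u₀)) ^ 2 * Real.exp (-(2 * m) * t)
            * (PhiHat Φ (k + k₀ / 2) - PhiHat Φ (k - k₀ / 2)) ^ 2 := by
            refine intervalIntegral.integral_mono_on (by norm_num)
              (Continuous.intervalIntegrable (by fun_prop) _ _)
              (Continuous.intervalIntegrable (by fun_prop) _ _) fun k _ => ?_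
            exact hpt t (le_of_lt ht) _ _
        _ = _ := by
            rw [intervalIntegral.integral_const_mul, hI]; ring
  rw [integral_const_mul, integral_exp_neg_mul_Ioi hm2] at hle
  have h3 := (hnd k₀ h1 h2).trans hle
  rw [div_le_iff₀ hK0, hK]
  simp only [mul_zero, Real.exp_zero] at h3
  calc c ≤ _ := h3
    _ = _ := by ring

theorem PhiHat_eq_of_cast_eq (Φ : ℤ → ℝ) {L : ℕ} [NeZero L] {a b : ℤ}
    (hab : (a : ZMod L) = (b : ZMod L)) : PhiHat Φ ((a : ℝ) / L) = PhiHat Φ ((b : ℝ) / L) := by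
  obtain ⟨c, hc⟩ := (ZMod.intCast_eq_intCast_iff_dvd_sub b a L).mp hab.symm
  have hL := natCast_pos' (L := L)
  have e : (a : ℝ) / L = (b : ℝ) / L + c := by
    have : (a : ℝ) - b = L * c := by exact_mod_cast hc
    field_simp; linarith
  rw [e, PhiHat_add_int]

theorem sum_range_natCast {M : Type*} [AddCommMonoid M] {L : ℕ} [NeZero L] (G : ZMod L → M) :
    ∑ j ∈ Finset.range L, G (j : ZMod L) = ∑ m, G m := by
  refine Finset.sum_nbij' (fun j => (j : ZMod L)) ZMod.val (fun _ _ => Finset.mem_univ _)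
    (fun m _ => Finset.mem_range.mpr (ZMod.val_lt m))
    (fun j hj => ZMod.val_natCast_of_lt (Finset.mem_range.mp hj))
    (fun m _ => ZMod.natCast_zmod_val m) fun _ _ => rfl

/-- The left end point rule for a Lipschitz function. It transfers the lower bound on the variation
of Φ̂ from the torus to the dual lattice, with an error that vanishes as L grows. -/
theorem integral_le_riemann_sum {F : ℝ → ℝ} {M : ℝ} (hF : Continuous F)
    (hM : ∀ x y, |F x - F y| ≤ M * |x - y|) (hM0 : 0 ≤ M) (a : ℝ) {L : ℕ} (hL : 0 < L) :
    ∫ x in a..(a + 1), F x ≤ 1 / (L : ℝ) * ∑ j ∈ Finset.range L, F (a + j / L) + M / L := by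
  have hL' : (0 : ℝ) < L := Nat.cast_pos.mpr hL
  have h1 := intervalIntegral.sum_integral_adjacent_intervals (f := F) (μ := volume)
    (a := fun j : ℕ => a + (j : ℝ) / L) (n := L) fun k _ => hF.intervalIntegrable _ _
  simp only [Nat.cast_zero, zero_div, add_zero, div_self hL'.ne'] at h1
  rw [← h1, Finset.mul_sum]
  have e : M / L = ∑ _j ∈ Finset.range L, M / (L : ℝ) ^ 2 := by
    rw [Finset.sum_const, Finset.card_range, nsmul_eq_mul]; field_simp
  rw [e, ← Finset.sum_add_distrib]
  refine Finset.sum_le_sum fun j _ => ?_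
  have hlen : a + ((j + 1 : ℕ) : ℝ) / L - (a + (j : ℝ) / L) = 1 / L := by
    push_cast; field_simp; ring
  have hle : a + (j : ℝ) / L ≤ a + ((j + 1 : ℕ) : ℝ) / L := by
    have : (0 : ℝ) < 1 / L := by positivity
    linarith
  calc _ ≤ ∫ _ in (a + (j : ℝ) / L)..(a + ((j + 1 : ℕ) : ℝ) / L), (F (a + j / L) + M / L) := by
        refine intervalIntegral.integral_mono_on hle (hF.intervalIntegrable _ _)
          (continuous_const.intervalIntegrable _ _) fun x hx => ?_
        have h2 := (abs_le.mp (hM x (a + j / L))).2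
        have h3 : |x - (a + j / L)| ≤ 1 / L := by
          rw [abs_of_nonneg (by linarith [hx.1])]; linarith [hx.2]
        have h4 := mul_le_mul_of_nonneg_left h3 hM0
        have h5 : M * (1 / (L : ℝ)) = M / L := by ring
        linarith
    _ = _ := by
        rw [intervalIntegral.integral_const, hlen, smul_eq_mul]; field_simp

/-- The variation of the dispersion relation over the dual lattice. -/
theorem IsAdmissible.discrete_variation_ge (h : IsAdmissible Φ γ) {ε : ℝ} (hε : 0 < ε) :
    ∃ L₀ : ℕ, ∃ c > 0, ∀ (L : ℕ) [NeZero L], L₀ ≤ L → ∀ n : ZMod L,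
      ε ≤ |(n.valMinAbs : ℝ) / L| →
      c ≤ 1 / (L : ℝ) * ∑ m : ZMod L, (PhiHat Φ ((m.valMinAbs : ℝ) / L)
        - PhiHat Φ (((m - n).valMinAbs : ℝ) / L)) ^ 2 := by
  obtain ⟨c, hc, hvar⟩ := h.variation_ge hε
  obtain ⟨w, hw, hp⟩ := h.interaction.pinning
  set D : ℝ := 2 * Real.pi * PhiBound Φ with hD
  have hD0 : 0 ≤ D := by have := PhiBound_nonneg Φ; positivity
  -- A Lipschitz constant for the squared difference: values of Φ̂ differ by at most γ²/4 and Φ̂ has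
  -- Lipschitz constant D. The choice of L₀ makes the error M/L at most c/2.
  set M : ℝ := γ ^ 2 * D with hM
  have hM0 : 0 ≤ M := by positivity
  obtain ⟨L₀, hL₀⟩ := exists_nat_gt (2 * M / c)
  refine ⟨L₀, c / 2, by positivity, fun L _ hL n hn => ?_⟩
  have hLpos := natCast_pos' (L := L)
  set k₀ : ℝ := (n.valMinAbs : ℝ) / L with hk₀
  have hk₀1 : |k₀| ≤ 1 / 2 := by
    have hx := ZMod.valMinAbs_mem_Ioc n
    have a1 : -(L : ℝ) < n.valMinAbs * 2 := by exact_mod_cast hx.1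
    have a2 : (n.valMinAbs : ℝ) * 2 ≤ L := by exact_mod_cast hx.2
    rw [hk₀, abs_le]
    constructor
    · rw [le_div_iff₀ hLpos]; linarith
    · rw [div_le_iff₀ hLpos]; linarith
  set F : ℝ → ℝ := fun k => (PhiHat Φ (k + k₀ / 2) - PhiHat Φ (k - k₀ / 2)) ^ 2 with hF
  have cP := h.interaction.continuous
  have cF : Continuous F := by rw [hF]; fun_prop
  have pF : Function.Periodic F 1 := by
    intro k
    have e1 : k + 1 + k₀ / 2 = k + k₀ / 2 + (1 : ℤ) := by push_cast; ring
    have e2 : k + 1 - k₀ / 2 = k - k₀ / 2 + (1 : ℤ) := by push_cast; ring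
    simp only [hF]
    rw [e1, e2, PhiHat_add_int, PhiHat_add_int]
  have bP : ∀ k l, |PhiHat Φ k - PhiHat Φ l| ≤ γ ^ 2 / 4 := by
    intro k l
    have hw2 : 0 < w ^ 2 := by positivity
    rw [abs_le]
    constructor <;> linarith [hp k, hp l, h.noise_dominates k, h.noise_dominates l]
  have lF : ∀ x y, |F x - F y| ≤ M * |x - y| := by
    intro x y
    simp only [hF]
    rw [sq_sub_sq, abs_mul]
    have b1 := bP (x + k₀ / 2) (x - k₀ / 2)
    have b2 := bP (y + k₀ / 2) (y - k₀ / 2)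
    have b3 := h.interaction.abs_sub_le (x + k₀ / 2) (y + k₀ / 2)
    have b4 := h.interaction.abs_sub_le (x - k₀ / 2) (y - k₀ / 2)
    rw [add_sub_add_right_eq_sub] at b3
    rw [sub_sub_sub_cancel_right] at b4
    have c1 := (abs_add_le _ _).trans (add_le_add b1 b2)
    have c2 : |PhiHat Φ (x + k₀ / 2) - PhiHat Φ (x - k₀ / 2)
        - (PhiHat Φ (y + k₀ / 2) - PhiHat Φ (y - k₀ / 2))| ≤ D * |x - y| + D * |x - y| := by
      rw [sub_sub_sub_comm]
      exact (abs_sub _ _).trans (add_le_add b3 b4)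
    calc _ ≤ (γ ^ 2 / 4 + γ ^ 2 / 4) * (D * |x - y| + D * |x - y|) :=
          mul_le_mul c1 c2 (abs_nonneg _) (by positivity)
      _ = _ := by rw [hM]; ring
  have h1 := hvar k₀ hn hk₀1
  -- By periodicity the window may start at -k₀/2. The nodes of the Riemann sum then give the points
  -- j/L and j/L - k₀, all on the dual lattice.
  have h2 : ∫ k in (-(1 / 2) : ℝ)..(1 / 2), F k = ∫ k in (-(k₀ / 2))..(-(k₀ / 2) + 1), F k := by
    have := pF.intervalIntegral_add_eq (-(1 / 2)) (-(k₀ / 2))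
    rw [← this]; norm_num
  have h3 := integral_le_riemann_sum cF lF hM0 (-(k₀ / 2)) (NeZero.pos L)
  have h4 : ∑ j ∈ Finset.range L, F (-(k₀ / 2) + j / L) = ∑ m : ZMod L,
      (PhiHat Φ ((m.valMinAbs : ℝ) / L) - PhiHat Φ (((m - n).valMinAbs : ℝ) / L)) ^ 2 := by
    rw [← sum_range_natCast]
    refine Finset.sum_congr rfl fun j _ => ?_
    simp only [hF]
    have e1 : -(k₀ / 2) + (j : ℝ) / L + k₀ / 2 = ((j : ℤ) : ℝ) / L := by push_cast; ring
    have e2 : -(k₀ / 2) + (j : ℝ) / L - k₀ / 2 = (((j : ℤ) - n.valMinAbs : ℤ) : ℝ) / L := by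
      rw [hk₀]; push_cast; ring
    rw [e1, e2, PhiHat_eq_of_cast_eq Φ (L := L) (a := (j : ℤ)) (b := (j : ZMod L).valMinAbs)
      (by simp), PhiHat_eq_of_cast_eq Φ (L := L) (a := (j : ℤ) - n.valMinAbs)
      (b := ((j : ZMod L) - n).valMinAbs) (by simp)]
  rw [h4] at h3
  have h5 : M / L ≤ c / 2 := by
    rw [div_le_iff₀ hLpos]
    have : 2 * M / c < L := hL₀.trans_le (by exact_mod_cast hL)
    rw [div_lt_iff₀ hc] at this
    linarith
  have h6 : c ≤ ∫ k in (-(1 / 2) : ℝ)..(1 / 2), F k := h1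
  linarith

end Dispersion

/-! ### The damped local dynamics -/

theorem hasDerivAt_clm_exp {𝔸 : Type*} [NormedRing 𝔸] [NormedAlgebra ℝ 𝔸] [CompleteSpace 𝔸]
    (M : 𝔸) (l : 𝔸 →ₗ[ℝ] ℝ) (hl : Continuous l) (t : ℝ) :
    HasDerivAt (fun t : ℝ => l (NormedSpace.exp ((-t) • M)))
      (-l (M * NormedSpace.exp ((-t) • M))) t := by
  have h1 := hasDerivAt_exp_smul_const' (𝕂 := ℝ) (-M) t
  simp only [smul_neg, ← neg_smul, neg_mul] at h1
  have h2 := (ContinuousLinearMap.hasFDerivAt ⟨l, hl⟩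
    (x := NormedSpace.exp ((-t) • M))).comp_hasDerivAt t h1
  exact h2.congr_deriv (map_neg l _)

/-- A column of the exponential solves v' = -Mv with a unit vector as initial value, and linear
equations have unique solutions. A guessed column thus only has to be inserted into the equation. -/
theorem exp_smul_apply_eq {ι : Type*} [Fintype ι] [DecidableEq ι] (M : Matrix ι ι ℝ) (j : ι)
    (v : ℝ → ι → ℝ) (hv : ∀ t, HasDerivAt v (-(M.mulVec (v t))) t) (h0 : v 0 = Pi.single j 1)
    (t : ℝ) (i : ι) : NormedSpace.exp ((-t) • M) i j = v t i := by
  set f : ℝ → ι → ℝ := fun t i => NormedSpace.exp ((-t) • M) i j with hf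
  have hfd : ∀ t, HasDerivAt f (-(M.mulVec (f t))) t := by
    intro t
    rw [hasDerivAt_pi]
    intro i
    -- The exponential depends only on the topology; a norm making the matrices a Banach algebra is
    -- installed just to differentiate it.
    let _ : NormedRing (Matrix ι ι ℝ) := Matrix.linftyOpNormedRing
    let _ : NormedAlgebra ℝ (Matrix ι ι ℝ) := Matrix.linftyOpNormedAlgebra
    have hc : CompleteSpace (Matrix ι ι ℝ) := FiniteDimensional.complete ℝ _
    exact hasDerivAt_clm_exp M (Matrix.entryLinearMap ℝ ℝ i j)
      (LinearMap.continuous_of_finiteDimensional _) t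
  have hL : ∀ _ : ℝ, LipschitzOnWith (‖LinearMap.toContinuousLinearMap (-(Matrix.toLin' M))‖₊)
      (fun w : ι → ℝ => -(M.mulVec w)) univ := by
    intro _
    exact ((LinearMap.toContinuousLinearMap (-(Matrix.toLin' M))).lipschitz).lipschitzOnWith
  have := ODE_solution_unique_univ (v := fun _ w => -(M.mulVec w)) (s := fun _ => univ) (t₀ := 0)
    hL (fun t => ⟨hfd t, mem_univ _⟩) (fun t => ⟨hv t, mem_univ _⟩) (by
      rw [h0]
      funext i
      simp [hf, Matrix.one_apply, Pi.single_apply])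
  exact congr_fun (congr_fun this t) i

theorem hasDerivAt_rinv {L : ℕ} [NeZero L] {F : ZMod L → ℝ → ℝ} {F' : ZMod L → ℝ} {t : ℝ}
    (h : ∀ n, HasDerivAt (F n) (F' n) t) (x : ZMod L) :
    HasDerivAt (fun t => rinv (fun n => F n t) x) (rinv F' x) t := by
  unfold rinv
  exact (HasDerivAt.fun_sum fun n _ => (h n).mul_const _).const_mul _

theorem rinv_neg_fun {L : ℕ} [NeZero L] (c : ZMod L → ℝ) (x : ZMod L) :
    rinv (fun n => -c n) x = -rinv c x := by
  simp [rinv]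

theorem rinv_lin {L : ℕ} [NeZero L] (a b : ℝ) (c d : ZMod L → ℝ) (x : ZMod L) :
    rinv (fun n => a * c n + b * d n) x = a * rinv c x + b * rinv d x := by
  simp only [rinv, add_mul, Finset.sum_add_distrib, mul_add, Finset.mul_sum]
  congr 1 <;> exact Finset.sum_congr rfl fun n _ => by ring

section Dynamics

variable {Φ : ℤ → ℝ} {γ : ℝ} {L : ℕ} [NeZero L]

/-- The squared dispersion relation on the dual lattice. -/
def dualPhi (Φ : ℤ → ℝ) (n : ZMod L) : ℝ := PhiHat Φ ((n.valMinAbs : ℝ) / L)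

/-- The function `u` on the dual lattice. -/
def dualU (Φ : ℤ → ℝ) (γ : ℝ) (n : ZMod L) : ℝ := uu Φ γ ((n.valMinAbs : ℝ) / L)

theorem dualPhi_neg (n : ZMod L) : dualPhi Φ (-n) = dualPhi Φ n := by
  unfold dualPhi
  rw [PhiHat_eq_of_cast_eq Φ (L := L) (a := (-n).valMinAbs) (b := -n.valMinAbs) (by simp),
    Int.cast_neg, neg_div, PhiHat_neg]

omit [NeZero L] in
theorem IsAdmissible.dualU_sq (h : IsAdmissible Φ γ) (n : ZMod L) :
    dualU Φ γ n ^ 2 = (γ / 2) ^ 2 - dualPhi Φ n := h.uu_sq _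

theorem IsAdmissible.dualU_neg (h : IsAdmissible Φ γ) (n : ZMod L) :
    dualU Φ γ (-n) = dualU Φ γ n := by
  have h1 := h.dualU_sq (-n)
  rw [dualPhi_neg, ← h.dualU_sq] at h1
  exact (sq_eq_sq₀ (Real.sqrt_nonneg _) (Real.sqrt_nonneg _)).mp h1

theorem IsAdmissible.PhiL_eq (h : IsAdmissible Φ γ) (x y : ZMod L) :
    PhiL Φ L x y = rinv (dualPhi Φ) (x - y) := by
  unfold PhiL rinv dualPhi
  simp only [Matrix.of_apply, h.interaction.omega_sq]

/-- The explicit form of `A`: the momentum part `mode` and the position part. -/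
theorem IsAdmissible.AA_eq (h : IsAdmissible Φ γ) (t : ℝ) (a : ZMod L ⊕ ZMod L) :
    AA Φ γ L t a = Sum.elim (rinv fun n => -(dualPhi Φ n * modeInt γ (dualU Φ γ n) t))
      (rinv fun n => mode γ (dualU Φ γ n) t) a := by
  obtain ⟨u₀, u₁, hu₀, -, -, hu⟩ := h.uu_bounds
  have hU : ∀ n : ZMod L, dualU Φ γ n ≠ 0 := fun n => (hu₀.trans_le (hu _).1).ne'
  unfold AA
  -- Position row: multiplication by `PhiL` is a convolution, diagonal after the transform. Momentum
  -- row: the oscillator equation `hasDerivAt_mode`. Initial value: the lattice delta, the inverse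
  -- transform of 1.
  refine exp_smul_apply_eq (MM Φ γ L) (Sum.inr 0)
    (fun t => Sum.elim (rinv fun n => -(dualPhi Φ n * modeInt γ (dualU Φ γ n) t))
      (rinv fun n => mode γ (dualU Φ γ n) t)) (fun t => ?_) ?_ t a
  · rw [hasDerivAt_pi]
    rintro (x | x)
    · have := hasDerivAt_rinv (t := t) (fun n =>
        ((hasDerivAt_modeInt γ (dualU Φ γ n) t).const_mul (dualPhi Φ n)).neg) x
      refine this.congr_deriv ?_
      simp only [MM, Pi.neg_apply, Matrix.fromBlocks_mulVec, Sum.elim_inl, Sum.elim_comp_inl,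
        Sum.elim_comp_inr, Matrix.zero_mulVec, zero_add, rinv_neg_fun]
      rw [← rinv_convolution dualPhi_neg fun n => by rw [h.dualU_neg]]
      simp only [Matrix.mulVec, dotProduct, h.PhiL_eq]
    · have := hasDerivAt_rinv (t := t) (fun n => hasDerivAt_mode γ (dualU Φ γ n) t) x
      refine this.congr_deriv ?_
      simp only [MM, Pi.neg_apply, Matrix.fromBlocks_mulVec, Sum.elim_inr, Sum.elim_comp_inl,
        Sum.elim_comp_inr, Matrix.neg_mulVec, Matrix.one_mulVec, Matrix.smul_mulVec, Pi.add_apply,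
        Pi.smul_apply, rinv_neg_fun, smul_eq_mul, Pi.neg_apply]
      rw [show (fun n : ZMod L => -γ * mode γ (dualU Φ γ n) t
          - ((γ / 2) ^ 2 - dualU Φ γ n ^ 2) * modeInt γ (dualU Φ γ n) t)
        = fun n => -γ * mode γ (dualU Φ γ n) t
          + (-1) * (dualPhi Φ n * modeInt γ (dualU Φ γ n) t) from by
          funext n; rw [h.dualU_sq]; ring, rinv_lin]
      ring
  · funext a
    rcases a with x | x
    · simp [modeInt_zero, rinv]
    · simp only [Sum.elim_inr, mode_zero γ (hU _), rinv_one]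
      by_cases hx : x = 0
      · simp [hx]
      · simp [hx]

end Dynamics

/-! ### The memory kernel and its transform -/

section Kernel

variable {Φ : ℤ → ℝ} {γ u₀ u₁ : ℝ} {L : ℕ} [NeZero L]

/-- The transform of the memory kernel. -/
def kern (Φ : ℤ → ℝ) (γ : ℝ) (n : ZMod L) (s : ℝ) : ℝ :=
  1 / (L : ℝ) * ∑ m : ZMod L, 2 * γ * (mode γ (dualU Φ γ m) s * mode γ (dualU Φ γ (m - n)) s)

theorem average_le {F : ZMod L → ℝ} {c : ℝ} (h : ∀ m, F m ≤ c) : 1 / (L : ℝ) * ∑ m, F m ≤ c := by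
  have hL := natCast_pos' (L := L)
  have h1 : ∑ m, F m ≤ L * c := by
    calc _ ≤ ∑ _m : ZMod L, c := Finset.sum_le_sum fun m _ => h m
      _ = _ := by simp [ZMod.card]
  rw [one_div, inv_mul_le_iff₀ hL]
  exact h1

theorem average_const (c : ℝ) : 1 / (L : ℝ) * ∑ _m : ZMod L, c = c := by
  have hL := natCast_pos' (L := L)
  simp [ZMod.card, hL.ne']

theorem memory_eq (h : IsAdmissible Φ γ) (s : ℝ) (x : ZMod L) :
    memory Φ γ L s x = 2 * γ * rinv (fun n => mode γ (dualU Φ γ n) s) x ^ 2 := by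
  unfold memory
  rw [h.AA_eq, Sum.elim_inr, rinv_neg fun n => by rw [h.dualU_neg]]

theorem memory_nonneg (h : IsAdmissible Φ γ) (s : ℝ) (x : ZMod L) : 0 ≤ memory Φ γ L s x := by
  have := h.flip_pos
  rw [memory_eq h]; positivity

theorem memory_continuous (h : IsAdmissible Φ γ) (x : ZMod L) :
    Continuous fun s => memory Φ γ L s x := by
  simp_rw [memory_eq h]
  unfold rinv
  have := fun u => mode_continuous γ u
  fun_prop

/-- The memory kernel is a square in position space, so its transform is a self-convolution of the
responses; their evenness turns n - m into m - n. -/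
theorem fhat_memory (h : IsAdmissible Φ γ) (s : ℝ) (n : ZMod L) :
    fhat (fun x => (memory Φ γ L s x : ℂ)) n = kern Φ γ n s := by
  have e : (fun x => (memory Φ γ L s x : ℂ)) = fun x => (2 * γ : ℂ) *
      (finv (fun n => (mode γ (dualU Φ γ n) s : ℂ)) x
        * finv (fun n => (mode γ (dualU Φ γ n) s : ℂ)) x) := by
    funext x
    rw [memory_eq h, ← rinv_eq_finv fun n => by rw [h.dualU_neg]]
    push_cast
    ring
  have e2 : fhat (fun x => (memory Φ γ L s x : ℂ)) n = (2 * γ : ℂ) *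
      fhat (fun x => finv (fun n => (mode γ (dualU Φ γ n) s : ℂ)) x
        * finv (fun n => (mode γ (dualU Φ γ n) s : ℂ)) x) n := by
    rw [e]; unfold fhat; rw [Finset.mul_sum]
    exact Finset.sum_congr rfl fun x _ => by ring
  rw [e2, fhat_mul]
  unfold kern
  push_cast
  rw [mul_left_comm, Finset.mul_sum]
  congr 1
  refine Finset.sum_congr rfl fun m _ => ?_
  rw [← h.dualU_neg (n - m), neg_sub]

/-- The angle `2π k x` with `k = n/L`. -/
def angle (n x : ZMod L) : ℝ := 2 * Real.pi * ((n.valMinAbs : ℝ) / L) * (x.valMinAbs : ℝ)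

/-- The transform is real, so only cosines remain. With nonnegative weights, the difference to the
zero frequency becomes a sum of nonnegative multiples of 1 - cos. -/
theorem kern_eq_sum_cos (h : IsAdmissible Φ γ) (s : ℝ) (n : ZMod L) :
    kern Φ γ n s = ∑ x, memory Φ γ L s x * Real.cos (angle n x) := by
  have := congr_arg Complex.re (fhat_memory h s n)
  rw [Complex.ofReal_re] at this
  rw [← this]
  unfold fhat
  rw [Complex.re_sum]
  refine Finset.sum_congr rfl fun x _ => ?_
  rw [Complex.re_ofReal_mul, AddChar.map_neg_eq_conj, Complex.conj_re, stdAddChar_mul_re]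
  rfl

theorem kern_zero_eq (h : IsAdmissible Φ γ) (s : ℝ) :
    kern Φ γ (0 : ZMod L) s = ∑ x, memory Φ γ L s x := by
  rw [kern_eq_sum_cos h]
  simp [angle]

theorem kern_zero_eq_average (s : ℝ) :
    kern Φ γ (0 : ZMod L) s = 1 / (L : ℝ) * ∑ m : ZMod L, 2 * γ * mode γ (dualU Φ γ m) s ^ 2 := by
  unfold kern
  simp only [sub_zero, sq]

theorem kern_continuous (n : ZMod L) : Continuous (kern Φ γ n) := by
  unfold kern
  have := fun u => mode_continuous γ u
  fun_prop

theorem abs_kern_le (hγ : 0 < γ) (hu₀ : 0 < u₀) (hu₁ : u₁ < γ / 2)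
    (hu : ∀ k, uu Φ γ k ∈ Icc u₀ u₁) (n : ZMod L) {s : ℝ} (hs : 0 ≤ s) :
    |kern Φ γ n s| ≤ 2 * γ * (γ / u₀) ^ 2 * Real.exp (-(γ / 2 - u₁) * s) := by
  unfold kern
  have hL := natCast_pos' (L := L)
  rw [abs_mul, abs_of_pos (by positivity : 0 < 1 / (L : ℝ))]
  refine (mul_le_mul_of_nonneg_left (Finset.abs_sum_le_sum_abs _ _) (by positivity)).trans
    (average_le fun m => ?_)
  have h1 := abs_mode_le hu₀ hu₁ (hu ((m.valMinAbs : ℝ) / L)) hs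
  have h2 := abs_mode_le hu₀ hu₁ (hu (((m - n).valMinAbs : ℝ) / L)) hs
  have h3 : Real.exp (-(γ / 2 - u₁) * s) ≤ 1 := Real.exp_le_one_iff.mpr (by nlinarith)
  rw [abs_mul (2 * γ), abs_mul (mode _ _ _), abs_of_pos (by positivity : 0 < 2 * γ)]
  calc _ ≤ 2 * γ * (γ / u₀ * Real.exp (-(γ / 2 - u₁) * s)
        * (γ / u₀ * Real.exp (-(γ / 2 - u₁) * s))) := by
        refine mul_le_mul_of_nonneg_left (mul_le_mul h1 h2 (abs_nonneg _) (by positivity))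
          (by positivity)
    _ = 2 * γ * (γ / u₀) ^ 2 * (Real.exp (-(γ / 2 - u₁) * s) * Real.exp (-(γ / 2 - u₁) * s)) := by
        ring
    _ ≤ _ := by
        refine mul_le_mul_of_nonneg_left (mul_le_of_le_one_right (Real.exp_pos _).le h3)
          (by positivity)

theorem memory_le (h : IsAdmissible Φ γ) (s : ℝ) (x : ZMod L) :
    memory Φ γ L s x ≤ kern Φ γ (0 : ZMod L) s := by
  rw [kern_zero_eq h]
  exact Finset.single_le_sum (f := fun x => memory Φ γ L s x) (fun y _ => memory_nonneg h s y)
    (Finset.mem_univ x)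

theorem abs_memory_le (h : IsAdmissible Φ γ) (hu₀ : 0 < u₀) (hu₁ : u₁ < γ / 2)
    (hu : ∀ k, uu Φ γ k ∈ Icc u₀ u₁) {s : ℝ} (hs : 0 ≤ s) (x : ZMod L) :
    ‖memory Φ γ L s x‖ ≤ 2 * γ * (γ / u₀) ^ 2 * Real.exp (-(γ / 2 - u₁) * s) := by
  rw [Real.norm_eq_abs, abs_of_nonneg (memory_nonneg h s x)]
  exact (memory_le h s x).trans ((le_abs_self _).trans
    (abs_kern_le h.flip_pos hu₀ hu₁ hu (0 : ZMod L) hs))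

/-- The second difference of `u` from the one of `u²`. -/
theorem abs_second_difference_of_sq {u₀ x y z A B : ℝ} (hu₀ : 0 < u₀) (hy : u₀ ≤ y)
    (h2 : |x ^ 2 - 2 * y ^ 2 + z ^ 2| ≤ A) (h3 : (x - y) ^ 2 ≤ B) (h4 : (z - y) ^ 2 ≤ B) :
    |x - 2 * y + z| ≤ (A + 2 * B) / (2 * u₀) := by
  have hy0 : 0 < y := hu₀.trans_le hy
  have e : (x - 2 * y + z) * (2 * y)
      = (x ^ 2 - 2 * y ^ 2 + z ^ 2) - ((x - y) ^ 2 + (z - y) ^ 2) := by ring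
  have h5 : |x - 2 * y + z| * (2 * y) ≤ A + 2 * B := by
    have e' : |x - 2 * y + z| * (2 * y) = |(x - 2 * y + z) * (2 * y)| := by
      rw [abs_mul, abs_of_pos (by positivity : 0 < 2 * y)]
    rw [e', e]
    refine (abs_sub _ _).trans ?_
    rw [abs_of_nonneg (by positivity : 0 ≤ (x - y) ^ 2 + (z - y) ^ 2)]
    linarith
  rw [le_div_iff₀ (by positivity)]
  refine le_trans ?_ h5
  exact mul_le_mul_of_nonneg_left (by linarith) (abs_nonneg _)

/-- Fourth moments of the memory kernel. -/
theorem fourth_moment_le (h : IsAdmissible Φ γ) (hu₀ : 0 < u₀) (h01 : u₀ ≤ u₁) (hu₁ : u₁ < γ / 2)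
    (hu : ∀ k, uu Φ γ k ∈ Icc u₀ u₁) :
    ∃ C₄ > 0, ∀ (L : ℕ) [NeZero L], ∀ s ≥ 0,
      ∑ x : ZMod L, (x.valMinAbs : ℝ) ^ 4 * memory Φ γ L s x
        ≤ C₄ * Real.exp (-(γ / 2 - u₁) * s) := by
  obtain ⟨B, hB, hdiff⟩ := mode_second_difference hu₀ hu₁ h01
  have hγ := h.flip_pos
  have hP := PhiBound_nonneg Φ
  -- D/L² bounds the squared increments of u between neighbouring frequencies, and E/L² the bracket
  -- in the second difference estimate for `mode`. The 1 added to C₄ only makes it positive.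
  set D : ℝ := (2 * Real.pi * PhiBound Φ / (2 * u₀)) ^ 2 with hD
  set E : ℝ := (4 * Real.pi ^ 2 * PhiBound Φ + 2 * D) / (2 * u₀) + 2 * D with hE
  have hD0 : 0 ≤ D := by positivity
  have hE0 : 0 ≤ E := by positivity
  refine ⟨2 * γ * (B * E) ^ 2 + 1, by positivity, fun L _ s hs => ?_⟩
  have hL := natCast_pos' (L := L)
  set e : ℝ := Real.exp (-((γ / 2 - u₁) / 2) * s) with he
  have he0 : 0 < e := Real.exp_pos _
  have nb : ∀ n : ZMod L, dualPhi Φ (n + 1) = PhiHat Φ ((n.valMinAbs : ℝ) / L + 1 / L)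
      ∧ dualPhi Φ (n - 1) = PhiHat Φ ((n.valMinAbs : ℝ) / L - 1 / L) := by
    intro n
    unfold dualPhi
    constructor
    · rw [PhiHat_eq_of_cast_eq Φ (L := L) (a := (n + 1).valMinAbs) (b := n.valMinAbs + 1) (by simp)]
      push_cast; rw [add_div]
    · rw [PhiHat_eq_of_cast_eq Φ (L := L) (a := (n - 1).valMinAbs) (b := n.valMinAbs - 1) (by simp)]
      push_cast; rw [sub_div]
  have sqdiff : ∀ n m : ZMod L, |dualPhi Φ n - dualPhi Φ m| ≤ 2 * Real.pi * PhiBound Φ * (1 / L) →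
      (dualU Φ γ n - dualU Φ γ m) ^ 2 ≤ D / (L : ℝ) ^ 2 := by
    intro n m hnm
    have a1 := (hu ((n.valMinAbs : ℝ) / L)).1
    have a2 := (hu ((m.valMinAbs : ℝ) / L)).1
    change u₀ ≤ dualU Φ γ n at a1
    change u₀ ≤ dualU Φ γ m at a2
    have e1 : dualPhi Φ m - dualPhi Φ n
        = (dualU Φ γ n + dualU Φ γ m) * (dualU Φ γ n - dualU Φ γ m) := by
      linear_combination h.dualU_sq m - h.dualU_sq n
    have e2 : 2 * u₀ * |dualU Φ γ n - dualU Φ γ m| ≤ |dualPhi Φ n - dualPhi Φ m| := by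
      rw [abs_sub_comm (dualPhi Φ n), e1, abs_mul]
      refine mul_le_mul_of_nonneg_right ?_ (abs_nonneg _)
      rw [abs_of_nonneg (by linarith)]; linarith
    have e3 : |dualU Φ γ n - dualU Φ γ m| ≤ 2 * Real.pi * PhiBound Φ / (2 * u₀) * (1 / L) := by
      rw [div_mul_eq_mul_div, le_div_iff₀ (by positivity)]; linarith
    rw [← sq_abs]
    refine (pow_le_pow_left₀ (abs_nonneg _) e3 2).trans (le_of_eq ?_)
    rw [hD]; ring
  have hsecond : ∀ n : ZMod L, |mode γ (dualU Φ γ (n + 1)) s - 2 * mode γ (dualU Φ γ n) s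
      + mode γ (dualU Φ γ (n - 1)) s| ≤ B * e * E / (L : ℝ) ^ 2 := by
    intro n
    refine ((hdiff s hs).2 _ (hu _) _ (hu _) _ (hu _)).trans ?_
    change B * e * (|dualU Φ γ (n + 1) - 2 * dualU Φ γ n + dualU Φ γ (n - 1)|
      + (dualU Φ γ (n + 1) - dualU Φ γ n) ^ 2 + (dualU Φ γ (n - 1) - dualU Φ γ n) ^ 2) ≤ _
    have b1 := sqdiff (n + 1) n (by
      rw [(nb n).1]; unfold dualPhi
      refine (h.interaction.abs_sub_le _ _).trans (le_of_eq ?_)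
      rw [add_sub_cancel_left, abs_of_pos (by positivity : 0 < 1 / (L : ℝ))])
    have b2 := sqdiff (n - 1) n (by
      rw [(nb n).2]; unfold dualPhi
      refine (h.interaction.abs_sub_le _ _).trans (le_of_eq ?_)
      rw [sub_sub_cancel_left, abs_neg, abs_of_pos (by positivity : 0 < 1 / (L : ℝ))])
    have b3 : |dualU Φ γ (n + 1) ^ 2 - 2 * dualU Φ γ n ^ 2 + dualU Φ γ (n - 1) ^ 2|
        ≤ 4 * Real.pi ^ 2 * PhiBound Φ / (L : ℝ) ^ 2 := by
      rw [h.dualU_sq, h.dualU_sq, h.dualU_sq, (nb n).1, (nb n).2]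
      have := h.interaction.second_difference_le ((n.valMinAbs : ℝ) / L) (1 / L)
      rw [← abs_neg]
      unfold dualPhi
      convert this using 1
      · congr 1; ring
      · ring
    have b4 := abs_second_difference_of_sq hu₀ (hu _).1 b3 b1 b2
    have b5 : B * e * (|dualU Φ γ (n + 1) - 2 * dualU Φ γ n + dualU Φ γ (n - 1)|
      + (dualU Φ γ (n + 1) - dualU Φ γ n) ^ 2 + (dualU Φ γ (n - 1) - dualU Φ γ n) ^ 2)
      ≤ B * e * ((4 * Real.pi ^ 2 * PhiBound Φ / (L : ℝ) ^ 2 + 2 * (D / (L : ℝ) ^ 2)) / (2 * u₀)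
        + D / (L : ℝ) ^ 2 + D / (L : ℝ) ^ 2) := by
      refine mul_le_mul_of_nonneg_left (add_le_add (add_le_add b4 b1) b2) (by positivity)
    refine b5.trans (le_of_eq ?_)
    rw [hE]; ring
  have h4 := sum_pow_four_le (L := L) (c := fun n => mode γ (dualU Φ γ n) s)
    (fun n => by rw [h.dualU_neg]) hsecond
  have e5 : ∑ x : ZMod L, (x.valMinAbs : ℝ) ^ 4 * memory Φ γ L s x
      = 2 * γ * ∑ x : ZMod L, (x.valMinAbs : ℝ) ^ 4
        * rinv (fun n => mode γ (dualU Φ γ n) s) x ^ 2 := by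
    rw [Finset.mul_sum]
    exact Finset.sum_congr rfl fun x _ => by rw [memory_eq h]; ring
  have e6 : Real.exp (-(γ / 2 - u₁) * s) = e ^ 2 := by
    rw [he, ← Real.exp_nat_mul]; congr 1; push_cast; ring
  rw [e5, e6]
  calc _ ≤ 2 * γ * (B * e * E) ^ 2 := mul_le_mul_of_nonneg_left h4 (by positivity)
    _ = 2 * γ * (B * E) ^ 2 * e ^ 2 := by ring
    _ ≤ _ := mul_le_mul_of_nonneg_right (by linarith) (by positivity)

/-- For |θ| ≤ 1 this is Taylor's formula; beyond that the trivial bounds suffice since θ² ≤ θ⁴. It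
holds for all θ because the angles 2πkx need not be small. -/
theorem abs_one_sub_cos_sub_le (θ : ℝ) : |1 - Real.cos θ - θ ^ 2 / 2| ≤ θ ^ 4 := by
  have h1 := Real.one_sub_sq_div_two_le_cos (x := θ)
  rcases le_total |θ| 1 with h | h
  · have h2 := Real.cos_bound h
    rw [abs_sub_comm] at h2
    have h3 : |θ| ^ 4 = θ ^ 4 := by
      rw [show (4 : ℕ) = 2 * 2 by norm_num, pow_mul, pow_mul, sq_abs]
    rw [h3] at h2
    rw [show 1 - Real.cos θ - θ ^ 2 / 2 = 1 - θ ^ 2 / 2 - Real.cos θ by ring]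
    refine h2.trans ?_
    have : 0 ≤ θ ^ 4 := by positivity
    linarith
  · have h2 : 1 ≤ θ ^ 2 := by rw [← sq_abs]; exact one_le_pow₀ h
    have h3 := Real.cos_le_one θ
    have h4 : θ ^ 2 ≤ θ ^ 4 := by
      have := mul_le_mul_of_nonneg_left h2 (sq_nonneg θ)
      calc _ = θ ^ 2 * 1 := by ring
        _ ≤ _ := this
        _ = _ := by ring
    rw [abs_le]
    constructor <;> linarith

omit [NeZero L] in
theorem valMinAbs_sq_le_pow_four (x : ZMod L) :
    (x.valMinAbs : ℝ) ^ 2 ≤ (x.valMinAbs : ℝ) ^ 4 := by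
  rcases eq_or_ne x.valMinAbs 0 with h | h
  · simp [h]
  · have h1 : (1 : ℝ) ≤ (x.valMinAbs : ℝ) ^ 2 := by
      have : (1 : ℤ) ≤ x.valMinAbs ^ 2 := by have := sq_pos_of_ne_zero h; omega
      exact_mod_cast this
    have := mul_le_mul_of_nonneg_left h1 (sq_nonneg (x.valMinAbs : ℝ))
    calc _ = (x.valMinAbs : ℝ) ^ 2 * 1 := by ring
      _ ≤ _ := this
      _ = _ := by ring

end Kernel

/-! ### The modes of the renewal equation -/

section Modes

variable {Φ : ℤ → ℝ} {γ u₀ u₁ : ℝ} {L : ℕ} [NeZero L]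

theorem integral_average {F : ZMod L → ℝ → ℝ} (hF : ∀ m, IntegrableOn (F m) (Ioi 0)) :
    ∫ s in Ioi (0 : ℝ), 1 / (L : ℝ) * ∑ m, F m s
      = 1 / (L : ℝ) * ∑ m, ∫ s in Ioi (0 : ℝ), F m s := by
  rw [integral_const_mul, integral_finsetSum _ fun m _ => hF m]

theorem integral_kern_zero (hu₀ : 0 < u₀) (hu₁ : u₁ < γ / 2) (hu : ∀ k, uu Φ γ k ∈ Icc u₀ u₁) :
    ∫ s in Ioi (0 : ℝ), kern Φ γ (0 : ZMod L) s = 1 := by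
  have p1 : ∀ m : ZMod L, 0 < dualU Φ γ m := fun m => hu₀.trans_le (hu _).1
  have p2 : ∀ m : ZMod L, dualU Φ γ m < γ / 2 := fun m => (hu _).2.trans_lt hu₁
  simp_rw [kern_zero_eq_average]
  rw [integral_average fun m => integrableOn_mode_sq (p1 m) (p2 m) 0]
  simp_rw [integral_mode_sq (p1 _) (p2 _), modeTail_zero (p1 _) (p2 _)]
  exact average_const 1

theorem integral_mul_kern_zero (hγ : 0 < γ) (hu₀ : 0 < u₀) (hu₁ : u₁ < γ / 2)
    (hu : ∀ k, uu Φ γ k ∈ Icc u₀ u₁) :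
    ∫ s in Ioi (0 : ℝ), s * kern Φ γ (0 : ZMod L) s = 1 / γ := by
  have p1 : ∀ m : ZMod L, 0 < dualU Φ γ m := fun m => hu₀.trans_le (hu _).1
  have p2 : ∀ m : ZMod L, dualU Φ γ m < γ / 2 := fun m => (hu _).2.trans_lt hu₁
  have e : ∀ s, s * kern Φ γ (0 : ZMod L) s
      = 1 / (L : ℝ) * ∑ m : ZMod L, s * (2 * γ * mode γ (dualU Φ γ m) s ^ 2) := by
    intro s
    rw [kern_zero_eq_average, mul_left_comm, Finset.mul_sum]
  simp_rw [e]
  rw [integral_average fun m => ?_]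
  · simp_rw [integral_mul_mode_sq (p1 _) (p2 _)]
    exact average_const _
  -- Integrability comes for free: a nonintegrable function would have integral 0, whereas the value
  -- is 1/γ.
  · by_contra h
    have h1 := integral_undef h
    rw [integral_mul_mode_sq (p1 m) (p2 m)] at h1
    have : 0 < 1 / γ := by positivity
    linarith

theorem one_sub_integral_kern_zero (hu₀ : 0 < u₀) (hu₁ : u₁ < γ / 2)
    (hu : ∀ k, uu Φ γ k ∈ Icc u₀ u₁) {s : ℝ} (hs : 0 ≤ s) :
    1 - ∫ r in (0 : ℝ)..s, kern Φ γ (0 : ZMod L) r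
      = 1 / (L : ℝ) * ∑ m : ZMod L, modeTail γ (dualU Φ γ m) s := by
  have p1 : ∀ m : ZMod L, 0 < dualU Φ γ m := fun m => hu₀.trans_le (hu _).1
  have p2 : ∀ m : ZMod L, dualU Φ γ m < γ / 2 := fun m => (hu _).2.trans_lt hu₁
  have c : ∀ m : ZMod L, Continuous fun r => 2 * γ * mode γ (dualU Φ γ m) r ^ 2 := fun m => by
    have := mode_continuous γ (dualU Φ γ m); fun_prop
  have e : ∀ m : ZMod L, ∫ r in (0 : ℝ)..s, 2 * γ * mode γ (dualU Φ γ m) r ^ 2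
      = 1 - modeTail γ (dualU Φ γ m) s := by
    intro m
    rw [integral_eq_integral_Ioi_sub (integrableOn_mode_sq (p1 m) (p2 m) 0) hs,
      integral_mode_sq (p1 m) (p2 m), integral_mode_sq (p1 m) (p2 m), modeTail_zero (p1 m) (p2 m)]
  simp_rw [kern_zero_eq_average]
  rw [intervalIntegral.integral_const_mul, intervalIntegral.integral_finsetSum fun m _ =>
    (c m).intervalIntegrable _ _]
  simp_rw [e]
  rw [Finset.sum_sub_distrib, mul_sub, average_const]
  ring

/-- The zero frequency kernel and its tail are averages of those of the single modes, with a common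
a, so the triangle inequality passes the bound on. Both a and η depend only on γ, u₀ and u₁. -/
theorem integral_hazard_le (hu₀ : 0 < u₀) (h01 : u₀ ≤ u₁) (hu₁ : u₁ < γ / 2) :
    ∃ a > 0, ∃ η > 0, ∀ (Φ : ℤ → ℝ), (∀ k, uu Φ γ k ∈ Icc u₀ u₁) → ∀ (L : ℕ) [NeZero L],
      ∫ s in Ioi (0 : ℝ), |kern Φ γ (0 : ZMod L) s
        - a * (1 - ∫ r in (0 : ℝ)..s, kern Φ γ (0 : ZMod L) r)| ≤ 1 - η := by
  obtain ⟨a, ha, η, hη, hhaz⟩ := mode_hazard hu₀ hu₁ h01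
  refine ⟨a, ha, η, hη, fun Φ hu L _ => ?_⟩
  have hL := natCast_pos' (L := L)
  have p1 : ∀ m : ZMod L, 0 < dualU Φ γ m := fun m => hu₀.trans_le (hu _).1
  have p2 : ∀ m : ZMod L, dualU Φ γ m < γ / 2 := fun m => (hu _).2.trans_lt hu₁
  have I : ∀ m : ZMod L, IntegrableOn (fun s => |2 * γ * mode γ (dualU Φ γ m) s ^ 2
      - a * modeTail γ (dualU Φ γ m) s|) (Ioi 0) := fun m =>
    ((integrableOn_mode_sq (p1 m) (p2 m) 0).sub
      ((modeTail_integrable (p1 m) (p2 m)).const_mul a)).abs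
  calc _ ≤ ∫ s in Ioi (0 : ℝ), 1 / (L : ℝ) * ∑ m : ZMod L,
        |2 * γ * mode γ (dualU Φ γ m) s ^ 2 - a * modeTail γ (dualU Φ γ m) s| := by
        refine integral_mono_of_nonneg (Filter.Eventually.of_forall fun s => abs_nonneg _)
          ((integrable_finsetSum _ fun m _ => I m).const_mul _) ?_
        filter_upwards [ae_restrict_mem measurableSet_Ioi] with s hs
        rw [one_sub_integral_kern_zero hu₀ hu₁ hu (le_of_lt hs), kern_zero_eq_average,
          mul_left_comm a, ← mul_sub, Finset.mul_sum, ← Finset.sum_sub_distrib, abs_mul,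
          abs_of_pos (by positivity : 0 < 1 / (L : ℝ))]
        exact mul_le_mul_of_nonneg_left (Finset.abs_sum_le_sum_abs _ _) (by positivity)
    _ = _ := integral_average I
    _ ≤ 1 - η := average_le fun m => hhaz _ (hu _)

/-- The kernel averages products of two responses, to each of which `mode_decorrelation` applies.
Differences of u² are differences of Φ̂, so the mass gap is the variation of the dispersion relation
on the dual lattice. -/
theorem integral_abs_kern_le (hu₀ : 0 < u₀) (h01 : u₀ ≤ u₁) (hu₁ : u₁ < γ / 2)
    (h : IsAdmissible Φ γ) (hu : ∀ k, uu Φ γ k ∈ Icc u₀ u₁) :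
    ∃ c > 0, ∀ (L : ℕ) [NeZero L] (n : ZMod L),
      ∫ s in Ioi (0 : ℝ), |kern Φ γ n s| ≤ 1 - c * (1 / (L : ℝ) * ∑ m : ZMod L,
        (PhiHat Φ ((m.valMinAbs : ℝ) / L) - PhiHat Φ (((m - n).valMinAbs : ℝ) / L)) ^ 2) := by
  obtain ⟨c, hc, hdec⟩ := mode_decorrelation hu₀ hu₁ h01
  refine ⟨c, hc, fun L _ n => ?_⟩
  have hL := natCast_pos' (L := L)
  have hγ : 0 < γ := by linarith
  have hm : 0 < γ / 2 - u₁ := by linarith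
  have I : ∀ m : ZMod L, IntegrableOn (fun s => 2 * γ * |mode γ (dualU Φ γ m) s
      * mode γ (dualU Φ γ (m - n)) s|) (Ioi 0) := by
    intro m
    refine integrableOn_Ioi_of_le_exp (C := 2 * γ * (γ / u₀) ^ 2) (m := γ / 2 - u₁) ?_ hm le_rfl ?_
    · have := fun u => mode_continuous γ u
      fun_prop
    · intro s hs
      have h1 := abs_mode_le hu₀ hu₁ (hu ((m.valMinAbs : ℝ) / L)) hs
      have h2 := abs_mode_le hu₀ hu₁ (hu (((m - n).valMinAbs : ℝ) / L)) hs
      have h3 : Real.exp (-(γ / 2 - u₁) * s) ≤ 1 := Real.exp_le_one_iff.mpr (by nlinarith)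
      rw [Real.norm_eq_abs, abs_mul (2 * γ), abs_abs, abs_mul (mode _ _ _),
        abs_of_pos (by positivity : 0 < 2 * γ)]
      calc _ ≤ 2 * γ * (γ / u₀ * Real.exp (-(γ / 2 - u₁) * s)
            * (γ / u₀ * Real.exp (-(γ / 2 - u₁) * s))) :=
            mul_le_mul_of_nonneg_left (mul_le_mul h1 h2 (abs_nonneg _) (by positivity))
              (by positivity)
        _ = 2 * γ * (γ / u₀) ^ 2
            * (Real.exp (-(γ / 2 - u₁) * s) * Real.exp (-(γ / 2 - u₁) * s)) := by ring
        _ ≤ _ := mul_le_mul_of_nonneg_left (mul_le_of_le_one_right (Real.exp_pos _).le h3)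
              (by positivity)
  have hsq : ∀ m : ZMod L, (dualU Φ γ m ^ 2 - dualU Φ γ (m - n) ^ 2) ^ 2
      = (PhiHat Φ ((m.valMinAbs : ℝ) / L) - PhiHat Φ (((m - n).valMinAbs : ℝ) / L)) ^ 2 := by
    intro m
    rw [h.dualU_sq, h.dualU_sq]
    unfold dualPhi
    ring
  calc _ ≤ ∫ s in Ioi (0 : ℝ), 1 / (L : ℝ) * ∑ m : ZMod L,
        2 * γ * |mode γ (dualU Φ γ m) s * mode γ (dualU Φ γ (m - n)) s| := by
        refine integral_mono_of_nonneg (Filter.Eventually.of_forall fun s => abs_nonneg _)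
          ((integrable_finsetSum _ fun m _ => I m).const_mul _) ?_
        refine Filter.Eventually.of_forall fun s => ?_
        simp only [kern]
        rw [abs_mul, abs_of_pos (by positivity : 0 < 1 / (L : ℝ))]
        refine mul_le_mul_of_nonneg_left ((Finset.abs_sum_le_sum_abs _ _).trans_eq ?_)
          (by positivity)
        exact Finset.sum_congr rfl fun m _ => by
          rw [abs_mul (2 * γ), abs_of_pos (by positivity : 0 < 2 * γ)]
    _ = 1 / (L : ℝ) * ∑ m : ZMod L, ∫ s in Ioi (0 : ℝ),
        2 * γ * |mode γ (dualU Φ γ m) s * mode γ (dualU Φ γ (m - n)) s| := integral_average I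
    _ ≤ 1 / (L : ℝ) * ∑ m : ZMod L,
        (1 - c * (dualU Φ γ m ^ 2 - dualU Φ γ (m - n) ^ 2) ^ 2) :=
        mul_le_mul_of_nonneg_left (Finset.sum_le_sum fun m _ => hdec _ (hu _) _ (hu _))
          (by positivity)
    _ = _ := by
        rw [Finset.sum_sub_distrib, mul_sub, average_const, ← Finset.mul_sum, mul_left_comm]
        simp_rw [hsq]

section Moments

variable (h : IsAdmissible Φ γ) (hu₀ : 0 < u₀) (hu₁ : u₁ < γ / 2)
  (hu : ∀ k, uu Φ γ k ∈ Icc u₀ u₁)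
include h hu₀ hu₁ hu

theorem memory_integrable (x : ZMod L) :
    IntegrableOn (fun s => memory Φ γ L s x) (Ioi 0) :=
  integrableOn_Ioi_of_le_exp (memory_continuous h x) (by linarith) le_rfl fun _ hs =>
    abs_memory_le h hu₀ hu₁ hu hs x

theorem integral_kern_sub (n : ZMod L) :
    ∫ s in Ioi (0 : ℝ), (kern Φ γ (0 : ZMod L) s - kern Φ γ n s)
      = ∑ x, (∫ s in Ioi (0 : ℝ), memory Φ γ L s x) * (1 - Real.cos (angle n x)) := by
  have e : ∀ s, kern Φ γ (0 : ZMod L) s - kern Φ γ n s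
      = ∑ x, memory Φ γ L s x * (1 - Real.cos (angle n x)) := by
    intro s
    rw [kern_zero_eq h, kern_eq_sum_cos h, ← Finset.sum_sub_distrib]
    exact Finset.sum_congr rfl fun x _ => by ring
  simp_rw [e]
  rw [integral_finsetSum _ fun x _ => (memory_integrable h hu₀ hu₁ hu x).mul_const _]
  exact Finset.sum_congr rfl fun x _ => integral_mul_const _ _

theorem integral_fourth_moment_le {C₄ : ℝ}
    (h4 : ∀ s ≥ 0, ∑ x : ZMod L, (x.valMinAbs : ℝ) ^ 4 * memory Φ γ L s x
      ≤ C₄ * Real.exp (-(γ / 2 - u₁) * s)) :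
    ∑ x : ZMod L, (x.valMinAbs : ℝ) ^ 4 * ∫ s in Ioi (0 : ℝ), memory Φ γ L s x
      ≤ C₄ / (γ / 2 - u₁) := by
  have e : ∑ x : ZMod L, (x.valMinAbs : ℝ) ^ 4 * ∫ s in Ioi (0 : ℝ), memory Φ γ L s x
      = ∫ s in Ioi (0 : ℝ), ∑ x : ZMod L, (x.valMinAbs : ℝ) ^ 4 * memory Φ γ L s x := by
    rw [integral_finsetSum _ fun x _ => (memory_integrable h hu₀ hu₁ hu x).const_mul _]
    exact Finset.sum_congr rfl fun x _ => (integral_const_mul _ _).symm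
  rw [e]
  refine setIntegral_le_of_le_exp (by linarith) fun s hs => ?_
  rw [Real.norm_eq_abs, abs_of_nonneg (Finset.sum_nonneg fun x _ =>
    mul_nonneg (by positivity) (memory_nonneg h s x))]
  exact h4 s hs

end Moments

end Modes

/-! ### Uniform estimates for the modes -/

section UniformModes

variable {Φ : ℤ → ℝ} {γ u₀ u₁ : ℝ} {L : ℕ} [NeZero L]

/-- `(2πk)²` for `k = n/L`. -/
def freqSq (n : ZMod L) : ℝ := (2 * Real.pi * ((n.valMinAbs : ℝ) / L)) ^ 2

omit [NeZero L] in
theorem freqSq_nonneg (n : ZMod L) : 0 ≤ freqSq n := sq_nonneg _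

omit [NeZero L] in
theorem angle_sq (n x : ZMod L) : angle n x ^ 2 = freqSq n * (x.valMinAbs : ℝ) ^ 2 := by
  unfold angle freqSq; ring

omit [NeZero L] in
theorem one_sub_cos_angle_le (n x : ZMod L) :
    1 - Real.cos (angle n x) ≤ freqSq n * (x.valMinAbs : ℝ) ^ 4 := by
  have h1 := Real.one_sub_sq_div_two_le_cos (x := angle n x)
  rw [angle_sq] at h1
  have h2 := mul_le_mul_of_nonneg_left (valMinAbs_sq_le_pow_four x) (freqSq_nonneg n)
  have h3 : 0 ≤ freqSq n * (x.valMinAbs : ℝ) ^ 2 := mul_nonneg (freqSq_nonneg n) (sq_nonneg _)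
  linarith

theorem one_sub_cos_nonneg (θ : ℝ) : 0 ≤ 1 - Real.cos θ := by linarith [Real.cos_le_one θ]

/-- Since 1 - cos θ ≤ θ²/2, a second moment would do; as x² ≤ x⁴ on the integers the fourth moment
is reused. -/
theorem abs_kern_sub_le (h : IsAdmissible Φ γ) {C₄ s : ℝ}
    (h4 : ∑ x : ZMod L, (x.valMinAbs : ℝ) ^ 4 * memory Φ γ L s x
      ≤ C₄ * Real.exp (-(γ / 2 - u₁) * s)) (n : ZMod L) :
    |kern Φ γ (0 : ZMod L) s - kern Φ γ n s|
      ≤ C₄ * freqSq n * Real.exp (-(γ / 2 - u₁) * s) := by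
  have e : kern Φ γ (0 : ZMod L) s - kern Φ γ n s
      = ∑ x, memory Φ γ L s x * (1 - Real.cos (angle n x)) := by
    rw [kern_zero_eq h, kern_eq_sum_cos h, ← Finset.sum_sub_distrib]
    exact Finset.sum_congr rfl fun x _ => by ring
  rw [e, abs_of_nonneg (Finset.sum_nonneg fun x _ =>
    mul_nonneg (memory_nonneg h s x) (one_sub_cos_nonneg _))]
  calc _ ≤ ∑ x : ZMod L, memory Φ γ L s x * (freqSq n * (x.valMinAbs : ℝ) ^ 4) :=
        Finset.sum_le_sum fun x _ =>
          mul_le_mul_of_nonneg_left (one_sub_cos_angle_le n x) (memory_nonneg h s x)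
    _ = freqSq n * ∑ x : ZMod L, (x.valMinAbs : ℝ) ^ 4 * memory Φ γ L s x := by
        rw [Finset.mul_sum]; exact Finset.sum_congr rfl fun x _ => by ring
    _ ≤ freqSq n * (C₄ * Real.exp (-(γ / 2 - u₁) * s)) :=
        mul_le_mul_of_nonneg_left h4 (freqSq_nonneg n)
    _ = _ := by ring

theorem integral_memory_nonneg (h : IsAdmissible Φ γ) (x : ZMod L) :
    0 ≤ ∫ s in Ioi (0 : ℝ), memory Φ γ L s x :=
  integral_nonneg fun s => memory_nonneg h s x

/-- Through the factor γ/2 in `ptilde`, κ_L/γ is half the second moment of the time-integrated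
memory: the coefficient of (2πk)² in the mass defect of the kernel. -/
theorem kappa_eq (hγ : 0 < γ) : kappa Φ γ L / γ
    = ∑ x : ZMod L, (x.valMinAbs : ℝ) ^ 2 / 2 * ∫ s in Ioi (0 : ℝ), memory Φ γ L s x := by
  unfold kappa ptilde
  rw [Finset.sum_div]
  exact Finset.sum_congr rfl fun x _ => by field_simp

section Moments

variable (h : IsAdmissible Φ γ) (hu₀ : 0 < u₀) (hu₁ : u₁ < γ / 2)
  (hu : ∀ k, uu Φ γ k ∈ Icc u₀ u₁)
include h hu₀ hu₁ hu

/-- The cosine is expanded to second order; the quartic error is summed with the fourth moment. This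
is where κ_L enters as the diffusion constant. -/
theorem abs_integral_kern_sub_le {C : ℝ}
    (h4 : ∑ x : ZMod L, (x.valMinAbs : ℝ) ^ 4 * ∫ s in Ioi (0 : ℝ), memory Φ γ L s x ≤ C)
    (n : ZMod L) :
    |(∫ s in Ioi (0 : ℝ), (kern Φ γ (0 : ZMod L) s - kern Φ γ n s))
      - kappa Φ γ L * freqSq n / γ| ≤ C * freqSq n ^ 2 := by
  rw [integral_kern_sub h hu₀ hu₁ hu, mul_div_right_comm, kappa_eq h.flip_pos, Finset.sum_mul,
    ← Finset.sum_sub_distrib]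
  refine (Finset.abs_sum_le_sum_abs _ _).trans ?_
  calc _ ≤ ∑ x : ZMod L, freqSq n ^ 2 * ((x.valMinAbs : ℝ) ^ 4
        * ∫ s in Ioi (0 : ℝ), memory Φ γ L s x) := by
        refine Finset.sum_le_sum fun x _ => ?_
        have e1 : (∫ s in Ioi (0 : ℝ), memory Φ γ L s x) * (1 - Real.cos (angle n x))
            - (x.valMinAbs : ℝ) ^ 2 / 2 * (∫ s in Ioi (0 : ℝ), memory Φ γ L s x) * freqSq n
            = (∫ s in Ioi (0 : ℝ), memory Φ γ L s x)
              * (1 - Real.cos (angle n x) - angle n x ^ 2 / 2) := by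
          rw [angle_sq]; ring
        have e2 : angle n x ^ 4 = freqSq n ^ 2 * (x.valMinAbs : ℝ) ^ 4 := by
          rw [show angle n x ^ 4 = (angle n x ^ 2) ^ 2 by ring, angle_sq]; ring
        rw [e1, abs_mul, abs_of_nonneg (integral_memory_nonneg h x)]
        refine (mul_le_mul_of_nonneg_left (abs_one_sub_cos_sub_le _)
          (integral_memory_nonneg h x)).trans (le_of_eq ?_)
        rw [e2]; ring
    _ = freqSq n ^ 2 * ∑ x : ZMod L, (x.valMinAbs : ℝ) ^ 4
        * ∫ s in Ioi (0 : ℝ), memory Φ γ L s x := by rw [Finset.mul_sum]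
    _ ≤ _ := by
        rw [mul_comm C]
        exact mul_le_mul_of_nonneg_left h4 (sq_nonneg _)

omit hu₀ hu₁ hu in
theorem kappa_le {C : ℝ}
    (h4 : ∑ x : ZMod L, (x.valMinAbs : ℝ) ^ 4 * ∫ s in Ioi (0 : ℝ), memory Φ γ L s x ≤ C) :
    kappa Φ γ L ≤ γ * C := by
  have hγ := h.flip_pos
  have h1 : kappa Φ γ L / γ ≤ C := by
    rw [kappa_eq hγ]
    refine le_trans (Finset.sum_le_sum fun x _ => ?_) h4
    refine mul_le_mul_of_nonneg_right ?_ (integral_memory_nonneg h x)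
    have := valMinAbs_sq_le_pow_four x
    have := sq_nonneg (x.valMinAbs : ℝ)
    linarith
  rw [div_le_iff₀ hγ] at h1
  linarith

/-- As 1 - cos θ ≤ 2 and the term x = 0 vanishes, the mass defect at any frequency is at most
4κ_L/γ. A single frequency with a mass gap thus bounds κ_L from below. -/
theorem le_kappa {d : ℝ} (n : ZMod L) (hd : ∫ s in Ioi (0 : ℝ), |kern Φ γ n s| ≤ 1 - d) :
    γ * d / 4 ≤ kappa Φ γ L := by
  have hγ := h.flip_pos
  have hm : 0 < γ / 2 - u₁ := by linarith
  have I : ∀ n : ZMod L, IntegrableOn (kern Φ γ n) (Ioi 0) := fun n =>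
    integrableOn_Ioi_of_le_exp (kern_continuous n) hm le_rfl fun s hs =>
      abs_kern_le hγ hu₀ hu₁ hu n hs
  have h1 : d ≤ ∫ s in Ioi (0 : ℝ), (kern Φ γ (0 : ZMod L) s - kern Φ γ n s) := by
    rw [integral_sub (I 0) (I n), integral_kern_zero hu₀ hu₁ hu]
    have : ∫ s in Ioi (0 : ℝ), kern Φ γ n s ≤ ∫ s in Ioi (0 : ℝ), |kern Φ γ n s| :=
      integral_mono (I n) (I n).abs fun s => le_abs_self _
    linarith
  have h2 : ∫ s in Ioi (0 : ℝ), (kern Φ γ (0 : ZMod L) s - kern Φ γ n s)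
      ≤ 4 * (kappa Φ γ L / γ) := by
    rw [integral_kern_sub h hu₀ hu₁ hu, kappa_eq hγ, Finset.mul_sum]
    refine Finset.sum_le_sum fun x _ => ?_
    have h3 : 1 - Real.cos (angle n x) ≤ 2 * (x.valMinAbs : ℝ) ^ 2 := by
      rcases eq_or_ne x.valMinAbs 0 with h0 | h0
      · simp [angle, h0]
      · have h1 : (1 : ℝ) ≤ (x.valMinAbs : ℝ) ^ 2 := by
          have : (1 : ℤ) ≤ x.valMinAbs ^ 2 := by have := sq_pos_of_ne_zero h0; omega
          exact_mod_cast this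
        linarith [Real.neg_one_le_cos (angle n x)]
    calc _ ≤ (∫ s in Ioi (0 : ℝ), memory Φ γ L s x) * (2 * (x.valMinAbs : ℝ) ^ 2) :=
          mul_le_mul_of_nonneg_left h3 (integral_memory_nonneg h x)
      _ = _ := by ring
  have h5 := h1.trans h2
  rw [← mul_div_assoc, le_div_iff₀ hγ] at h5
  linarith

end Moments

/-- The frequency ⌊L/2⌋ works, because 4⌊L/2⌋ ≥ L as soon as L ≥ 2. -/
theorem exists_quarter_le (hL : 2 ≤ L) : ∃ n : ZMod L, 1 / 4 ≤ |(n.valMinAbs : ℝ) / L| := by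
  have hL' := natCast_pos' (L := L)
  refine ⟨((L / 2 : ℕ) : ZMod L), ?_⟩
  rw [ZMod.valMinAbs_natCast_of_le_half le_rfl, Int.cast_natCast,
    abs_of_nonneg (by positivity), div_le_div_iff₀ (by norm_num) hL']
  have : L ≤ L / 2 * 4 := by omega
  have : (L : ℝ) ≤ (L / 2 : ℕ) * 4 := by exact_mod_cast this
  linarith

/-- The modes of the temperature profile diffuse, uniformly in the volume. -/
theorem renewal_modes (h : IsAdmissible Φ γ) (hu₀ : 0 < u₀) (h01 : u₀ ≤ u₁) (hu₁ : u₁ < γ / 2)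
    (hu : ∀ k, uu Φ γ k ∈ Icc u₀ u₁) :
    ∃ L₀ : ℕ, ∃ c > 0, ∃ C > 0, ∀ (L : ℕ) [NeZero L], L₀ ≤ L → 0 < kappa Φ γ L ∧
      ∀ (n : ZMod L) (f g : ℝ → ℂ) (S : ℝ), Continuous f → Continuous g → 0 ≤ S →
      (∀ t ≥ 0, ‖g t‖ ≤ S * Real.exp (-(γ / 2 - u₁) * t)) →
      (∀ t ≥ 0, f t = g t + ∫ s in (0 : ℝ)..t, (kern Φ γ n s : ℂ) * f (t - s)) →
      (∀ t ≥ 0, ‖f t‖ ≤ C * S) ∧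
      ∀ t₀ ≥ 0, ∀ t ≥ 0, ‖f (t₀ + t) - Real.exp (-(kappa Φ γ L * freqSq n) * t) * f t₀‖
        ≤ C * S * (freqSq n * Real.exp (-(c * freqSq n) * t₀) + Real.exp (-c * t₀)) := by
  have hγ := h.flip_pos
  set m : ℝ := γ / 2 - u₁ with hm
  have hm0 : 0 < m := by linarith
  obtain ⟨C₄, hC₄, h4⟩ := fourth_moment_le h hu₀ h01 hu₁ hu
  have h4i : ∀ (L : ℕ) [NeZero L], ∑ x : ZMod L, (x.valMinAbs : ℝ) ^ 4
      * ∫ s in Ioi (0 : ℝ), memory Φ γ L s x ≤ C₄ / m := fun L _ =>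
    integral_fourth_moment_le h hu₀ hu₁ hu (h4 L)
  obtain ⟨d, hd, hdec⟩ := integral_abs_kern_le hu₀ h01 hu₁ h hu
  obtain ⟨a, ha, η, hη, hhaz⟩ := integral_hazard_le hu₀ h01 hu₁
  obtain ⟨L₁, c₁, hc₁, hvar₁⟩ := h.discrete_variation_ge (ε := 1 / 4) (by norm_num)
  have hC₀ : 0 < 2 * γ * (γ / u₀) ^ 2 := by positivity
  -- κ₀ is the lower bound on κ_L from a frequency with |k| ≥ 1/4, and κ₁ the upper bound from the
  -- fourth moment. Neither depends on L, hence nor does the threshold ε.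
  obtain ⟨ε, hε, c₂, hc₂, C₂, hC₂, hdiff⟩ := renewal_diffusive (γ := γ) (C₀ := 2 * γ * (γ / u₀) ^ 2)
    (m := m) (C₁ := C₄) (C₂ := C₄ / m) (a := a) (η := η) (κ₀ := γ * (d * c₁) / 4)
    (κ₁ := γ * (C₄ / m)) hγ hC₀ hm0 hC₄ (by positivity) ha hη (by positivity) (by positivity)
  -- If (2πk)² exceeds ε then |k| is at least √ε/(2π), where nondegeneracy provides a uniform mass
  -- gap.
  have hε' : 0 < √ε / (2 * Real.pi) := by positivity
  obtain ⟨L₂, c₃, hc₃, hvar₂⟩ := h.discrete_variation_ge hε'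
  obtain ⟨δ, hδ, hδm, hren⟩ := renewal_decay (C₀ := 2 * γ * (γ / u₀) ^ 2) (m := m) (c := d * c₃)
    hC₀ hm0 (by positivity)
  refine ⟨max 2 (max L₁ L₂), min c₂ δ, by positivity, max C₂ (4 / (d * c₃)), by positivity,
    fun L _ hL => ?_⟩
  have hL2 : 2 ≤ L := (le_max_left _ _).trans hL
  have hL₁ : L₁ ≤ L := (le_max_left _ _).trans ((le_max_right _ _).trans hL)
  have hL₂ : L₂ ≤ L := (le_max_right _ _).trans ((le_max_right _ _).trans hL)
  obtain ⟨n₁, hn₁⟩ := exists_quarter_le hL2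
  have hκ : γ * (d * c₁) / 4 ≤ kappa Φ γ L := by
    refine le_kappa h hu₀ hu₁ hu n₁ ((hdec L n₁).trans ?_)
    have := mul_le_mul_of_nonneg_left (hvar₁ L hL₁ n₁ hn₁) hd.le
    linarith
  have hκ0 : 0 < kappa Φ γ L := lt_of_lt_of_le (by positivity) hκ
  refine ⟨hκ0, fun n f g S hf hg hS hgS hfg => ?_⟩
  have hx0 := freqSq_nonneg n
  by_cases hx : freqSq n ≤ ε
  · obtain ⟨r1, r2⟩ := hdiff (kern Φ γ (0 : ZMod L)) (kern Φ γ n) (kappa Φ γ L) (freqSq n)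
      (kern_continuous _) (kern_continuous _) (fun s hs => abs_kern_le hγ hu₀ hu₁ hu _ hs)
      (fun s hs => abs_kern_sub_le h (h4 L s hs) n) (integral_kern_zero hu₀ hu₁ hu)
      (integral_mul_kern_zero hγ hu₀ hu₁ hu) (abs_integral_kern_sub_le h hu₀ hu₁ hu (h4i L) n)
      (hhaz Φ hu L) hκ (kappa_le h (h4i L)) hx0 hx f g S hf hg hS hgS hfg
    refine ⟨fun t ht => (r1 t ht).trans (mul_le_mul_of_nonneg_right (le_max_left _ _) hS),
      fun t₀ ht₀ t ht => (r2 t₀ ht₀ t ht).trans ?_⟩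
    have e1 : Real.exp (-(c₂ * freqSq n) * t₀) ≤ Real.exp (-(min c₂ δ * freqSq n) * t₀) := by
      refine Real.exp_le_exp.mpr ?_
      have := mul_le_mul_of_nonneg_right (min_le_left c₂ δ) (mul_nonneg hx0 ht₀)
      linarith
    have e2 : Real.exp (-c₂ * t₀) ≤ Real.exp (-min c₂ δ * t₀) := by
      refine Real.exp_le_exp.mpr ?_
      have := mul_le_mul_of_nonneg_right (min_le_left c₂ δ) ht₀
      linarith
    exact mul_le_mul (mul_le_mul_of_nonneg_right (le_max_left _ _) hS)
      (add_le_add (mul_le_mul_of_nonneg_left e1 hx0) e2) (by positivity) (by positivity)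
  · have hk : √ε / (2 * Real.pi) ≤ |(n.valMinAbs : ℝ) / L| := by
      have h1 : √ε ≤ |2 * Real.pi * ((n.valMinAbs : ℝ) / L)| := by
        rw [← Real.sqrt_sq_eq_abs]
        exact Real.sqrt_le_sqrt (not_le.mp hx).le
      rw [abs_mul, abs_of_pos Real.two_pi_pos] at h1
      rw [div_le_iff₀ Real.two_pi_pos]
      linarith
    have r := hren (kern Φ γ n) (kern_continuous _) (fun s hs => abs_kern_le hγ hu₀ hu₁ hu _ hs)
      ((hdec L n).trans (by
        have := mul_le_mul_of_nonneg_left (hvar₂ L hL₂ n hk) hd.le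
        linarith)) f g S hf hg hS hgS hfg
    have hc0 : 0 < d * c₃ := by positivity
    have hle : 4 / (d * c₃) ≤ max C₂ (4 / (d * c₃)) := le_max_right _ _
    have h24 : 2 / (d * c₃) ≤ 4 / (d * c₃) := by gcongr; norm_num
    refine ⟨fun t ht => (r t ht).trans ?_, fun t₀ ht₀ t ht => ?_⟩
    · have e1 : Real.exp (-δ * t) ≤ 1 := Real.exp_le_one_iff.mpr (by nlinarith)
      calc _ ≤ 2 / (d * c₃) * S * 1 := mul_le_mul_of_nonneg_left e1 (by positivity)
        _ = 2 / (d * c₃) * S := mul_one _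
        _ ≤ _ := mul_le_mul_of_nonneg_right (h24.trans hle) hS
    -- At high frequency no cancellation is needed: each of the two terms is exponentially small in
    -- t₀.
    · have r1 := r (t₀ + t) (by positivity)
      have r2 := r t₀ ht₀
      have e1 : Real.exp (-δ * (t₀ + t)) ≤ Real.exp (-min c₂ δ * t₀) := by
        refine Real.exp_le_exp.mpr ?_
        have := mul_le_mul_of_nonneg_right (min_le_right c₂ δ) ht₀
        have := mul_nonneg hδ.le ht
        linarith
      have e2 : Real.exp (-δ * t₀) ≤ Real.exp (-min c₂ δ * t₀) := by
        refine Real.exp_le_exp.mpr ?_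
        have := mul_le_mul_of_nonneg_right (min_le_right c₂ δ) ht₀
        linarith
      have e3 : Real.exp (-(kappa Φ γ L * freqSq n) * t) ≤ 1 :=
        Real.exp_le_one_iff.mpr (by
          have := mul_nonneg (mul_nonneg hκ0.le hx0) ht; linarith)
      have hA : 0 ≤ 2 / (d * c₃) * S := by positivity
      have b1 := r1.trans (mul_le_mul_of_nonneg_left e1 hA)
      have b2 := r2.trans (mul_le_mul_of_nonneg_left e2 hA)
      have b3 : ‖(Real.exp (-(kappa Φ γ L * freqSq n) * t) : ℂ) * f t₀‖ ≤ ‖f t₀‖ := by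
        rw [norm_mul, Complex.norm_real, Real.norm_eq_abs, Real.abs_exp]
        exact mul_le_of_le_one_left (norm_nonneg _) e3
      have b4 := norm_sub_le (f (t₀ + t))
        ((Real.exp (-(kappa Φ γ L * freqSq n) * t) : ℂ) * f t₀)
      calc _ ≤ 4 / (d * c₃) * S * Real.exp (-min c₂ δ * t₀) := by
            have : 4 / (d * c₃) * S * Real.exp (-min c₂ δ * t₀)
              = 2 / (d * c₃) * S * Real.exp (-min c₂ δ * t₀)
                + 2 / (d * c₃) * S * Real.exp (-min c₂ δ * t₀) := by ring
            linarith
        _ ≤ max C₂ (4 / (d * c₃)) * S * (freqSq n * Real.exp (-(min c₂ δ * freqSq n) * t₀)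
            + Real.exp (-min c₂ δ * t₀)) := by
            refine mul_le_mul (mul_le_mul_of_nonneg_right hle hS) ?_ (Real.exp_pos _).le
              (by positivity)
            have : 0 ≤ freqSq n * Real.exp (-(min c₂ δ * freqSq n) * t₀) := by positivity
            linarith

end UniformModes

/-! ### The temperature profile -/

section Profile

variable {Φ : ℤ → ℝ} {γ u₀ u₁ : ℝ} {L : ℕ} [NeZero L]

/-- The field which the damped dynamics transports to the site `x`. -/
def response (Φ : ℤ → ℝ) (γ t : ℝ) (x : ZMod L) (X : Phase L) : ℝ :=
  ∑ a : ZMod L ⊕ ZMod L, AA Φ γ L t a * X (shift x a)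

theorem response_sq (t : ℝ) (x : ZMod L) (X : Phase L) :
    response Φ γ t x X ^ 2 = ∑ a' : ZMod L ⊕ ZMod L, ∑ a : ZMod L ⊕ ZMod L,
      AA Φ γ L t a * AA Φ γ L t a' * (X (shift x a') * X (shift x a)) := by
  unfold response
  rw [sq, Finset.sum_mul_sum]
  exact Finset.sum_congr rfl fun a _ => Finset.sum_congr rfl fun b _ => by ring

theorem response_sq_integrable {μ : Measure (Phase L)} (hμ : HasSecondMoments μ) (t : ℝ)
    (x : ZMod L) : Integrable (fun X => response Φ γ t x X ^ 2) μ := by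
  simp_rw [response_sq]
  exact integrable_finsetSum _ fun a _ => integrable_finsetSum _ fun b _ => (hμ _ _).const_mul _

/-- Written as the expectation of a square, the source is visibly nonnegative and can be compared
with the energy. -/
theorem source_eq {μ : Measure (Phase L)} (hμ : HasSecondMoments μ) (t : ℝ) (x : ZMod L) :
    source Φ γ L μ t x = ∫ X, response Φ γ t x X ^ 2 ∂μ := by
  unfold source
  simp_rw [response_sq]
  rw [integral_finsetSum _ fun a _ => integrable_finsetSum _ fun b _ => (hμ _ _).const_mul _]
  refine Finset.sum_congr rfl fun a _ => ?_
  rw [integral_finsetSum _ fun b _ => (hμ _ _).const_mul _]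
  exact Finset.sum_congr rfl fun b _ => (integral_const_mul _ _).symm

theorem source_nonneg {μ : Measure (Phase L)} (hμ : HasSecondMoments μ) (t : ℝ) (x : ZMod L) :
    0 ≤ source Φ γ L μ t x := by
  rw [source_eq hμ]; exact integral_nonneg fun X => sq_nonneg _

theorem hamiltonian_integrable {μ : Measure (Phase L)} (hμ : HasSecondMoments μ) :
    Integrable (hamiltonian Φ L) μ := by
  unfold hamiltonian
  refine Integrable.add (integrable_finsetSum _ fun x _ => ?_)
    (integrable_finsetSum _ fun x _ => integrable_finsetSum _ fun y _ => ?_)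
  · simp_rw [sq]; exact (hμ _ _).const_mul _
  · have := ((hμ (Sum.inl x) (Sum.inl y)).const_mul (1 / 2)).mul_const (PhiL Φ L x y)
    simpa only [mul_assoc] using this

/-- Pinning makes the potential energy coercive, so the energy controls positions as well as momenta
in ℓ². -/
theorem le_hamiltonian (h : IsAdmissible Φ γ) {w : ℝ} (hw : ∀ k, w ^ 2 ≤ PhiHat Φ k)
    (X : Phase L) : 1 / 2 * ∑ x, X (Sum.inr x) ^ 2 + w ^ 2 / 2 * ∑ x, X (Sum.inl x) ^ 2
      ≤ hamiltonian Φ L X := by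
  have h1 := le_sum_sum_rinv (c := dualPhi Φ) dualPhi_neg (b := w ^ 2) (fun n : ZMod L => hw _)
    fun x => X (Sum.inl x)
  unfold hamiltonian
  rw [Finset.mul_sum]
  have e : ∑ x' : ZMod L, ∑ x : ZMod L, 1 / 2 * X (Sum.inl x') * X (Sum.inl x) * PhiL Φ L x' x
      = 1 / 2 * ∑ x : ZMod L, ∑ y : ZMod L,
        X (Sum.inl x) * X (Sum.inl y) * rinv (dualPhi Φ) (x - y) := by
    rw [Finset.mul_sum]
    refine Finset.sum_congr rfl fun x _ => ?_
    rw [Finset.mul_sum]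
    refine Finset.sum_congr rfl fun y _ => ?_
    rw [h.PhiL_eq]; ring
  rw [e]
  linarith

theorem hamiltonian_nonneg (h : IsAdmissible Φ γ) (X : Phase L) : 0 ≤ hamiltonian Φ L X := by
  obtain ⟨w, hw, hp⟩ := h.interaction.pinning
  refine le_trans ?_ (le_hamiltonian h hp X)
  positivity

theorem energyDensity_nonneg (h : IsAdmissible Φ γ) (μ : Measure (Phase L)) :
    0 ≤ energyDensity Φ L μ :=
  mul_nonneg (by positivity) (integral_nonneg fun X => hamiltonian_nonneg h X)

/-- Correlation with the response is bounded on ℓ² by the supremum of its transform, which decays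
exponentially uniformly in L; the ℓ² norms are then bounded by the energy. -/
theorem sum_response_sq_le (h : IsAdmissible Φ γ) (hu₀ : 0 < u₀) (hu₁ : u₁ < γ / 2)
    (hu : ∀ k, uu Φ γ k ∈ Icc u₀ u₁) :
    ∃ K > 0, ∀ (L : ℕ) [NeZero L] (X : Phase L), ∀ t ≥ 0, ∑ x, response Φ γ t x X ^ 2
      ≤ K * hamiltonian Φ L X * Real.exp (-(γ / 2 - u₁) * t) := by
  obtain ⟨w, hw, hp⟩ := h.interaction.pinning
  have hγ := h.flip_pos
  set B₁ : ℝ := (γ / 2) ^ 2 * (1 / u₀) with hB₁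
  set B₂ : ℝ := γ / u₀ with hB₂
  refine ⟨4 * B₁ ^ 2 / w ^ 2 + 4 * B₂ ^ 2, by positivity, fun L _ X t ht => ?_⟩
  set e : ℝ := Real.exp (-(γ / 2 - u₁) * t) with he
  have he0 : 0 < e := Real.exp_pos _
  have he1 : e ≤ 1 := Real.exp_le_one_iff.mpr (by nlinarith)
  have b1 := sum_correlation_sq_le (L := L)
    (c := fun n => -(dualPhi Φ n * modeInt γ (dualU Φ γ n) t)) (B := B₁ * e)
    (fun n => by rw [dualPhi_neg, h.dualU_neg]) (fun n => by
      rw [abs_neg, abs_mul]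
      have h1 := abs_modeInt_le (γ := γ) hu₀ (hu ((n.valMinAbs : ℝ) / L)) ht
      have h2 : |dualPhi Φ n| ≤ (γ / 2) ^ 2 := by
        have a1 := hp ((n.valMinAbs : ℝ) / L)
        have a2 := h.noise_dominates ((n.valMinAbs : ℝ) / L)
        unfold dualPhi
        rw [abs_of_nonneg (le_trans (by positivity) a1)]
        linarith
      calc _ ≤ (γ / 2) ^ 2 * (1 / u₀ * e) := mul_le_mul h2 h1 (abs_nonneg _) (by positivity)
        _ = _ := by rw [hB₁]; ring) fun x => X (Sum.inl x)
  have b2 := sum_correlation_sq_le (L := L) (c := fun n => mode γ (dualU Φ γ n) t) (B := B₂ * e)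
    (fun n => by rw [h.dualU_neg]) (fun n => abs_mode_le hu₀ hu₁ (hu _) ht) fun x => X (Sum.inr x)
  have b3 : ∀ x, response Φ γ t x X ^ 2
      ≤ 2 * (∑ y, rinv (fun n => -(dualPhi Φ n * modeInt γ (dualU Φ γ n) t)) y
          * X (Sum.inl (x + y))) ^ 2
        + 2 * (∑ y, rinv (fun n => mode γ (dualU Φ γ n) t) y * X (Sum.inr (x + y))) ^ 2 := by
    intro x
    unfold response
    rw [Fintype.sum_sum_type]
    simp only [h.AA_eq, Sum.elim_inl, Sum.elim_inr, shift, Sum.map_inl, Sum.map_inr]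
    rw [← mul_add]
    exact add_sq_le
  have b4 := Finset.sum_le_sum fun x (_ : x ∈ Finset.univ) => b3 x
  rw [Finset.sum_add_distrib, ← Finset.mul_sum, ← Finset.mul_sum] at b4
  have b5 := le_hamiltonian h hp X
  have p1 : 0 ≤ ∑ x, X (Sum.inl x) ^ 2 := by positivity
  have p2 : 0 ≤ ∑ x, X (Sum.inr x) ^ 2 := by positivity
  set Q := ∑ x, X (Sum.inl x) ^ 2
  set P := ∑ x, X (Sum.inr x) ^ 2
  have b6 : 2 * (B₁ ^ 2 * Q) + 2 * (B₂ ^ 2 * P)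
      ≤ (4 * B₁ ^ 2 / w ^ 2 + 4 * B₂ ^ 2) * hamiltonian Φ L X := by
    calc _ ≤ (4 * B₁ ^ 2 / w ^ 2 + 4 * B₂ ^ 2) * (1 / 2 * P + w ^ 2 / 2 * Q) := by
          have e1 : (4 * B₁ ^ 2 / w ^ 2 + 4 * B₂ ^ 2) * (1 / 2 * P + w ^ 2 / 2 * Q)
              = 2 * (B₁ ^ 2 * Q) + 2 * (B₂ ^ 2 * P) + (2 * B₁ ^ 2 / w ^ 2 * P
                + 2 * B₂ ^ 2 * w ^ 2 * Q) := by field_simp; ring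
          rw [e1]
          have : 0 ≤ 2 * B₁ ^ 2 / w ^ 2 * P + 2 * B₂ ^ 2 * w ^ 2 * Q := by positivity
          linarith
      _ ≤ _ := mul_le_mul_of_nonneg_left b5 (by positivity)
  calc _ ≤ 2 * ((B₁ * e) ^ 2 * Q) + 2 * ((B₂ * e) ^ 2 * P) := by linarith
    _ = (2 * (B₁ ^ 2 * Q) + 2 * (B₂ ^ 2 * P)) * (e * e) := by ring
    _ ≤ (4 * B₁ ^ 2 / w ^ 2 + 4 * B₂ ^ 2) * hamiltonian Φ L X * (e * 1) :=
        mul_le_mul b6 (mul_le_mul_of_nonneg_left he1 he0.le) (by positivity)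
          (mul_nonneg (by positivity) (hamiltonian_nonneg h X))
    _ = _ := by ring

theorem sum_source_le (h : IsAdmissible Φ γ) (hu₀ : 0 < u₀) (hu₁ : u₁ < γ / 2)
    (hu : ∀ k, uu Φ γ k ∈ Icc u₀ u₁) :
    ∃ K > 0, ∀ (L : ℕ) [NeZero L] (μ : Measure (Phase L)), HasSecondMoments μ → ∀ t ≥ 0,
      ∑ x, source Φ γ L μ t x
        ≤ K * (L * energyDensity Φ L μ) * Real.exp (-(γ / 2 - u₁) * t) := by
  obtain ⟨K, hK, hle⟩ := sum_response_sq_le h hu₀ hu₁ hu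
  refine ⟨K, hK, fun L _ μ hμ t ht => ?_⟩
  have hL := natCast_pos' (L := L)
  simp_rw [source_eq hμ]
  rw [← integral_finsetSum _ fun x _ => response_sq_integrable hμ t x]
  have e : (L : ℝ) * energyDensity Φ L μ = ∫ X, hamiltonian Φ L X ∂μ := by
    unfold energyDensity; field_simp
  rw [e, ← integral_const_mul, ← integral_mul_const]
  exact integral_mono (integrable_finsetSum _ fun x _ => response_sq_integrable hμ t x)
    (((hamiltonian_integrable hμ).const_mul K).mul_const _) fun X => hle L X t ht

theorem AA_continuous (h : IsAdmissible Φ γ) (a : ZMod L ⊕ ZMod L) :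
    Continuous fun t => AA Φ γ L t a := by
  simp_rw [h.AA_eq]
  have h1 := fun u => mode_continuous γ u
  have h2 := fun u => modeInt_continuous γ u
  rcases a with x | x
  · simp only [Sum.elim_inl, rinv]; fun_prop
  · simp only [Sum.elim_inr, rinv]; fun_prop

theorem source_continuous (h : IsAdmissible Φ γ) (μ : Measure (Phase L)) (x : ZMod L) :
    Continuous fun t => source Φ γ L μ t x := by
  unfold source
  have := AA_continuous (L := L) h
  fun_prop

/-- Translation of a profile. -/
def translate (y : ZMod L) : (ZMod L → ℝ) →L[ℝ] (ZMod L → ℝ) :=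
  ContinuousLinearMap.pi fun x => ContinuousLinearMap.proj (x - y)

/-- The memory kernel as an operator. -/
def memoryOp (Φ : ℤ → ℝ) (γ : ℝ) (L : ℕ) [NeZero L] (s : ℝ) : (ZMod L → ℝ) →L[ℝ] (ZMod L → ℝ) :=
  ∑ y : ZMod L, memory Φ γ L s y • translate y

theorem memoryOp_apply (s : ℝ) (T : ZMod L → ℝ) (x : ZMod L) :
    memoryOp Φ γ L s T x = ∑ y, memory Φ γ L s y * T (x - y) := by
  simp [memoryOp, translate]

theorem memoryOp_continuous (h : IsAdmissible Φ γ) : Continuous (memoryOp Φ γ L) := by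
  unfold memoryOp
  have := memory_continuous (L := L) h
  fun_prop

theorem memoryOp_bound (h : IsAdmissible Φ γ) (hu₀ : 0 < u₀) (hu₁ : u₁ < γ / 2)
    (hu : ∀ k, uu Φ γ k ∈ Icc u₀ u₁) : ∃ B > 0, ∀ s ≥ 0, ‖memoryOp Φ γ L s‖ ≤ B := by
  have hγ := h.flip_pos
  refine ⟨(∑ y : ZMod L, 2 * γ * (γ / u₀) ^ 2 * ‖translate y‖) + 1, ?_, fun s hs => ?_⟩
  · have : 0 ≤ ∑ y : ZMod L, 2 * γ * (γ / u₀) ^ 2 * ‖translate y‖ := by positivity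
    linarith
  · unfold memoryOp
    refine (norm_sum_le _ _).trans (le_trans (Finset.sum_le_sum fun y _ => ?_)
      (le_add_of_nonneg_right zero_le_one))
    rw [norm_smul]
    refine mul_le_mul_of_nonneg_right ((abs_memory_le h hu₀ hu₁ hu hs y).trans ?_) (norm_nonneg _)
    exact mul_le_of_le_one_right (by positivity) (Real.exp_le_one_iff.mpr (by nlinarith))

theorem memoryOp_integral_apply (h : IsAdmissible Φ γ) {T : ℝ → ZMod L → ℝ} (hT : Continuous T)
    (t : ℝ) (x : ZMod L) : (∫ s in (0 : ℝ)..t, memoryOp Φ γ L s (T (t - s))) x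
      = ∫ s in (0 : ℝ)..t, ∑ y : ZMod L, memory Φ γ L s y * T (t - s) (x - y) := by
  have := memoryOp_continuous (L := L) h
  have hc : Continuous fun s => memoryOp Φ γ L s (T (t - s)) := by fun_prop
  have e := (ContinuousLinearMap.proj (R := ℝ) (φ := fun _ : ZMod L => ℝ)
    x).intervalIntegral_comp_comm (hc.intervalIntegrable (μ := volume) 0 t)
  simp only [ContinuousLinearMap.proj_apply, memoryOp_apply] at e
  exact e.symm

/-- The renewal equation is a Volterra equation with values in the space of profiles, with a
continuous bounded operator kernel and a continuous bounded source. -/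
theorem exists_profile (h : IsAdmissible Φ γ) (hu₀ : 0 < u₀) (hu₁ : u₁ < γ / 2)
    (hu : ∀ k, uu Φ γ k ∈ Icc u₀ u₁) {μ : Measure (Phase L)} (hμ : HasSecondMoments μ) :
    ∃ T : ℝ → ZMod L → ℝ, Continuous T ∧ IsTemperatureProfile Φ γ L μ T ∧
      ∀ T' : ℝ → ZMod L → ℝ, IsTemperatureProfile Φ γ L μ T' →
        ∀ t ≥ 0, ∀ x : ZMod L, T' t x = T t x := by
  obtain ⟨B, hB, hKB⟩ := memoryOp_bound (L := L) h hu₀ hu₁ hu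
  obtain ⟨K, hK, hsrc⟩ := sum_source_le h hu₀ hu₁ hu
  set S : ℝ := K * (L * energyDensity Φ L μ) with hS
  have hS0 : 0 ≤ S := by have := energyDensity_nonneg h μ; positivity
  have hgc : Continuous fun t => source Φ γ L μ t :=
    continuous_pi fun x => source_continuous h μ x
  have hgB : ∀ s ≥ 0, ‖source Φ γ L μ s‖ ≤ S := by
    intro s hs
    rw [pi_norm_le_iff_of_nonneg hS0]
    intro x
    rw [Real.norm_eq_abs, abs_of_nonneg (source_nonneg hμ s x)]
    refine (Finset.single_le_sum (f := fun x => source Φ γ L μ s x)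
      (fun y _ => source_nonneg hμ s y) (Finset.mem_univ x)).trans ((hsrc L μ hμ s hs).trans ?_)
    exact mul_le_of_le_one_right hS0 (Real.exp_le_one_iff.mpr (by nlinarith))
  obtain ⟨T, hT, hTeq⟩ := exists_volterra (memoryOp_continuous h) hgc (B := B + S) (by positivity)
    (fun s hs => (hKB s hs).trans (by linarith)) (fun s hs => (hgB s hs).trans (by linarith))
  refine ⟨T, hT, ⟨fun x => ((continuous_apply x).comp hT).continuousOn, fun t ht x => ?_⟩,
    fun T' hT' => ?_⟩
  · rw [hTeq t ht, Pi.add_apply, memoryOp_integral_apply h hT]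
  -- A competing solution is continuous only for t ≥ 0; it is extended by its initial value to
  -- negative times before uniqueness is applied.
  · have hc : Continuous fun t => T' (max t 0) := continuous_pi fun x =>
      (hT'.continuousOn x).comp_continuous (by fun_prop) fun t => mem_Ici.mpr (le_max_right _ _)
    have := volterra_unique (memoryOp_continuous h) hB hKB hT hc hTeq (fun t ht => by
      funext x
      rw [Pi.add_apply, memoryOp_integral_apply h hc, max_eq_left ht, hT'.renewal t ht x]
      congr 1
      refine intervalIntegral.integral_congr fun s hs => ?_
      rw [uIcc_of_le ht] at hs
      simp only [max_eq_left (sub_nonneg.mpr hs.2)])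
    intro t ht x
    have := congr_fun (this t ht) x
    rwa [max_eq_left ht] at this

/-- The modes of the profile. -/
def profileMode (T : ℝ → ZMod L → ℝ) (n : ZMod L) (t : ℝ) : ℂ := fhat (fun x => (T t x : ℂ)) n

theorem fhat_continuous {F : ℝ → ZMod L → ℝ} (hF : ∀ x, Continuous fun t => F t x) (n : ZMod L) :
    Continuous fun t => fhat (fun x => (F t x : ℂ)) n := by
  unfold fhat; fun_prop

theorem profileMode_eq (h : IsAdmissible Φ γ) {μ : Measure (Phase L)} {T : ℝ → ZMod L → ℝ}
    (hTc : Continuous T) (hT : IsTemperatureProfile Φ γ L μ T) (n : ZMod L) {t : ℝ} (ht : 0 ≤ t) :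
    profileMode T n t = fhat (fun x => (source Φ γ L μ t x : ℂ)) n
      + ∫ s in (0 : ℝ)..t, (kern Φ γ n s : ℂ) * profileMode T n (t - s) := by
  have hm := memory_continuous (L := L) h
  have e : ∀ s, (kern Φ γ n s : ℂ) * profileMode T n (t - s)
      = fhat (fun x => ((∑ y : ZMod L, memory Φ γ L s y * T (t - s) (x - y) : ℝ) : ℂ)) n := by
    intro s
    rw [← fhat_memory h, profileMode, ← fhat_convolution]
    congr 1
    funext x
    push_cast
    rfl
  simp_rw [e]
  unfold profileMode fhat
  rw [intervalIntegral.integral_finsetSum fun x _ => Continuous.intervalIntegrable (by fun_prop) _ _,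
    ← Finset.sum_add_distrib]
  refine Finset.sum_congr rfl fun x _ => ?_
  rw [intervalIntegral.integral_mul_const, intervalIntegral.integral_ofReal, ← add_mul]
  beta_reduce
  rw [hT.renewal t ht x, Complex.ofReal_add]

/-- Positivity turns the ℓ¹ norm, which dominates every mode, into a plain sum, and the total energy
controls that sum. -/
theorem norm_fhat_source_le {μ : Measure (Phase L)} (hμ : HasSecondMoments μ) (n : ZMod L) (t : ℝ) :
    ‖fhat (fun x => (source Φ γ L μ t x : ℂ)) n‖ ≤ ∑ x, source Φ γ L μ t x := by
  unfold fhat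
  refine (norm_sum_le _ _).trans (Finset.sum_le_sum fun x _ => ?_)
  rw [norm_mul, norm_stdAddChar, mul_one, Complex.norm_real, Real.norm_eq_abs,
    abs_of_nonneg (source_nonneg hμ t x)]

/-- The temperature profile exists, is unique, and its modes diffuse. -/
theorem profile_diffusive (h : IsAdmissible Φ γ) :
    ∃ L₀ : ℕ, ∃ c > 0, ∃ C > 0, ∀ (L : ℕ) [NeZero L], L₀ ≤ L → 0 < kappa Φ γ L ∧
      ∀ (μ : Measure (Phase L)), HasSecondMoments μ →
      ∃ T : ℝ → ZMod L → ℝ, Continuous T ∧ IsTemperatureProfile Φ γ L μ T ∧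
        (∀ T' : ℝ → ZMod L → ℝ, IsTemperatureProfile Φ γ L μ T' →
          ∀ t ≥ 0, ∀ x : ZMod L, T' t x = T t x) ∧
        ∀ n : ZMod L, (∀ t ≥ 0, ‖profileMode T n t‖ ≤ C * (L * energyDensity Φ L μ)) ∧
          ∀ t₀ ≥ 0, ∀ t ≥ 0, ‖profileMode T n (t₀ + t)
              - Real.exp (-(kappa Φ γ L * freqSq n) * t) * profileMode T n t₀‖
            ≤ C * (L * energyDensity Φ L μ)
              * (freqSq n * Real.exp (-(c * freqSq n) * t₀) + Real.exp (-c * t₀)) := by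
  obtain ⟨u₀, u₁, hu₀, h01, hu₁, hu⟩ := h.uu_bounds
  obtain ⟨L₀, c, hc, C, hC, hmodes⟩ := renewal_modes h hu₀ h01 hu₁ hu
  obtain ⟨K, hK, hsrc⟩ := sum_source_le h hu₀ hu₁ hu
  refine ⟨L₀, c, hc, C * K, by positivity, fun L _ hL => ?_⟩
  obtain ⟨hκ, hm⟩ := hmodes L hL
  refine ⟨hκ, fun μ hμ => ?_⟩
  obtain ⟨T, hTc, hT, huniq⟩ := exists_profile h hu₀ hu₁ hu hμ
  refine ⟨T, hTc, hT, huniq, fun n => ?_⟩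
  have hE := energyDensity_nonneg h μ
  have hL := natCast_pos' (L := L)
  obtain ⟨r1, r2⟩ := hm n (profileMode T n) (fun t => fhat (fun x => (source Φ γ L μ t x : ℂ)) n)
    (K * (L * energyDensity Φ L μ))
    (fhat_continuous (fun x => (continuous_apply x).comp hTc) n)
    (fhat_continuous (fun x => source_continuous h μ x) n) (by positivity)
    (fun t ht => (norm_fhat_source_le hμ n t).trans (hsrc L μ hμ t ht))
    (fun t ht => profileMode_eq h hTc hT n ht)
  rw [← mul_assoc] at r1 r2
  exact ⟨r1, r2⟩

end Profile

/-! ### Uniqueness for the heat equation -/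

/-- Were the second derivative positive, the point would also be a local minimum, so f would be
locally constant and its second derivative zero. -/
theorem deriv_deriv_nonpos_of_isLocalMax {f : ℝ → ℝ} {x : ℝ} (h : IsLocalMax f x)
    (hc : ContinuousAt f x) : deriv (deriv f) x ≤ 0 := by
  by_contra! hpos
  have hmin := isLocalMin_of_deriv_deriv_pos hpos h.deriv_eq_zero hc
  have heq : f =ᶠ[nhds x] fun _ => f x := by
    filter_upwards [h, hmin] with y h1 h2
    exact le_antisymm h1 h2
  have h1 : deriv f =ᶠ[nhds x] deriv fun _ => f x := heq.deriv
  have h2 := h1.deriv_eq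
  simp at h2
  linarith

/-- The maximum principle. -/
theorem heat_nonpos {l κ : ℝ} (hl : 0 < l) (hκ : 0 < κ) {v : ℝ → ℝ → ℝ}
    (hper : ∀ t ≥ 0, Function.Periodic (v t) l)
    (hcont : ContinuousOn (fun z : ℝ × ℝ => v z.1 z.2) (Ici 0 ×ˢ univ))
    (hder : ∀ t > 0, ∀ ξ, HasDerivAt (fun s => v s ξ) (κ * deriv (deriv (v t)) ξ) t)
    (h0 : ∀ ξ, v 0 ξ ≤ 0) : ∀ t ≥ 0, ∀ ξ, v t ξ ≤ 0 := by
  have key : ∀ ε > 0, ∀ τ ≥ 0, ∀ ξ, v τ ξ ≤ ε * τ := by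
    intro ε hε τ hτ
    -- Subtracting εt makes the time derivative strictly smaller than κ times the second space
    -- derivative, which excludes a maximum at a positive time.
    set w : ℝ × ℝ → ℝ := fun z => v z.1 z.2 - ε * z.1 with hw
    have hsub : Icc 0 τ ×ˢ Icc 0 l ⊆ Ici (0 : ℝ) ×ˢ (univ : Set ℝ) := fun z hz =>
      ⟨hz.1.1, mem_univ _⟩
    have hwc : ContinuousOn w (Icc 0 τ ×ˢ Icc 0 l) :=
      (hcont.mono hsub).sub (by fun_prop)
    obtain ⟨⟨s, x⟩, ⟨hs, hx⟩, hmax⟩ := (isCompact_Icc.prod isCompact_Icc).exists_isMaxOn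
      ⟨(0, 0), ⟨le_rfl, hτ⟩, ⟨le_rfl, hl.le⟩⟩ hwc
    simp only at hs hx
    -- By periodicity the maximum over one period is a maximum over the whole line, so the end
    -- points of the period cause no boundary terms.
    have hmax' : ∀ r ∈ Icc 0 τ, ∀ y, v r y - ε * r ≤ v s x - ε * s := by
      intro r hr y
      obtain ⟨z, hz, hzy⟩ := (hper r hr.1).exists_mem_Ico₀ hl y
      have := hmax (a := (r, z)) ⟨hr, hz.1, hz.2.le⟩
      rw [hzy]
      exact this
    have hs0 : s = 0 := by
      by_contra hne
      have hspos : 0 < s := lt_of_le_of_ne hs.1 (Ne.symm hne)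
      have hloc : IsLocalMax (v s) x := Filter.Eventually.of_forall fun y => by
        have := hmax' s hs y; linarith
      have hcx : ContinuousAt (v s) x := by
        have h1 : ContinuousOn (fun y : ℝ => v s y) univ :=
          hcont.comp (f := fun y : ℝ => ((s, y) : ℝ × ℝ)) (by fun_prop) fun y _ =>
            ⟨hs.1, mem_univ _⟩
        exact h1.continuousAt Filter.univ_mem
      have h2 := deriv_deriv_nonpos_of_isLocalMax hloc hcx
      have h3 : HasDerivAt (fun r => v r x - ε * r) (κ * deriv (deriv (v s)) x - ε) s := by
        have := (hder s hspos x).fun_sub ((hasDerivAt_id' s).const_mul ε)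
        rwa [mul_one] at this
      have h4 : κ * deriv (deriv (v s)) x - ε < 0 := by
        have := mul_nonneg hκ.le (neg_nonneg.mpr h2)
        linarith
      have h5 := h3.tendsto_slope.eventually (gt_mem_nhds h4)
      -- The maximum may sit at the final time τ, so only earlier times are compared: slopes to the
      -- left of a maximum are nonnegative, while the derivative is negative.
      have h6 : ∀ᶠ r in nhdsWithin s (Iio s), r ∈ Ioo 0 s := Ioo_mem_nhdsLT hspos
      have h7 : nhdsWithin s (Iio s) ≤ nhdsWithin s {s}ᶜ :=
        nhdsWithin_mono _ fun r hr => ne_of_lt hr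
      obtain ⟨r, hr1, hr2⟩ := ((h5.filter_mono h7).and h6).exists
      rw [slope_def_field] at hr1
      have h8 := hmax' r ⟨hr2.1.le, hr2.2.le.trans hs.2⟩ x
      have h9 : 0 ≤ (v r x - ε * r - (v s x - ε * s)) / (r - s) :=
        div_nonneg_of_nonpos (by linarith) (by linarith [hr2.2])
      linarith
    intro ξ
    have := hmax' τ ⟨hτ, le_rfl⟩ ξ
    rw [hs0] at this
    have := h0 x
    linarith
  intro t ht ξ
  by_contra! hpos
  -- With this ε the bound εt is at most half of v t ξ, which is a contradiction.
  have h1 : 0 < v t ξ / (2 * (t + 1)) := by positivity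
  have h2 := key _ h1 t ht ξ
  have h3 : v t ξ / (2 * (t + 1)) * t ≤ v t ξ / 2 := by
    rw [div_mul_eq_mul_div, div_le_div_iff₀ (by positivity) (by norm_num)]
    have := mul_nonneg hpos.le ht
    linarith
  linarith

theorem IsHeatSolution.contDiff_space {l κ : ℝ} {u₀ : ℝ → ℂ} {u : ℝ → ℝ → ℂ}
    (h : IsHeatSolution l κ u₀ u) {t : ℝ} (ht : 0 ≤ t) : ContDiff ℝ 2 (u t) := by
  rw [← contDiffOn_univ]
  exact h.contDiffOn.comp (f := fun y : ℝ => ((t, y) : ℝ × ℝ))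
    (ContDiff.contDiffOn (by fun_prop)) fun y _ => ⟨ht, mem_univ _⟩

theorem IsHeatSolution.hasDerivAt_time {l κ : ℝ} {u₀ : ℝ → ℂ} {u : ℝ → ℝ → ℂ}
    (h : IsHeatSolution l κ u₀ u) {t : ℝ} (ht : 0 < t) (ξ : ℝ) :
    HasDerivAt (fun s => u s ξ) (κ * deriv (deriv (u t)) ξ) t := by
  have h1 : ContDiffOn ℝ 2 (fun s => u s ξ) (Ici 0) :=
    h.contDiffOn.comp (f := fun s : ℝ => ((s, ξ) : ℝ × ℝ))
      (ContDiff.contDiffOn (by fun_prop)) fun s hs => ⟨hs, mem_univ _⟩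
  have h2 : DifferentiableAt ℝ (fun s => u s ξ) t :=
    (h1.differentiableOn (by norm_num) t ht.le).differentiableAt (Ici_mem_nhds ht)
  have h3 := h.heat t ht.le ξ
  rw [derivWithin_of_mem_nhds (Ici_mem_nhds ht), iteratedDeriv_succ, iteratedDeriv_one] at h3
  rw [← h3]
  exact h2.hasDerivAt

theorem deriv_clm_comp {g : ℝ → ℂ} (hg : Differentiable ℝ g) (Λ : ℂ →L[ℝ] ℝ) :
    deriv (fun x => Λ (g x)) = fun x => Λ (deriv g x) := by
  funext x
  exact (Λ.hasFDerivAt.comp_hasDerivAt x (hg x).hasDerivAt).deriv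

/-- The difference of two solutions is complex valued; the maximum principle is applied to its image
under ± Re and ± Im. -/
theorem IsHeatSolution.unique {l κ : ℝ} (hl : 0 < l) (hκ : 0 < κ) {u₀ : ℝ → ℂ} {u w : ℝ → ℝ → ℂ}
    (hu : IsHeatSolution l κ u₀ u) (hw : IsHeatSolution l κ u₀ w) :
    ∀ t ≥ 0, ∀ ξ, u t ξ = w t ξ := by
  have key : ∀ Λ : ℂ →L[ℝ] ℝ, ∀ t ≥ 0, ∀ ξ, Λ (u t ξ - w t ξ) ≤ 0 := by
    intro Λ
    refine heat_nonpos hl hκ (v := fun t ξ => Λ (u t ξ - w t ξ)) (fun t ht ξ => ?_) ?_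
      (fun t ht ξ => ?_) fun ξ => ?_
    · simp only [hu.periodic t ht ξ, hw.periodic t ht ξ]
    · exact Λ.continuous.comp_continuousOn (hu.contDiffOn.continuousOn.sub
        hw.contDiffOn.continuousOn)
    · have cu := hu.contDiff_space ht.le
      have cw := hw.contDiff_space ht.le
      have du : Differentiable ℝ (u t) := cu.differentiable (by norm_num)
      have dw : Differentiable ℝ (w t) := cw.differentiable (by norm_num)
      have du' : Differentiable ℝ (deriv (u t)) :=
        (cu.iterate_deriv' 1 1).differentiable (by norm_num)
      have dw' : Differentiable ℝ (deriv (w t)) :=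
        (cw.iterate_deriv' 1 1).differentiable (by norm_num)
      have e1 : deriv (fun ξ => u t ξ - w t ξ) = fun ξ => deriv (u t) ξ - deriv (w t) ξ :=
        funext fun ξ => deriv_fun_sub (du ξ) (dw ξ)
      have e : deriv (deriv fun ξ => Λ (u t ξ - w t ξ)) ξ
          = Λ (deriv (deriv (u t)) ξ - deriv (deriv (w t)) ξ) := by
        rw [deriv_clm_comp (du.fun_sub dw), e1, deriv_clm_comp (du'.fun_sub dw')]
        beta_reduce
        rw [deriv_fun_sub (du' ξ) (dw' ξ)]
      have h1 := Λ.hasFDerivAt.comp_hasDerivAt t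
        ((hu.hasDerivAt_time ht ξ).sub (hw.hasDerivAt_time ht ξ))
      refine h1.congr_deriv ?_
      rw [e, ← mul_sub, ← Complex.real_smul, map_smul, smul_eq_mul]
    · simp [hu.initial, hw.initial]
  intro t ht ξ
  rw [← sub_eq_zero]
  refine Complex.ext ?_ ?_
  · refine le_antisymm (key Complex.reCLM t ht ξ) ?_
    have := key (-Complex.reCLM) t ht ξ
    simpa using this
  · refine le_antisymm (key Complex.imCLM t ht ξ) ?_
    have := key (-Complex.imCLM) t ht ξ
    simpa using this

/-! ### Existence for the heat equation -/

theorem iteratedDeriv_exp_neg' (k : ℕ) :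
    iteratedDeriv k (fun s : ℝ => Real.exp (-s)) = fun s => (-1) ^ k * Real.exp (-s) := by
  induction k with
  | zero => simp
  | succ k ih =>
    rw [iteratedDeriv_succ, ih]
    funext s
    have : HasDerivAt (fun s => (-1) ^ k * Real.exp (-s)) ((-1) ^ k * (Real.exp (-s) * (-1))) s :=
      ((hasDerivAt_id' s).fun_neg.exp).const_mul _
    rw [this.deriv]; ring

theorem hasDerivAt_cexp_mul_I (w x : ℝ) : HasDerivAt (fun x : ℝ => Complex.exp ((w * x : ℝ) * Complex.I))
    (w * Complex.I * Complex.exp ((w * x : ℝ) * Complex.I)) x := by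
  have h := (((hasDerivAt_id' x).const_mul w).ofReal_comp.mul_const Complex.I).cexp
  refine h.congr_deriv ?_
  push_cast; ring

theorem norm_iteratedDeriv_cexp_mul_I (k : ℕ) (x : ℝ) :
    ‖iteratedDeriv k (fun x : ℝ => Complex.exp (x * Complex.I)) x‖ = 1 := by
  have : iteratedDeriv k (fun x : ℝ => Complex.exp (x * Complex.I))
      = fun x : ℝ => Complex.I ^ k * Complex.exp (x * Complex.I) := by
    induction k with
    | zero => simp
    | succ k ih =>
      rw [iteratedDeriv_succ, ih]
      funext x
      have h := (hasDerivAt_cexp_mul_I 1 x).const_mul (Complex.I ^ k)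
      simp only [one_mul, Complex.ofReal_one] at h
      rw [h.deriv]; ring
  rw [this, norm_mul, norm_pow, Complex.norm_I, one_pow, one_mul, Complex.norm_exp_ofReal_mul_I]

/-- A smooth extension of `exp (-s)` from the half line with bounded derivatives. -/
theorem exists_exp_extension : ∃ E : ℝ → ℝ, ContDiff ℝ 2 E ∧ (∀ s ≥ 0, E s = Real.exp (-s)) ∧
    ∃ M > 0, ∀ k ≤ 2, ∀ s, |iteratedDeriv k E s| ≤ M := by
  -- The exponential grows at negative s. A smooth step, equal to 1 for s ≥ 0 and to 0 for s ≤ -1,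
  -- keeps the derivatives bounded and leaves s ≥ 0 unchanged.
  set E : ℝ → ℝ := fun s => Real.exp (-s) * Real.smoothTransition (s + 1) with hE
  have hc : ContDiff ℝ 2 E := by
    have h1 : ContDiff ℝ 2 Real.smoothTransition := Real.smoothTransition.contDiff (n := 2)
    rw [hE]
    exact (contDiff_neg.exp).mul (h1.comp (contDiff_id.add contDiff_const))
  have hpos : ∀ s ≥ 0, E s = Real.exp (-s) := fun s hs => by
    simp only [hE]
    rw [Real.smoothTransition.one_of_one_le (by linarith), mul_one]
  refine ⟨E, hc, hpos, ?_⟩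
  have hbound : ∀ k : ℕ, k ≤ 2 → ∃ M > 0, ∀ s, |iteratedDeriv k E s| ≤ M := by
    intro k hk
    have hcont : Continuous (iteratedDeriv k E) := hc.continuous_iteratedDeriv k (by exact_mod_cast hk)
    obtain ⟨M, hM⟩ := isCompact_Icc.exists_bound_of_continuousOn (s := Icc (-1 : ℝ) 0)
      hcont.continuousOn
    refine ⟨max M 1, by positivity, fun s => ?_⟩
    rcases lt_or_ge 0 s with h | h
    · have e : E =ᶠ[nhds s] fun s => Real.exp (-s) := by
        filter_upwards [Ioi_mem_nhds h] with r hr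
        exact hpos r (le_of_lt hr)
      rw [e.iteratedDeriv_eq, iteratedDeriv_exp_neg', abs_mul, abs_pow, abs_neg, abs_one, one_pow,
        one_mul, Real.abs_exp]
      exact (Real.exp_le_one_iff.mpr (by linarith)).trans (le_max_right _ _)
    · rcases lt_or_ge s (-1) with h' | h'
      · have e : E =ᶠ[nhds s] fun _ => 0 := by
          filter_upwards [Iio_mem_nhds h'] with r hr
          simp only [hE]
          rw [Real.smoothTransition.zero_of_nonpos (by linarith [mem_Iio.mp hr]), mul_zero]
        rw [e.iteratedDeriv_eq, iteratedDeriv_fun_const_zero]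
        simp
      · exact (hM s ⟨h', h⟩).trans (le_max_left _ _)
  obtain ⟨M₀, h00, h0⟩ := hbound 0 (by norm_num)
  obtain ⟨M₁, h10, h1⟩ := hbound 1 (by norm_num)
  obtain ⟨M₂, h20, h2⟩ := hbound 2 le_rfl
  refine ⟨max M₀ (max M₁ M₂), by positivity, fun k hk s => ?_⟩
  interval_cases k
  · exact (h0 s).trans (le_max_left _ _)
  · exact (h1 s).trans ((le_max_left _ _).trans (le_max_right _ _))
  · exact (h2 s).trans ((le_max_right _ _).trans (le_max_right _ _))

/-- Each factor of a plane wave is a function of one linear coordinate, and every derivative costs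
one norm of that coordinate. -/
theorem norm_iteratedFDeriv_comp_clm_le {f : ℝ → ℂ} (hf : ContDiff ℝ 2 f) (l : ℝ × ℝ →L[ℝ] ℝ)
    {k : ℕ} (hk : k ≤ 2) {M : ℝ} (hM : ∀ s, ‖iteratedDeriv k f s‖ ≤ M) {r : ℝ} (hr : ‖l‖ ≤ r)
    (z : ℝ × ℝ) : ‖iteratedFDeriv ℝ k (fun z => f (l z)) z‖ ≤ M * r ^ k := by
  have hk' : (k : WithTop ℕ∞) ≤ 2 := by exact_mod_cast hk
  have h := l.iteratedFDeriv_comp_right hf z hk'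
  change ‖iteratedFDeriv ℝ k (f ∘ l) z‖ ≤ _
  rw [h]
  refine (ContinuousMultilinearMap.norm_compContinuousLinearMap_le _ _).trans ?_
  rw [Finset.prod_const, Finset.card_univ, Fintype.card_fin,
    norm_iteratedFDeriv_eq_norm_iteratedDeriv]
  exact mul_le_mul (hM _) (pow_le_pow_left₀ (norm_nonneg _) hr k) (by positivity)
    ((norm_nonneg _).trans (hM 0))

set_option maxHeartbeats 400000 in
/-- A superposition of decaying plane waves solves the heat equation. -/
theorem exists_heatSolution {l κ : ℝ} (hl : 0 < l) (hκ : 0 < κ) {w : ℤ → ℝ}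
    (hw : ∀ j, w j = 2 * Real.pi * j / l) {a : ℤ → ℂ}
    (ha : Summable fun j => ‖a j‖ * (1 + κ * w j ^ 2 + |w j|) ^ 2) :
    ∃ u : ℝ → ℝ → ℂ,
      IsHeatSolution l κ (fun ξ => ∑' j, a j * Complex.exp ((w j * ξ : ℝ) * Complex.I)) u ∧
      ∀ t ≥ 0, ∀ ξ, u t ξ = ∑' j, Real.exp (-(κ * w j ^ 2) * t)
        * (a j * Complex.exp ((w j * ξ : ℝ) * Complex.I)) := by
  obtain ⟨E, hE, hpos, M, hM, hb⟩ := exists_exp_extension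
  -- The weight r_j is at least 1 and dominates both κw² and |w|, so up to two derivatives of the
  -- j-th term cost at most r_j².
  set r : ℤ → ℝ := fun j => 1 + κ * w j ^ 2 + |w j| with hr
  have hr1 : ∀ j, 1 ≤ r j := fun j => by
    have : 0 ≤ κ * w j ^ 2 := by positivity
    have := abs_nonneg (w j)
    simp only [hr]; linarith
  have hr2 : ∀ j, κ * w j ^ 2 ≤ r j := fun j => by
    have := abs_nonneg (w j)
    simp only [hr]; linarith
  have hr3 : ∀ j, |w j| ≤ r j := fun j => by
    have : 0 ≤ κ * w j ^ 2 := by positivity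
    simp only [hr]; linarith
  have hrr : ∀ j, r j ≤ r j ^ 2 := fun j => by
    have := mul_le_mul_of_nonneg_left (hr1 j) (zero_le_one.trans (hr1 j))
    rw [mul_one] at this; rw [sq]; exact this
  have hcE : ContDiff ℝ 2 fun s => (E s : ℂ) := Complex.ofRealCLM.contDiff.comp hE
  have hEb : ∀ k ≤ 2, ∀ s, ‖iteratedDeriv k (fun s => (E s : ℂ)) s‖ ≤ M := by
    intro k hk s
    have h1 := Complex.ofRealLI.norm_iteratedFDeriv_comp_left (f := E) (x := s) (i := k)
      (n := 2) hE.contDiffAt (by exact_mod_cast hk)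
    rw [norm_iteratedFDeriv_eq_norm_iteratedDeriv, norm_iteratedFDeriv_eq_norm_iteratedDeriv] at h1
    refine (le_of_eq h1).trans (hb k hk s)
  have hEM : ∀ s, |E s| ≤ M := fun s => by simpa using hb 0 (by norm_num) s
  have hE'M : ∀ s, |deriv E s| ≤ M := fun s => by simpa using hb 1 (by norm_num) s
  have hnb : ∀ j (t ξ : ℝ), ‖(E t : ℂ) * (a j * Complex.exp ((w j * ξ : ℝ) * Complex.I))‖
      ≤ M * ‖a j‖ := by
    intro j t ξ
    rw [norm_mul, norm_mul, Complex.norm_exp_ofReal_mul_I, mul_one, Complex.norm_real]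
    exact mul_le_mul_of_nonneg_right (hEM t) (norm_nonneg _)
  have sM : Summable fun j => M * (‖a j‖ * r j ^ 2) := ha.mul_left M
  have hle : ∀ j, M * ‖a j‖ ≤ M * (‖a j‖ * r j ^ 2) := fun j => by
    refine mul_le_mul_of_nonneg_left ?_ hM.le
    exact le_mul_of_one_le_right (norm_nonneg _) ((hr1 j).trans (hrr j))
  -- Using E in place of the exponential gives a series converging in C² on the whole plane; it
  -- agrees with the heat flow for t ≥ 0 because κw²t ≥ 0 there.
  set u : ℝ → ℝ → ℂ := fun t ξ => ∑' j, (E (κ * w j ^ 2 * t) : ℂ)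
    * (a j * Complex.exp ((w j * ξ : ℝ) * Complex.I)) with hu
  have hdu : ∀ t ≥ 0, ∀ ξ, u t ξ = ∑' j, Real.exp (-(κ * w j ^ 2) * t)
        * (a j * Complex.exp ((w j * ξ : ℝ) * Complex.I)) := by
    intro t ht ξ
    simp only [hu]
    refine tsum_congr fun j => ?_
    rw [hpos _ (by positivity), neg_mul]
  -- At s = 0 the two sided derivative of E is identified with its right derivative, where E is the
  -- exponential.
  have hE' : ∀ s ≥ 0, deriv E s = -E s := by
    intro s hs
    have h1 := ((hE.differentiable (by norm_num)) s).hasDerivAt.hasDerivWithinAt (s := Ici 0)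
    have h2 : HasDerivAt (fun s : ℝ => Real.exp (-s)) (Real.exp (-s) * (-1)) s :=
      (hasDerivAt_id' s).fun_neg.exp
    have h3 : HasDerivWithinAt E (Real.exp (-s) * (-1)) (Ici 0) s :=
      h2.hasDerivWithinAt.congr (fun x hx => hpos x hx) (hpos s hs)
    rw [(uniqueDiffOn_Ici (0 : ℝ) s hs).eq_deriv _ h1 h3, hpos s hs]
    ring
  have hsum : ∀ t ξ, Summable fun j => (E (κ * w j ^ 2 * t) : ℂ)
      * (a j * Complex.exp ((w j * ξ : ℝ) * Complex.I)) := fun t ξ =>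
    Summable.of_norm_bounded sM fun j => (hnb j _ ξ).trans (hle j)
  have hdt : ∀ t ξ, HasDerivAt (fun t => u t ξ) (∑' j, (((κ * w j ^ 2) * deriv E (κ * w j ^ 2 * t) : ℝ) : ℂ)
      * (a j * Complex.exp ((w j * ξ : ℝ) * Complex.I))) t := by
    intro t ξ
    refine hasDerivAt_tsum (g := fun j t => (E (κ * w j ^ 2 * t) : ℂ)
        * (a j * Complex.exp ((w j * ξ : ℝ) * Complex.I)))
      (g' := fun j t => (((κ * w j ^ 2) * deriv E (κ * w j ^ 2 * t) : ℝ) : ℂ)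
        * (a j * Complex.exp ((w j * ξ : ℝ) * Complex.I)))
      (y₀ := 0) sM (fun j t => ?_) (fun j t => ?_) (hsum 0 ξ) t
    · have h1 := ((hE.differentiable (by norm_num)) (κ * w j ^ 2 * t)).hasDerivAt
      have h2 := (h1.comp t ((hasDerivAt_id' t).const_mul (κ * w j ^ 2))).ofReal_comp.mul_const
        (a j * Complex.exp ((w j * ξ : ℝ) * Complex.I))
      refine h2.congr_deriv ?_
      rw [mul_one, mul_comm (deriv E _)]
    · rw [norm_mul, norm_mul, Complex.norm_exp_ofReal_mul_I, mul_one, Complex.norm_real,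
        Real.norm_eq_abs, abs_mul, abs_of_nonneg (by positivity : 0 ≤ κ * w j ^ 2)]
      calc _ ≤ r j ^ 2 * M * ‖a j‖ := by
            refine mul_le_mul_of_nonneg_right (mul_le_mul ((hr2 j).trans (hrr j)) (hE'M _)
              (abs_nonneg _) (by positivity)) (norm_nonneg _)
        _ = _ := by ring
  have hdx : ∀ t ξ, HasDerivAt (u t) (∑' j, (E (κ * w j ^ 2 * t) : ℂ)
      * (a j * (w j * Complex.I * Complex.exp ((w j * ξ : ℝ) * Complex.I)))) ξ := by
    intro t ξ
    refine hasDerivAt_tsum (g := fun j ξ => (E (κ * w j ^ 2 * t) : ℂ)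
        * (a j * Complex.exp ((w j * ξ : ℝ) * Complex.I)))
      (g' := fun j ξ => (E (κ * w j ^ 2 * t) : ℂ)
        * (a j * (w j * Complex.I * Complex.exp ((w j * ξ : ℝ) * Complex.I))))
      (y₀ := 0) sM (fun j ξ => ?_) (fun j ξ => ?_) (hsum t 0) ξ
    · exact ((hasDerivAt_cexp_mul_I (w j) ξ).const_mul (a j)).const_mul _
    · rw [norm_mul, norm_mul, norm_mul, norm_mul, Complex.norm_exp_ofReal_mul_I, Complex.norm_I,
        mul_one, mul_one, Complex.norm_real, Complex.norm_real, Real.norm_eq_abs, Real.norm_eq_abs]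
      refine mul_le_mul (hEM _) (mul_le_mul_of_nonneg_left ((hr3 j).trans (hrr j))
        (norm_nonneg _)) (by positivity) hM.le
  have hdxx : ∀ t ξ, HasDerivAt (fun ξ => ∑' j, (E (κ * w j ^ 2 * t) : ℂ)
      * (a j * (w j * Complex.I * Complex.exp ((w j * ξ : ℝ) * Complex.I))))
      (∑' j, (E (κ * w j ^ 2 * t) : ℂ) * (a j * (w j * Complex.I * (w j * Complex.I
        * Complex.exp ((w j * ξ : ℝ) * Complex.I))))) ξ := by
    intro t ξ
    refine hasDerivAt_tsum (g := fun j ξ => (E (κ * w j ^ 2 * t) : ℂ)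
        * (a j * (w j * Complex.I * Complex.exp ((w j * ξ : ℝ) * Complex.I))))
      (g' := fun j ξ => (E (κ * w j ^ 2 * t) : ℂ) * (a j * (w j * Complex.I * (w j * Complex.I
        * Complex.exp ((w j * ξ : ℝ) * Complex.I)))))
      (y₀ := 0) sM (fun j ξ => ?_) (fun j ξ => ?_) ?_ ξ
    · exact (((hasDerivAt_cexp_mul_I (w j) ξ).const_mul _).const_mul (a j)).const_mul _
    · rw [norm_mul, norm_mul, norm_mul, norm_mul, norm_mul, norm_mul,
        Complex.norm_exp_ofReal_mul_I, Complex.norm_I,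
        mul_one, mul_one, Complex.norm_real, Complex.norm_real, Real.norm_eq_abs, Real.norm_eq_abs]
      refine mul_le_mul (hEM _) (mul_le_mul_of_nonneg_left ?_
        (norm_nonneg _)) (by positivity) hM.le
      rw [sq]
      exact mul_le_mul (hr3 j) (hr3 j) (abs_nonneg _) (zero_le_one.trans (hr1 j))
    · refine Summable.of_norm_bounded sM fun j => ?_
      rw [norm_mul, norm_mul, norm_mul, norm_mul, Complex.norm_exp_ofReal_mul_I, Complex.norm_I,
        mul_one, mul_one, Complex.norm_real, Complex.norm_real, Real.norm_eq_abs, Real.norm_eq_abs]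
      refine mul_le_mul (hEM _) (mul_le_mul_of_nonneg_left ((hr3 j).trans (hrr j))
        (norm_nonneg _)) (by positivity) hM.le
  refine ⟨u, ⟨fun t _ ξ => ?_, ?_, fun t ht ξ => ?_, fun ξ => ?_⟩, hdu⟩
  · simp only [hu]
    refine tsum_congr fun j => ?_
    congr 2
    have e : ((w j * (ξ + l) : ℝ) : ℂ) * Complex.I
        = (w j * ξ : ℝ) * Complex.I + j * (2 * Real.pi * Complex.I) := by
      have : w j * (ξ + l) = w j * ξ + j * (2 * Real.pi) := by
        rw [hw]; field_simp
      rw [this]; push_cast; ring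
    rw [e, Complex.exp_add, Complex.exp_int_mul_two_pi_mul_I, mul_one]
  · refine ContDiff.contDiffOn ?_
    have hce : ContDiff ℝ 2 fun x : ℝ => Complex.exp (x * Complex.I) := by
      have : ContDiff ℝ 2 fun x : ℝ => (x : ℂ) := Complex.ofRealCLM.contDiff
      exact (this.mul contDiff_const).cexp
    have hl1 : ∀ j, ‖(κ * w j ^ 2) • ContinuousLinearMap.fst ℝ ℝ ℝ‖ ≤ κ * w j ^ 2 := fun j => by
      rw [norm_smul, Real.norm_eq_abs, abs_of_nonneg (by positivity)]
      exact mul_le_of_le_one_right (by positivity) (ContinuousLinearMap.norm_fst_le ..)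
    have hl2 : ∀ j, ‖w j • ContinuousLinearMap.snd ℝ ℝ ℝ‖ ≤ |w j| := fun j => by
      rw [norm_smul, Real.norm_eq_abs]
      exact mul_le_of_le_one_right (by positivity) (ContinuousLinearMap.norm_snd_le ..)
    have c1 : ∀ j, ContDiff ℝ 2 fun z : ℝ × ℝ =>
        (E (((κ * w j ^ 2) • ContinuousLinearMap.fst ℝ ℝ ℝ) z) : ℂ) := fun j =>
      hcE.comp (ContinuousLinearMap.contDiff _)
    have c2 : ∀ j, ContDiff ℝ 2 fun z : ℝ × ℝ =>
        Complex.exp ((((w j • ContinuousLinearMap.snd ℝ ℝ ℝ) z : ℝ) : ℂ) * Complex.I) := fun j =>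
      hce.comp (ContinuousLinearMap.contDiff _)
    have e : (fun z : ℝ × ℝ => u z.1 z.2) = fun z => ∑' j, a j •
        ((E (((κ * w j ^ 2) • ContinuousLinearMap.fst ℝ ℝ ℝ) z) : ℂ)
        * Complex.exp ((((w j • ContinuousLinearMap.snd ℝ ℝ ℝ) z : ℝ) : ℂ) * Complex.I)) := by
      funext z
      simp only [hu]
      refine tsum_congr fun j => ?_
      simp only [_root_.smul_apply, ContinuousLinearMap.coe_fst',
        ContinuousLinearMap.coe_snd', smul_eq_mul]
      ring
    rw [e]
    -- By the Leibniz rule and the binomial formula the k-th derivative of the j-th wave is at most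
    -- M(κw² + |w|)^k ≤ Mr_j².
    refine contDiff_tsum (N := 2) (v := fun _ j => M * (‖a j‖ * r j ^ 2))
      (fun j => ((c1 j).mul (c2 j)).const_smul (a j)) (fun k _ => sM) fun k j z hk => ?_
    have hk2 : k ≤ 2 := by exact_mod_cast hk
    have hk' : (k : WithTop ℕ∞) ≤ 2 := by exact_mod_cast hk2
    rw [iteratedFDeriv_const_smul_apply' (((c1 j).mul (c2 j)).of_le hk').contDiffAt, norm_smul]
    have h1 := norm_iteratedFDeriv_mul_le (c1 j) (c2 j) z hk'
    have h2 : ∀ i ∈ Finset.range (k + 1), (k.choose i : ℝ)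
        * ‖iteratedFDeriv ℝ i (fun z : ℝ × ℝ =>
          (E (((κ * w j ^ 2) • ContinuousLinearMap.fst ℝ ℝ ℝ) z) : ℂ)) z‖
        * ‖iteratedFDeriv ℝ (k - i) (fun z : ℝ × ℝ =>
          Complex.exp ((((w j • ContinuousLinearMap.snd ℝ ℝ ℝ) z : ℝ) : ℂ) * Complex.I)) z‖
        ≤ M * ((κ * w j ^ 2) ^ i * |w j| ^ (k - i) * (k.choose i : ℝ)) := by
      intro i hi
      have hik : i ≤ k := Nat.lt_succ_iff.mp (Finset.mem_range.mp hi)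
      have b1 := norm_iteratedFDeriv_comp_clm_le hcE ((κ * w j ^ 2) • ContinuousLinearMap.fst ℝ ℝ ℝ)
        (hik.trans hk2) (hEb i (hik.trans hk2)) (hl1 j) z
      have b2 := norm_iteratedFDeriv_comp_clm_le hce (w j • ContinuousLinearMap.snd ℝ ℝ ℝ)
        ((Nat.sub_le k i).trans hk2) (fun s => (norm_iteratedDeriv_cexp_mul_I (k - i) s).le)
        (hl2 j) z
      rw [one_mul] at b2
      calc _ ≤ (k.choose i : ℝ) * (M * (κ * w j ^ 2) ^ i) * |w j| ^ (k - i) :=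
            mul_le_mul (mul_le_mul_of_nonneg_left b1 (by positivity)) b2 (norm_nonneg _)
              (by positivity)
        _ = _ := by ring
    have h3 := h1.trans (Finset.sum_le_sum h2)
    rw [← Finset.mul_sum, ← add_pow] at h3
    have h4 : (κ * w j ^ 2 + |w j|) ^ k ≤ r j ^ 2 := by
      calc _ ≤ r j ^ k := pow_le_pow_left₀ (by positivity) (by simp only [hr]; linarith) k
        _ ≤ _ := pow_le_pow_right₀ (hr1 j) hk2
    calc _ ≤ ‖a j‖ * (M * (κ * w j ^ 2 + |w j|) ^ k) :=
          mul_le_mul_of_nonneg_left h3 (norm_nonneg _)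
      _ ≤ ‖a j‖ * (M * r j ^ 2) :=
          mul_le_mul_of_nonneg_left (mul_le_mul_of_nonneg_left h4 hM.le) (norm_nonneg _)
      _ = _ := by ring
  · rw [(hdt t ξ).hasDerivWithinAt.derivWithin (uniqueDiffOn_Ici (0 : ℝ) t ht),
      iteratedDeriv_succ, iteratedDeriv_one]
    have e1 : deriv (u t) = fun ξ => ∑' j, (E (κ * w j ^ 2 * t) : ℂ)
        * (a j * (w j * Complex.I * Complex.exp ((w j * ξ : ℝ) * Complex.I))) :=
      funext fun ξ => (hdx t ξ).deriv
    rw [e1, (hdxx t ξ).deriv, ← tsum_mul_left]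
    refine tsum_congr fun j => ?_
    rw [hE' _ (by positivity)]
    push_cast
    linear_combination (-(κ : ℂ) * E (κ * w j ^ 2 * t) * a j * (w j : ℂ) ^ 2
      * Complex.exp (w j * ξ * Complex.I)) * Complex.I_sq
  · rw [hdu 0 le_rfl]
    refine tsum_congr fun j => ?_
    simp

/-! ### Poisson summation -/

/-- Schwartz decay of order k + 2 leaves a summable 1/n² away from n = 0. -/
theorem summable_pow_mul_norm (ψ : 𝓢(ℝ, ℂ)) (k : ℕ) :
    Summable fun n : ℤ => |(n : ℝ)| ^ k * ‖ψ n‖ := by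
  obtain ⟨C, hC, hd⟩ := ψ.decay (k + 2) 0
  have h1 : Summable fun n : ℤ => C * (1 / (n : ℝ) ^ 2) :=
    (Real.summable_one_div_int_pow.mpr one_lt_two).mul_left C
  refine Summable.of_norm_bounded_eventually h1 ?_
  have h2 : ∀ᶠ n : ℤ in Filter.cofinite, n ≠ 0 := (Set.finite_singleton 0).compl_mem_cofinite
  filter_upwards [h2] with n hn
  have hn' : (0 : ℝ) < (n : ℝ) ^ 2 := by positivity
  have h3 := hd n
  rw [norm_iteratedFDeriv_zero, Real.norm_eq_abs, pow_add, sq_abs] at h3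
  rw [Real.norm_eq_abs, abs_of_nonneg (by positivity), mul_one_div, le_div_iff₀ hn']
  linarith

theorem summable_schwartz_sub (φ : 𝓢(ℝ, ℂ)) (ξ : ℝ) : Summable fun y : ℤ => ‖φ (ξ - y)‖ := by
  have hg : Function.HasTemperateGrowth fun x : ℝ => ξ - x := by fun_prop
  have ha : AntilipschitzWith 1 fun x : ℝ => ξ - x :=
    (isometry_iff_dist_eq.mpr fun x y => by
      rw [Real.dist_eq, Real.dist_eq, sub_sub_sub_cancel_left, abs_sub_comm]).antilipschitz
  have := summable_pow_mul_norm (SchwartzMap.compCLMOfAntilipschitz ℝ hg ha φ) 0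
  simpa using this

section Poisson

variable {L : ℕ} [NeZero L]

/-- Rescaling of a Schwartz function. -/
def rescale (L : ℕ) [NeZero L] (φ : 𝓢(ℝ, ℂ)) : 𝓢(ℝ, ℂ) :=
  SchwartzMap.compCLMOfContinuousLinearEquiv ℝ
    (ContinuousLinearEquiv.unitsEquivAut ℝ (Units.mk0 (L : ℝ) natCast_pos'.ne')) φ

theorem rescale_apply (φ : 𝓢(ℝ, ℂ)) (x : ℝ) : rescale L φ x = φ (x * L) := rfl

theorem fourier_rescale (φ : 𝓢(ℝ, ℂ)) (p : ℝ) :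
    𝓕 (rescale L φ) p = 1 / (L : ℂ) * 𝓕 (φ : ℝ → ℂ) (p / L) := by
  have hL := natCast_pos' (L := L)
  rw [SchwartzMap.fourier_coe, Real.fourier_real_eq_integral_exp_smul,
    Real.fourier_real_eq_integral_exp_smul]
  have h := Measure.integral_comp_mul_right
    (fun v : ℝ => Complex.exp ((-2 * Real.pi * v * (p / L) : ℝ) * Complex.I) • φ v) (L : ℝ)
  rw [abs_of_pos (by positivity), Complex.real_smul] at h
  have e : (1 / (L : ℂ)) = (((L : ℝ)⁻¹ : ℝ) : ℂ) := by push_cast; rw [one_div]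
  rw [e, ← h]
  refine integral_congr_ae (Filter.Eventually.of_forall fun x => ?_)
  simp only [rescale_apply]
  congr 4
  field_simp

theorem summable_pow_mul_fourier (φ : 𝓢(ℝ, ℂ)) (k : ℕ) :
    Summable fun j : ℤ => |(j : ℝ)| ^ k * ‖𝓕 (φ : ℝ → ℂ) (j / L)‖ := by
  have hL := natCast_pos' (L := L)
  have h := (summable_pow_mul_norm (𝓕 (rescale L φ)) k).mul_left (L : ℝ)
  refine h.congr fun j => ?_
  rw [fourier_rescale, norm_mul, norm_div, norm_one, Complex.norm_natCast]
  field_simp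

/-- This is Poisson summation over the integers for x ↦ φ(Lx), evaluated at z/L. -/
theorem tsum_periodize (φ : 𝓢(ℝ, ℂ)) (z : ℝ) : ∑' q : ℤ, φ (z - q * L)
    = 1 / (L : ℂ) * ∑' j : ℤ, 𝓕 (φ : ℝ → ℂ) (j / L)
      * Complex.exp ((2 * Real.pi * j / L * z : ℝ) * Complex.I) := by
  have hL := natCast_pos' (L := L)
  have h := SchwartzMap.tsum_eq_tsum_fourier (rescale L φ) (z / L)
  rw [← tsum_mul_left]
  calc _ = ∑' q : ℤ, φ (z - (Equiv.neg ℤ q : ℤ) * L) :=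
        ((Equiv.neg ℤ).tsum_eq (fun q : ℤ => φ (z - q * L))).symm
    _ = ∑' q : ℤ, rescale L φ (z / L + q) := by
        refine tsum_congr fun q => ?_
        rw [rescale_apply]
        congr 1
        simp only [Equiv.neg_apply, Int.cast_neg]
        field_simp
        ring
    _ = _ := by
        rw [h]
        refine tsum_congr fun j => ?_
        rw [fourier_rescale, fourier_coe_apply, mul_assoc]
        congr 3
        push_cast
        field_simp

theorem tsum_residue {f : ℤ → ℂ} (hf : Summable f) :
    ∑' y, f y = ∑ r ∈ Finset.range L, ∑' q : ℤ, f (q * L + r) := by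
  set e : Fin L × ℤ ≃ ℤ := (Equiv.prodComm _ _).trans (Int.divModEquiv L).symm with he
  have hs : Summable fun c : Fin L × ℤ => f (e c) := e.summable_iff.mpr hf
  rw [← e.tsum_eq, hs.tsum_prod, tsum_fintype, Finset.sum_range]
  rfl

/-- Translation by r becomes the phase exp(-2πi jr/L), which is a character of `ZMod L` in j.
Summation over r with periodic weights therefore produces the discrete transform of the weights. -/
theorem tsum_class (φ : 𝓢(ℝ, ℂ)) (ξ : ℝ) (r : ℕ) : ∑' q : ℤ, φ (ξ - ((q * L + r : ℤ) : ℝ))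
    = 1 / (L : ℂ) * ∑' j : ℤ, 𝓕 (φ : ℝ → ℂ) (j / L) * ZMod.stdAddChar (-((j : ZMod L) * (r : ZMod L)))
      * Complex.exp ((2 * Real.pi * j / L * ξ : ℝ) * Complex.I) := by
  have hL := natCast_pos' (L := L)
  have e1 : ∀ q : ℤ, φ (ξ - ((q * L + r : ℤ) : ℝ)) = φ (ξ - r - q * L) := by
    intro q
    congr 1
    push_cast
    ring
  simp_rw [e1]
  rw [tsum_periodize]
  congr 1
  refine tsum_congr fun j => ?_
  have e2 : (ZMod.stdAddChar (-((j : ZMod L) * (r : ZMod L))) : ℂ)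
      = Complex.exp (2 * Real.pi * Complex.I * (-(j * r) : ℤ) / L) := by
    rw [← ZMod.stdAddChar_coe]; push_cast; rfl
  rw [e2, mul_assoc (𝓕 (φ : ℝ → ℂ) (j / L)), ← Complex.exp_add]
  congr 2
  push_cast
  field_simp
  ring

/-- Poisson summation for a Schwartz function against a periodic sequence. -/
theorem tsum_mul_periodic (φ : 𝓢(ℝ, ℂ)) (F : ZMod L → ℂ) (ξ : ℝ) :
    ∑' y : ℤ, φ (ξ - y) * F (y : ZMod L) = 1 / (L : ℂ) * ∑' j : ℤ,
      (𝓕 (φ : ℝ → ℂ) (j / L) * fhat F (j : ZMod L))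
        * Complex.exp ((2 * Real.pi * j / L * ξ : ℝ) * Complex.I) := by
  have hS : Summable fun y : ℤ => φ (ξ - y) * F (y : ZMod L) := by
    refine Summable.of_norm_bounded ((summable_schwartz_sub φ ξ).mul_right (∑ x, ‖F x‖))
      fun y => ?_
    rw [norm_mul]
    exact mul_le_mul_of_nonneg_left (Finset.single_le_sum (f := fun x => ‖F x‖)
      (fun x _ => norm_nonneg _) (Finset.mem_univ _)) (norm_nonneg _)
  have hsj : Summable fun j : ℤ => ‖𝓕 (φ : ℝ → ℂ) (j / L)‖ := by
    simpa using summable_pow_mul_fourier (L := L) φ 0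
  set G : ℤ → ZMod L → ℂ := fun j x => 𝓕 (φ : ℝ → ℂ) (j / L)
    * ZMod.stdAddChar (-((j : ZMod L) * x))
    * Complex.exp ((2 * Real.pi * j / L * ξ : ℝ) * Complex.I) with hG
  have hGs : ∀ x, Summable fun j => G j x := fun x => by
    refine Summable.of_norm_bounded hsj fun j => ?_
    simp only [hG]
    rw [norm_mul, norm_mul, norm_stdAddChar, Complex.norm_exp_ofReal_mul_I, mul_one, mul_one]
  have h1 : ∀ r : ℕ, ∑' q : ℤ, φ (ξ - ((q * L + r : ℤ) : ℝ)) * F ((q * L + r : ℤ) : ZMod L)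
      = 1 / (L : ℂ) * ∑' j : ℤ, G j (r : ZMod L) * F (r : ZMod L) := by
    intro r
    have e1 : ∀ q : ℤ, ((q * L + r : ℤ) : ZMod L) = (r : ZMod L) := fun q => by
      push_cast
      rw [ZMod.natCast_self, mul_zero, zero_add]
    simp_rw [e1]
    rw [tsum_mul_right, tsum_class, tsum_mul_right, mul_assoc]
  rw [tsum_residue (L := L) hS]
  simp_rw [h1]
  rw [← Finset.mul_sum, sum_range_natCast fun x => ∑' j : ℤ, G j x * F x,
    ← Summable.tsum_finsetSum fun x _ => (hGs x).mul_right (F x)]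
  congr 1
  refine tsum_congr fun j => ?_
  simp only [hG, fhat]
  rw [Finset.mul_sum, Finset.sum_mul]
  exact Finset.sum_congr rfl fun x _ => by ring

end Poisson

/-! ### Summing the modes -/

/-- The Gaussian decreases on the positive half line, so the sum is at most the half line integral.
-/
theorem sum_exp_neg_mul_sq_le {α : ℝ} (hα : 0 < α) (N : ℕ) :
    ∑ i ∈ Finset.range N, Real.exp (-α * ((i + 1 : ℕ) : ℝ) ^ 2) ≤ √(Real.pi / α) / 2 := by
  have hanti : AntitoneOn (fun x : ℝ => Real.exp (-α * x ^ 2)) (Icc 0 (0 + (N : ℝ))) := by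
    intro x hx y _ hxy
    refine Real.exp_le_exp.mpr ?_
    have := mul_le_mul_of_nonneg_left (pow_le_pow_left₀ hx.1 hxy 2) hα.le
    linarith
  have h := hanti.sum_le_integral
  simp only [zero_add] at h
  refine h.trans ?_
  rw [← integral_gaussian_Ioi, intervalIntegral.integral_of_le (Nat.cast_nonneg N)]
  exact setIntegral_mono_set (integrable_exp_neg_mul_sq hα).integrableOn
    (Filter.Eventually.of_forall fun x => (Real.exp_pos _).le)
    (LE.le.eventuallyLE fun x hx => hx.1)

/-- The lattice sum of the heat kernel in dimension one. -/
theorem sum_sq_mul_exp_le {c b : ℝ} (hc : 0 < c) (hb : 0 < b) (N : ℕ) :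
    ∑ j ∈ Finset.Icc (-(N : ℤ)) N, (b * (j : ℝ)) ^ 2 * Real.exp (-(c * (b * (j : ℝ)) ^ 2))
      ≤ 2 / c * √(Real.pi / (c / 2 * b ^ 2)) := by
  have heven : Function.Even fun j : ℤ =>
      (b * (j : ℝ)) ^ 2 * Real.exp (-(c * (b * (j : ℝ)) ^ 2)) := by
    intro j; simp
  rw [Finset.sum_Icc_of_even_eq_range heven, Finset.sum_range_succ']
  simp only [Nat.cast_zero, Int.cast_zero, mul_zero, ne_eq, OfNat.ofNat_ne_zero, not_false_eq_true,
    zero_pow, zero_mul, add_zero, sub_zero, nsmul_eq_mul, Nat.cast_ofNat]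
  have hα : 0 < c / 2 * b ^ 2 := by positivity
  have h := sum_exp_neg_mul_sq_le hα N
  -- Half of the exponent absorbs the prefactor; the other half is summed as a Gaussian.
  have hle : ∑ i ∈ Finset.range N, (b * (((i + 1 : ℕ) : ℤ) : ℝ)) ^ 2
      * Real.exp (-(c * (b * (((i + 1 : ℕ) : ℤ) : ℝ)) ^ 2))
      ≤ ∑ i ∈ Finset.range N, 2 / c * Real.exp (-(c / 2 * b ^ 2) * ((i + 1 : ℕ) : ℝ) ^ 2) := by
    refine Finset.sum_le_sum fun i _ => ?_
    rw [Int.cast_natCast]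
    set x : ℝ := (b * ((i + 1 : ℕ) : ℝ)) ^ 2 with hx
    have e1 : Real.exp (-(c * x)) = Real.exp (-(c / 2) * x) * Real.exp (-(c / 2) * x) := by
      rw [← Real.exp_add]; congr 1; ring
    have e2 : -(c / 2 * b ^ 2) * ((i + 1 : ℕ) : ℝ) ^ 2 = -(c / 2) * x := by rw [hx]; ring
    have h1 := mul_exp_neg_le (a := c / 2) (t := x) (by positivity)
    rw [one_div_div] at h1
    rw [e1, e2, ← mul_assoc]
    exact mul_le_mul_of_nonneg_right h1 (Real.exp_pos _).le
  rw [← Finset.mul_sum] at hle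
  calc _ ≤ 2 * (2 / c * (√(Real.pi / (c / 2 * b ^ 2)) / 2)) :=
        mul_le_mul_of_nonneg_left (hle.trans (mul_le_mul_of_nonneg_left h (by positivity)))
          (by norm_num)
    _ = _ := by ring

/-- From y^(3/2) ≤ 1 + y² ≤ 2 exp y with y = ct; the exponential error is thereby put on the
diffusive scale. -/
theorem exp_neg_le_rpow {c : ℝ} (hc : 0 < c) {t : ℝ} (ht : 0 < t) :
    Real.exp (-c * t) ≤ 2 * c ^ (-(3 / 2) : ℝ) * t ^ (-(3 / 2) : ℝ) := by
  have hx : 0 < c * t := by positivity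
  have h1 : (c * t) ^ (3 / 2 : ℝ) ≤ 1 + (c * t) ^ 2 := by
    rcases le_total (c * t) 1 with h | h
    · have := Real.rpow_le_one hx.le h (by norm_num : (0 : ℝ) ≤ 3 / 2)
      have := sq_nonneg (c * t)
      linarith
    · have := Real.rpow_le_rpow_of_exponent_le h (by norm_num : (3 / 2 : ℝ) ≤ (2 : ℕ))
      rw [Real.rpow_natCast] at this
      linarith
  have h2 := Real.quadratic_le_exp_of_nonneg hx.le
  have h3 : (c * t) ^ (3 / 2 : ℝ) ≤ 2 * Real.exp (c * t) := by linarith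
  rw [mul_assoc, ← Real.mul_rpow hc.le ht.le, Real.rpow_neg hx.le, neg_mul, Real.exp_neg,
    ← div_eq_mul_inv, inv_le_comm₀ (Real.exp_pos _) (by positivity), inv_div,
    div_le_iff₀ (by norm_num)]
  linarith

theorem rpow_neg_three_half {t : ℝ} (ht : 0 < t) : t ^ (-(3 / 2) : ℝ) = 1 / (t * √t) := by
  rw [Real.rpow_neg ht.le, Real.sqrt_eq_rpow, ← Real.rpow_one_add' ht.le (by norm_num), one_div]
  norm_num

/-- The sum of the diffusive mode bounds over the dual lattice decays like `t ^ (-3/2)`. -/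
theorem exists_sum_modes_le {c : ℝ} (hc : 0 < c) :
    ∃ K > 0, ∀ (L : ℕ) [NeZero L] (t : ℝ), 0 < t →
      ∑ j ∈ Finset.Icc (-((L / 2 : ℕ) : ℤ)) ((L / 2 : ℕ) : ℤ),
        ((2 * Real.pi * j / L) ^ 2 * Real.exp (-(c * (2 * Real.pi * j / L) ^ 2) * t)
          + Real.exp (-c * t)) ≤ K * (L * t ^ (-(3 / 2) : ℝ)) := by
  refine ⟨2 / c * √(Real.pi / (c / 2 * (2 * Real.pi) ^ 2)) + 2 * (2 * c ^ (-(3 / 2) : ℝ)),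
    by positivity, fun L _ t ht => ?_⟩
  have hL := natCast_pos' (L := L)
  rw [Finset.sum_add_distrib, add_mul]
  refine add_le_add ?_ ?_
  · have h := sum_sq_mul_exp_le (c := c * t) (b := 2 * Real.pi / L) (by positivity)
      (by positivity) (L / 2)
    have e1 : ∀ j : ℤ, 2 * Real.pi * j / L = 2 * Real.pi / L * j := fun j => by ring
    have e2 : ∀ x : ℝ, -(c * x) * t = -(c * t * x) := fun x => by ring
    simp_rw [e1, e2]
    refine h.trans (le_of_eq ?_)
    -- The Gaussian sum contributes L/√t and the absorbed prefactor 1/t, together L t^(-3/2).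
    have e3 : Real.pi / (c * t / 2 * (2 * Real.pi / L) ^ 2)
        = Real.pi / (c / 2 * (2 * Real.pi) ^ 2) * ((L : ℝ) ^ 2 / t) := by field_simp
    rw [e3, Real.sqrt_mul (by positivity), Real.sqrt_div (sq_nonneg (L : ℝ)), Real.sqrt_sq hL.le,
      rpow_neg_three_half ht]
    field_simp
  · rw [Finset.sum_const, nsmul_eq_mul]
    -- The interval has 2⌊L/2⌋ + 1 ≤ L + 1 ≤ 2L elements.
    have hcard : ((Finset.Icc (-((L / 2 : ℕ) : ℤ)) ((L / 2 : ℕ) : ℤ)).card : ℝ) ≤ 2 * L := by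
      have h1 : (Finset.Icc (-((L / 2 : ℕ) : ℤ)) ((L / 2 : ℕ) : ℤ)).card ≤ 2 * L := by
        rw [Int.card_Icc]
        have := NeZero.pos L
        omega
      exact_mod_cast h1
    calc _ ≤ 2 * (L : ℝ) * (2 * c ^ (-(3 / 2) : ℝ) * t ^ (-(3 / 2) : ℝ)) :=
          mul_le_mul hcard (exp_neg_le_rpow hc ht) (Real.exp_pos _).le (by positivity)
      _ = _ := by ring

section Comparison

variable {L : ℕ} [NeZero L]

theorem norm_fourier_le (φ : 𝓢(ℝ, ℂ)) (p : ℝ) : ‖𝓕 (φ : ℝ → ℂ) p‖ ≤ ∫ x : ℝ, ‖φ x‖ :=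
  VectorFourier.norm_fourierIntegral_le_integral_norm _ _ _ _ _

/-- The heat flow damps with the true frequency 2πj/L, the lattice with its reduced representative.
For |j| < L/2 they coincide, which is why the remainder starts at L/2. -/
theorem freqSq_intCast {j : ℤ} (hj : |(j : ℝ)| < (L : ℝ) / 2) :
    freqSq (j : ZMod L) = (2 * Real.pi * j / L) ^ 2 := by
  have h : ((j : ZMod L)).valMinAbs = j := by
    rw [ZMod.valMinAbs_spec]
    refine ⟨rfl, ?_⟩
    rw [abs_lt] at hj
    have h1 : -(L : ℝ) < (j : ℝ) * 2 := by linarith [hj.1]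
    have h2 : (j : ℝ) * 2 ≤ L := by linarith [hj.2]
    exact ⟨by exact_mod_cast h1, by exact_mod_cast h2⟩
  unfold freqSq
  rw [h, mul_div_assoc]

omit [NeZero L] in
theorem mem_Icc_of_lt {j : ℤ} (hj : |(j : ℝ)| < (L : ℝ) / 2) :
    j ∈ Finset.Icc (-((L / 2 : ℕ) : ℤ)) ((L / 2 : ℕ) : ℤ) := by
  rw [abs_lt] at hj
  have h1 : -(L : ℝ) < (j : ℝ) * 2 := by linarith [hj.1]
  have h2 : (j : ℝ) * 2 < L := by linarith [hj.2]
  have h3 : -(L : ℤ) < j * 2 := by exact_mod_cast h1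
  have h4 : j * 2 < (L : ℤ) := by exact_mod_cast h2
  rw [Finset.mem_Icc]
  constructor <;> push_cast <;> omega

theorem Tobs_eq (φ : 𝓢(ℝ, ℂ)) (T : ℝ → ZMod L → ℝ) (t₀ t ξ : ℝ) :
    Tobs φ T t₀ t ξ = ∑' j : ℤ, 1 / (L : ℂ) * (𝓕 (φ : ℝ → ℂ) (j / L)
        * profileMode T (j : ZMod L) (t₀ + t))
      * Complex.exp ((2 * Real.pi * j / L * ξ : ℝ) * Complex.I) := by
  unfold Tobs profileMode
  rw [tsum_mul_periodic φ (fun x => (T (t₀ + t) x : ℂ)) ξ, ← tsum_mul_left]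
  exact tsum_congr fun j => by ring

/-- The heat flow of the observed profile. -/
theorem exists_prediction {κ : ℝ} (hκ : 0 < κ) (φ : 𝓢(ℝ, ℂ)) (T : ℝ → ZMod L → ℝ) (t₀ : ℝ) :
    ∃ u : ℝ → ℝ → ℂ, IsHeatSolution L κ (Tobs φ T t₀ 0) u ∧
      ∀ t ≥ 0, ∀ ξ, u t ξ = ∑' j : ℤ, Real.exp (-(κ * (2 * Real.pi * j / L) ^ 2) * t)
        * (1 / (L : ℂ) * (𝓕 (φ : ℝ → ℂ) (j / L) * profileMode T (j : ZMod L) t₀)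
          * Complex.exp ((2 * Real.pi * j / L * ξ : ℝ) * Complex.I)) := by
  have hL := natCast_pos' (L := L)
  set b : ℝ := 2 * Real.pi / L with hb
  set B : ℝ := ∑ n : ZMod L, ‖profileMode T n t₀‖ with hB
  have hB0 : 0 ≤ B := by positivity
  have hS : Summable fun j : ℤ => ‖1 / (L : ℂ) * (𝓕 (φ : ℝ → ℂ) (j / L)
      * profileMode T (j : ZMod L) t₀)‖
        * (1 + κ * (2 * Real.pi * j / L) ^ 2 + |2 * Real.pi * j / L|) ^ 2 := by
    -- A C² solution needs weights up to j⁴: (1 + κw² + |w|)² ≤ 3(1 + w² + κ²w⁴).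
    have s0 := summable_pow_mul_fourier (L := L) φ 0
    have s2 := (summable_pow_mul_fourier (L := L) φ 2).mul_left (b ^ 2)
    have s4 := (summable_pow_mul_fourier (L := L) φ 4).mul_left (κ ^ 2 * b ^ 4)
    refine Summable.of_nonneg_of_le (fun j => by positivity) (fun j => ?_)
      (((s0.add s2).add s4).mul_left (1 / (L : ℝ) * B * 3))
    have e1 : 2 * Real.pi * j / L = b * j := by rw [hb]; ring
    have h1 : ‖profileMode T (j : ZMod L) t₀‖ ≤ B :=
      Finset.single_le_sum (f := fun n => ‖profileMode T n t₀‖) (fun _ _ => norm_nonneg _)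
        (Finset.mem_univ _)
    have h2 : (1 + κ * (b * j) ^ 2 + |b * (j : ℝ)|) ^ 2
        ≤ 3 * (1 + b ^ 2 * |(j : ℝ)| ^ 2 + κ ^ 2 * b ^ 4 * |(j : ℝ)| ^ 4) := by
      set y := |b * (j : ℝ)| with hy
      have hy2 : (b * (j : ℝ)) ^ 2 = y ^ 2 := (sq_abs _).symm
      have hy3 : b ^ 2 * |(j : ℝ)| ^ 2 = y ^ 2 := by rw [sq_abs, ← hy2]; ring
      have hy4 : κ ^ 2 * b ^ 4 * |(j : ℝ)| ^ 4 = (κ * y ^ 2) ^ 2 := by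
        rw [← hy3]; ring
      rw [hy2, hy3, hy4]
      have := sq_nonneg (1 - κ * y ^ 2)
      have := sq_nonneg (1 - y)
      have := sq_nonneg (κ * y ^ 2 - y)
      linarith
    rw [norm_mul, norm_mul, norm_div, norm_one, Complex.norm_natCast, e1]
    calc _ ≤ 1 / (L : ℝ) * (‖𝓕 (φ : ℝ → ℂ) (j / L)‖ * B)
          * (3 * (1 + b ^ 2 * |(j : ℝ)| ^ 2 + κ ^ 2 * b ^ 4 * |(j : ℝ)| ^ 4)) :=
          mul_le_mul (mul_le_mul_of_nonneg_left (mul_le_mul_of_nonneg_left h1 (norm_nonneg _))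
            (by positivity)) h2 (by positivity) (by positivity)
      _ = _ := by ring
  obtain ⟨u, hu, hu2⟩ := exists_heatSolution hL hκ (w := fun j => 2 * Real.pi * j / L)
    (fun j => rfl) hS
  refine ⟨u, ?_, hu2⟩
  have e : Tobs φ T t₀ 0 = fun ξ => ∑' j : ℤ, 1 / (L : ℂ) * (𝓕 (φ : ℝ → ℂ) (j / L)
      * profileMode T (j : ZMod L) t₀) * Complex.exp ((2 * Real.pi * j / L * ξ : ℝ) * Complex.I) := by
    funext ξ
    rw [Tobs_eq, add_zero]
  rw [e]
  exact hu

/-- If the modes diffuse, then the heat flow predicts the profile. -/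
theorem norm_prediction_sub_le {κ c A K : ℝ} (hκ : 0 < κ) (hA : 0 ≤ A)
    (φ : 𝓢(ℝ, ℂ)) (T : ℝ → ZMod L → ℝ) {t₀ t : ℝ} (ht₀ : 0 < t₀) (ht : 0 ≤ t)
    (hbd : ∀ n : ZMod L, ∀ s ≥ 0, ‖profileMode T n s‖ ≤ A * L)
    (hdiff : ∀ n : ZMod L, ‖profileMode T n (t₀ + t)
        - Real.exp (-(κ * freqSq n) * t) * profileMode T n t₀‖
      ≤ A * L * (freqSq n * Real.exp (-(c * freqSq n) * t₀) + Real.exp (-c * t₀)))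
    (hK : ∑ j ∈ Finset.Icc (-((L / 2 : ℕ) : ℤ)) ((L / 2 : ℕ) : ℤ),
        ((2 * Real.pi * j / L) ^ 2 * Real.exp (-(c * (2 * Real.pi * j / L) ^ 2) * t₀)
          + Real.exp (-c * t₀)) ≤ K) (ξ : ℝ) :
    ‖(∑' j : ℤ, Real.exp (-(κ * (2 * Real.pi * j / L) ^ 2) * t)
        * (1 / (L : ℂ) * (𝓕 (φ : ℝ → ℂ) (j / L) * profileMode T (j : ZMod L) t₀)
          * Complex.exp ((2 * Real.pi * j / L * ξ : ℝ) * Complex.I))) - Tobs φ T t₀ t ξ‖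
      ≤ A * K * (∫ x : ℝ, ‖φ x‖)
        + 2 * A * ∑' n : {n : ℤ // (L : ℝ) / 2 ≤ |(n : ℝ)|}, ‖𝓕 (φ : ℝ → ℂ) ((n : ℤ) / (L : ℝ))‖ := by
  have hL := natCast_pos' (L := L)
  have hsj : Summable fun j : ℤ => ‖𝓕 (φ : ℝ → ℂ) (j / L)‖ := by
    simpa using summable_pow_mul_fourier (L := L) φ 0
  set I : ℝ := ∫ x : ℝ, ‖φ x‖ with hI
  have hI0 : 0 ≤ I := integral_nonneg fun x => norm_nonneg _
  set J := Finset.Icc (-((L / 2 : ℕ) : ℤ)) ((L / 2 : ℕ) : ℤ) with hJ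
  set H : ℤ → ℝ := fun j => (2 * Real.pi * j / L) ^ 2
    * Real.exp (-(c * (2 * Real.pi * j / L) ^ 2) * t₀) + Real.exp (-c * t₀) with hH
  have hH0 : ∀ j, 0 ≤ H j := fun j => by simp only [hH]; positivity
  set S : Set ℤ := {n : ℤ | (L : ℝ) / 2 ≤ |(n : ℝ)|} with hS
  have hexp : ∀ j : ℤ, Real.exp (-(κ * (2 * Real.pi * j / L) ^ 2) * t) ≤ 1 := fun j =>
    Real.exp_le_one_iff.mpr (by
      have : 0 ≤ κ * (2 * Real.pi * j / L) ^ 2 * t := by positivity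
      linarith)
  -- D j is the error of the j-th mode. Below L/2 it is the diffusive error; from L/2 on the aliased
  -- lattice mode need not match, and the uniform bound on both terms is used.
  set D : ℤ → ℂ := fun j => Real.exp (-(κ * (2 * Real.pi * j / L) ^ 2) * t)
    * profileMode T (j : ZMod L) t₀ - profileMode T (j : ZMod L) (t₀ + t) with hD
  have hD2 : ∀ j, ‖D j‖ ≤ 2 * (A * L) := by
    intro j
    have h1 := hbd (j : ZMod L) t₀ ht₀.le
    have h2 := hbd (j : ZMod L) (t₀ + t) (by positivity)
    simp only [hD]
    refine (norm_sub_le _ _).trans ?_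
    rw [norm_mul, Complex.norm_real, Real.norm_eq_abs, Real.abs_exp]
    have h3 := mul_le_of_le_one_left (norm_nonneg (profileMode T (j : ZMod L) t₀)) (hexp j)
    linarith
  have hDH : ∀ j ∉ S, ‖D j‖ ≤ A * L * H j := by
    intro j hj
    have hj' : |(j : ℝ)| < (L : ℝ) / 2 := not_le.mp hj
    have h1 := hdiff (j : ZMod L)
    rw [freqSq_intCast hj', norm_sub_rev] at h1
    exact h1
  have e : ∀ j : ℤ, Real.exp (-(κ * (2 * Real.pi * j / L) ^ 2) * t)
        * (1 / (L : ℂ) * (𝓕 (φ : ℝ → ℂ) (j / L) * profileMode T (j : ZMod L) t₀)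
          * Complex.exp ((2 * Real.pi * j / L * ξ : ℝ) * Complex.I))
        - 1 / (L : ℂ) * (𝓕 (φ : ℝ → ℂ) (j / L) * profileMode T (j : ZMod L) (t₀ + t))
          * Complex.exp ((2 * Real.pi * j / L * ξ : ℝ) * Complex.I)
      = 1 / (L : ℂ) * 𝓕 (φ : ℝ → ℂ) (j / L) * D j
        * Complex.exp ((2 * Real.pi * j / L * ξ : ℝ) * Complex.I) := fun j => by
    simp only [hD]; ring
  have hnorm : ∀ (j : ℤ) (z : ℂ), ‖1 / (L : ℂ) * 𝓕 (φ : ℝ → ℂ) (j / L) * z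
      * Complex.exp ((2 * Real.pi * j / L * ξ : ℝ) * Complex.I)‖
      = 1 / (L : ℝ) * ‖𝓕 (φ : ℝ → ℂ) (j / L)‖ * ‖z‖ := by
    intro j z
    rw [norm_mul, norm_mul, norm_mul, Complex.norm_exp_ofReal_mul_I, mul_one, norm_div, norm_one,
      Complex.norm_natCast]
  have s1 : ∀ z : ℤ → ℂ, (∀ j, ‖z j‖ ≤ A * L) → Summable fun j : ℤ =>
      1 / (L : ℂ) * 𝓕 (φ : ℝ → ℂ) (j / L) * z j
        * Complex.exp ((2 * Real.pi * j / L * ξ : ℝ) * Complex.I) := by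
    intro z hz
    refine Summable.of_norm_bounded (hsj.mul_left (1 / (L : ℝ) * (A * L))) fun j => ?_
    rw [hnorm]
    calc _ ≤ 1 / (L : ℝ) * ‖𝓕 (φ : ℝ → ℂ) (j / L)‖ * (A * L) :=
          mul_le_mul_of_nonneg_left (hz j) (by positivity)
      _ = _ := by ring
  have sA : Summable fun j : ℤ => Real.exp (-(κ * (2 * Real.pi * j / L) ^ 2) * t)
        * (1 / (L : ℂ) * (𝓕 (φ : ℝ → ℂ) (j / L) * profileMode T (j : ZMod L) t₀)
          * Complex.exp ((2 * Real.pi * j / L * ξ : ℝ) * Complex.I)) := by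
    refine (s1 (fun j => Real.exp (-(κ * (2 * Real.pi * j / L) ^ 2) * t)
      * profileMode T (j : ZMod L) t₀) fun j => ?_).congr fun j => by ring
    rw [norm_mul, Complex.norm_real, Real.norm_eq_abs, Real.abs_exp]
    exact (mul_le_of_le_one_left (norm_nonneg _) (hexp j)).trans (hbd _ t₀ ht₀.le)
  have sB : Summable fun j : ℤ => 1 / (L : ℂ) * (𝓕 (φ : ℝ → ℂ) (j / L)
      * profileMode T (j : ZMod L) (t₀ + t))
        * Complex.exp ((2 * Real.pi * j / L * ξ : ℝ) * Complex.I) :=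
    (s1 (fun j => profileMode T (j : ZMod L) (t₀ + t)) fun j => hbd _ _ (by positivity)).congr
      fun j => by ring
  rw [Tobs_eq, ← sA.tsum_sub sB]
  simp_rw [e]
  have sS : Summable (S.indicator fun j : ℤ => 2 * A * ‖𝓕 (φ : ℝ → ℂ) (j / L)‖) :=
    (hsj.mul_left (2 * A)).indicator S
  have sJ : Summable ((J : Set ℤ).indicator fun j : ℤ => A * I * H j) :=
    summable_of_ne_finset_zero (s := J) fun j hj => Set.indicator_of_notMem (by simpa using hj) _
  refine (tsum_of_norm_bounded (sJ.add sS).hasSum fun j => ?_).trans ?_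
  · rw [hnorm]
    by_cases hj : j ∈ S
    · rw [Set.indicator_of_mem hj]
      refine le_trans ?_ (le_add_of_nonneg_left (Set.indicator_nonneg
        (fun j _ => mul_nonneg (mul_nonneg hA hI0) (hH0 j)) j))
      calc _ ≤ 1 / (L : ℝ) * ‖𝓕 (φ : ℝ → ℂ) (j / L)‖ * (2 * (A * L)) :=
            mul_le_mul_of_nonneg_left (hD2 j) (by positivity)
        _ = _ := by field_simp
    · have hjJ : j ∈ (J : Set ℤ) := Finset.mem_coe.mpr (mem_Icc_of_lt (not_le.mp hj))
      rw [Set.indicator_of_notMem hj, Set.indicator_of_mem hjJ, add_zero]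
      calc _ ≤ 1 / (L : ℝ) * I * (A * L * H j) :=
            mul_le_mul (mul_le_mul_of_nonneg_left (norm_fourier_le φ _) (by positivity)) (hDH j hj)
              (norm_nonneg _) (by positivity)
        _ = _ := by field_simp
  · have eJ : ∑' j, (J : Set ℤ).indicator (fun j : ℤ => A * I * H j) j = A * I * ∑ j ∈ J, H j := by
      rw [Finset.mul_sum]
      exact (tsum_subtype (J : Set ℤ) _).symm.trans (Finset.tsum_subtype J fun j => A * I * H j)
    rw [sJ.tsum_add sS, eJ, ← tsum_subtype, tsum_mul_left, mul_right_comm A K]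
    exact add_le_add (mul_le_mul_of_nonneg_left hK (by positivity)) le_rfl

end Comparison

end

end VelocityFlip

/-! ### Assembly of the corollary -/

theorem corollary4p4 (Φ : ℤ → ℝ) (γ : ℝ) (hΦγ : VelocityFlip.IsAdmissible Φ γ) :
    ∃ L₀ : ℕ, ∃ C > (0 : ℝ), ∀ (L : ℕ) [NeZero L], L₀ ≤ L →
      0 < VelocityFlip.kappa Φ γ L ∧
      ∀ (μ : Measure (VelocityFlip.Phase L)) [IsProbabilityMeasure μ],
        VelocityFlip.HasSecondMoments μ →
        -- the temperature profile exists and is unique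
        ∃ T : ℝ → ZMod L → ℝ, VelocityFlip.IsTemperatureProfile Φ γ L μ T ∧
          (∀ T' : ℝ → ZMod L → ℝ, VelocityFlip.IsTemperatureProfile Φ γ L μ T' →
            ∀ t ≥ 0, ∀ x : ZMod L, T' t x = T t x) ∧
          ∀ (φ : 𝓢(ℝ, ℂ)) (t₀ : ℝ), 0 < t₀ →
            -- the predicted profile exists and is unique
            ∃ Tpred : ℝ → ℝ → ℂ,
              VelocityFlip.IsHeatSolution L (VelocityFlip.kappa Φ γ L)
                (VelocityFlip.Tobs φ T t₀ 0) Tpred ∧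
              (∀ u : ℝ → ℝ → ℂ,
                VelocityFlip.IsHeatSolution L (VelocityFlip.kappa Φ γ L)
                  (VelocityFlip.Tobs φ T t₀ 0) u →
                ∀ t ≥ 0, ∀ ξ : ℝ, u t ξ = Tpred t ξ) ∧
              (∀ t ≥ 0, ∀ ξ : ℝ,
                ‖Tpred t ξ - VelocityFlip.Tobs φ T t₀ t ξ‖ ≤
                  C * VelocityFlip.energyDensity Φ L μ * L * t₀ ^ (-(3 / 2) : ℝ) *
                      ((∫ x : ℝ, ‖φ x‖) + ⨆ ξ' : ℝ, ∑' y : ℤ, ‖φ (ξ' - y)‖) +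
                    C * VelocityFlip.energyDensity Φ L μ *
                      ∑' n : {n : ℤ // (L : ℝ) / 2 ≤ |(n : ℝ)|},
                        ‖𝓕 (φ : ℝ → ℂ) ((n : ℤ) / (L : ℝ))‖) ∧
              ((∀ x : ℝ, 0 ≤ (φ x).re ∧ (φ x).im = 0) → (∫ x : ℝ, φ x) = 1 →
                (∀ p : ℝ, 1 / 2 ≤ |p| → 𝓕 (φ : ℝ → ℂ) p = 0) →
                ∀ t ≥ 0, ∀ ξ : ℝ,
                  ‖Tpred t ξ - VelocityFlip.Tobs φ T t₀ t ξ‖ ≤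
                    2 * C * VelocityFlip.energyDensity Φ L μ * L * t₀ ^ (-(3 / 2) : ℝ)) := by
  obtain ⟨L₀, c, hc, C, hC, hprof⟩ := VelocityFlip.profile_diffusive hΦγ
  obtain ⟨K, hK, hsum⟩ := VelocityFlip.exists_sum_modes_le hc
  have hCle : 2 * C ≤ 2 * C + C * K := by linarith [mul_pos hC hK]
  have hKle : C * K ≤ 2 * C + C * K := by linarith
  -- One constant serves both terms: CK for the diffusive error summed over the dual lattice, 2C for
  -- the two uniformly bounded terms in the tail of φ̂.
  refine ⟨L₀, 2 * C + C * K, by positivity, fun L _ hL => ?_⟩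
  obtain ⟨hκ, hT⟩ := hprof L hL
  refine ⟨hκ, fun μ _ hμ => ?_⟩
  obtain ⟨T, -, hTsol, hTuniq, hmode⟩ := hT μ hμ
  refine ⟨T, hTsol, hTuniq, fun φ t₀ ht₀ => ?_⟩
  have hLpos : (0 : ℝ) < L := VelocityFlip.natCast_pos'
  have hE := VelocityFlip.energyDensity_nonneg (L := L) hΦγ μ
  set e := VelocityFlip.energyDensity Φ L μ with he
  set I : ℝ := ∫ x : ℝ, ‖φ x‖ with hI
  set R : ℝ := ∑' n : {n : ℤ // (L : ℝ) / 2 ≤ |(n : ℝ)|}, ‖𝓕 (φ : ℝ → ℂ) ((n : ℤ) / (L : ℝ))‖ with hR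
  set τ : ℝ := t₀ ^ (-(3 / 2) : ℝ) with hτ
  have hτ0 : 0 < τ := Real.rpow_pos_of_pos ht₀ _
  have hI0 : 0 ≤ I := integral_nonneg fun x => norm_nonneg _
  have hR0 : 0 ≤ R := tsum_nonneg fun n => norm_nonneg _
  obtain ⟨u, hu, hueq⟩ := VelocityFlip.exists_prediction hκ φ T t₀
  have hA : ∀ x, C * (L * e) * x = C * e * L * x := fun x => by ring
  have hmain : ∀ t ≥ 0, ∀ ξ : ℝ, ‖u t ξ - VelocityFlip.Tobs φ T t₀ t ξ‖
      ≤ (2 * C + C * K) * e * L * τ * I + (2 * C + C * K) * e * R := by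
    intro t ht ξ
    rw [hueq t ht ξ]
    refine (VelocityFlip.norm_prediction_sub_le (c := c) (A := C * e) (K := K * (L * τ)) hκ
      (by positivity) φ T ht₀ ht
      (fun n s hs => ((hmode n).1 s hs).trans (le_of_eq (by ring)))
      (fun n => ((hmode n).2 t₀ ht₀.le t ht).trans (le_of_eq (hA _))) (hsum L t₀ ht₀) ξ).trans ?_
    refine add_le_add ?_ ?_
    · calc C * e * (K * (L * τ)) * I = C * K * (e * L * τ * I) := by ring
        _ ≤ (2 * C + C * K) * (e * L * τ * I) :=
          mul_le_mul_of_nonneg_right hKle (by positivity)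
        _ = _ := by ring
    · calc 2 * (C * e) * R = 2 * C * (e * R) := by ring
        _ ≤ (2 * C + C * K) * (e * R) := mul_le_mul_of_nonneg_right hCle (by positivity)
        _ = _ := by ring
  refine ⟨u, hu, fun w hw t ht ξ => hw.unique hLpos hκ hu t ht ξ, fun t ht ξ => ?_,
    fun hpos hint hsupp t ht ξ => ?_⟩
  · refine (hmain t ht ξ).trans (add_le_add ?_ le_rfl)
    refine mul_le_mul_of_nonneg_left (le_add_of_nonneg_right ?_) (by positivity)
    -- The error is already bounded with ‖φ‖₁ alone; the supremum, being nonnegative, only enlarges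
    -- the right side.
    exact Real.iSup_nonneg fun ξ' => tsum_nonneg fun y => norm_nonneg _
  -- For φ ≥ 0 of integral one ‖φ‖₁ = 1, and for |n| ≥ L/2 the frequency n/L lies where φ̂ vanishes.
  -- What remains is one copy of the rate; the factor 2 is slack.
  · have hI1 : I = 1 := by
      have h1 : ∀ x, ((‖φ x‖ : ℝ) : ℂ) = φ x := fun x => by
        have h2 : φ x = ((φ x).re : ℂ) := Complex.ext (by simp) (by simp [(hpos x).2])
        rw [h2, Complex.norm_real, Real.norm_of_nonneg (hpos x).1]
      have h3 : ((I : ℝ) : ℂ) = 1 := by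
        rw [hI, ← integral_complex_ofReal]
        simp_rw [h1]
        exact hint
      exact_mod_cast h3
    have hR1 : R = 0 := by
      rw [hR]
      have : ∀ n : {n : ℤ // (L : ℝ) / 2 ≤ |(n : ℝ)|},
          ‖𝓕 (φ : ℝ → ℂ) ((n : ℤ) / (L : ℝ))‖ = 0 := fun n => by
        rw [hsupp _ ?_, norm_zero]
        rw [abs_div, abs_of_pos hLpos, le_div_iff₀ hLpos]
        linarith [n.2]
      simp_rw [this]
      exact tsum_zero
    refine (hmain t ht ξ).trans ?_
    rw [hI1, hR1, mul_one, mul_zero, add_zero]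
    have : 0 ≤ (2 * C + C * K) * e * L * τ := by positivity
    linarith
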